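/- \textbf{Setting.} Let $d\in\{2,3\}$, let $\Omega\subset\mathbb R^d$ be a bounded polyhedral open set with $\Omega=\operatorname{int}\overline\Omega$ (e.g. a bounded polyhedral Lipschitz domain), $\Gamma=\partial\Omega$, and let $\alpha\in L^\infty(\Omega)$, $\kappa\in L^\infty(\Gamma)$ be uniformly positive. Fix a polynomial degree $k\ge 1$ and a parameter $\sigma$. Let $\mathcal T$ be a conforming simplicial triangulation of $\overline\Omega$ with maximal mesh width $h$ (the largest element diameter) which is quasi-uniform with parameter $\sigma$, i.e. every element contains a ball of some radius $\rho>0$ with $h\le\sigma\rho$. Let $\mathcal T_\Gamma$ be a conforming triangulation of $\Gamma$ which refines the restriction $\mathcal T|_\Gamma$. Let $\mathbb V_h=\mathcal P_k(\mathcal T)\subset H^1(\Omega)$ be the Lagrange finite element space with nodal basis $(\varphi_i)$, interior nodes ordered first and boundary nodes last; let $\mathbb M_h=\mathcal P_k(\mathcal T|_\Gamma)=\mathbb V_h|_\Gamma$ with the traces of the boundary nodal functions as basis $(\mu_i)$; and let $\mathbb Q_h\subset H^1(\Gamma)$ be any space of continuous piecewise polynomials on $\mathcal T_\Gamma$, with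 basis $(\psi_j)$. Put $$(M_u)_{ij}=\int_\Omega\varphi_i\varphi_j,\quad (K_u)_{ij}=\int_\Omega\alpha\nabla\varphi_i\cdot\nabla\varphi_j,\quad (M_p)_{ij}=\int_\Gamma\psi_i\psi_j,\quad (K_p)_{ij}=\int_\Gamma\kappa\nabla_\Gamma\psi_i\cdot\nabla_\Gamma\psi_j,$$ $$(B_u)_{ij}=\int_\Gamma\mu_i\varphi_j,\quad (B_p)_{ij}=\int_\Gamma\mu_i\psi_j,\quad (M_\lambda)_{ij}=\int_\Gamma\mu_i\mu_j,$$ so that $B_u=[\,0\ M_\lambda\,]$. Coefficient vectors of bulk functions are split as $u=(u_1,u_2)$ into interior and boundary nodes, $f_u=(f_1,f_2)$ likewise, and $M_{ij}$, $K_{ij}$ ($i,j=1,2$) are the corresponding blocks of $M_u$, $K_u$. Write $\|x\|_A^2=x^TAx$. The semi-discrete problem with right-hand sides $f_u(t),f_p(t)$ is $$M_u\dot u+K_uu-B_u^T\lambda=f_u,\qquad M_p\dot p+K_pp+B_p^T\lambda=f_p,\qquad B_uu-B_pp=0 .\tag{1}$$ For a step size $\tau>0$ put $t^n=n\tau$,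 $D_\tau x^n=\frac1{2\tau}(3x^n-4x^{n-1}+x^{n-2})$ and $\widetilde D_\tau x^n=\frac1{2\tau}(5x^n-8x^{n-1}+3x^{n-2})$. Given data $\hat u^j=u^j$, $p^j$ ($j=-2,-1,0$), the auxiliary scheme determines $\hat u^n=(u_1^n,\hat u_2^n)$, $p^n$, $\lambda^n$ for $n\ge1$, $t^n\le T$, by $$M_{11}D_\tau u_1^n+K_{11}u_1^n=f_1(t^n)-M_{12}M_\lambda^{-1}B_p\widetilde D_\tau p^{n-1}-K_{12}M_\lambda^{-1}B_p(2p^{n-1}-p^{n-2}),$$ $$M_{21}D_\tau u_1^n+K_{21}u_1^n-M_\lambda\lambda^n=f_2(t^n)-M_{22}M_\lambda^{-1}B_p\widetilde D_\tau p^{n-1}-K_{22}M_\lambda^{-1}B_p(2p^{n-1}-p^{n-2}),$$ $$M_pD_\tau p^n+K_pp^n+B_p^T\lambda^n=f_p(t^n),\qquad M_\lambda\hat u_2^n=B_pp^n .$$ \textbf{Theorem.} There are constants $h_0>0$ and $c>0$, depending only on $d$, $k$, $\sigma$, $\Omega$, $\alpha$, $\kappa$, and for all $T>0$ and $R,C_0\in\mathbb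 R$ there is a constant $C$, depending only on these data and on $T$, $R$, $C_0$ (in particular not on $\tau$, $h$, the triangulations, $\mathbb Q_h$, the right-hand sides, or the solution), such that the following holds. Let $h\le h_0$ and $0<\tau\le c\,h$. Suppose that the solution $(u,p,\lambda)$ of (1) extends to negative times, so that it solves (1) on $[-2\tau,T]$, and is regular: $u,p\in C^3([-2\tau,T])$ with $$\max_{[-2\tau,T]}\|\ddot p\|_{M_p}^2\le R,\qquad \int_{-2\tau}^T\|\dddot u\|_{M_u}^2+\|\dddot p\|_{M_p}^2\,ds\le R .$$ Suppose further that the initial data are consistent, $B_uu^j=B_pp^j$, and satisfy $$\|u^j-u(t^j)\|_{M_u}^2+\tau\|u^j-u(t^j)\|_{K_u}^2+\|p^j-p(t^j)\|_{M_p}^2+\tau\|p^j-p(t^j)\|_{K_p}^2\le C_0\tau^4\qquad(j=-2,-1,0).$$ Then the solution of the auxiliary scheme satisfies $$\|\hat u^n-u(t^n)\|_{K_u}^2+\|p^n-p(t^n)\|_{K_p}^2\le C\,\tau^3\qquad\text{for all } n\ge-2 \text{ with } t^n\le T .$$ -/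

import Mathlib

open MeasureTheory Matrix Set

noncomputable section

namespace BulkSurface

/-! ### Triangulations -/

/-- The ambient Euclidean space `ℝ^d`. -/
abbrev Space (d : ℕ) : Type := EuclideanSpace ℝ (Fin d)

/-- The closed simplex spanned by a finite set of vertices. -/
def simplex {d : ℕ} (K : Finset (Space d)) : Set (Space d) := convexHull ℝ (K : Set (Space d))

open scoped Classical in
/-- `𝒯` (given by the vertex sets of its elements) is a conforming triangulation of `S` into
nondegenerate closed `r`-simplices: any two elements meet in a common (possibly empty) face. -/
structure IsTriangulation {d : ℕ} (𝒯 : Finset (Finset (Space d))) (r : ℕ) (S : Set (Space d)) :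
    Prop where
  card_eq : ∀ K ∈ 𝒯, K.card = r + 1
  indep : ∀ K ∈ 𝒯, AffineIndependent ℝ (fun v : K => (v : Space d))
  inter : ∀ K ∈ 𝒯, ∀ L ∈ 𝒯, simplex K ∩ simplex L = simplex (K ∩ L)
  cover : ⋃ K ∈ 𝒯, simplex K = S

/-- The maximal mesh width `h`, i.e. the largest diameter of an element. -/
def meshWidth {d : ℕ} (𝒯 : Finset (Finset (Space d))) : ℝ :=
  ⨆ K : 𝒯, Metric.diam (simplex (K : Finset (Space d)))

/-- Quasi-uniformity with parameter `σ`: every element contains a ball of radius `ρ` with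
`h ≤ σ ρ`, where `h` is the maximal mesh width of the whole triangulation. -/
def QuasiUniform {d : ℕ} (σ : ℝ) (𝒯 : Finset (Finset (Space d))) : Prop :=
  ∀ K ∈ 𝒯, ∃ x : Space d, ∃ ρ : ℝ, 0 < ρ ∧ meshWidth 𝒯 ≤ σ * ρ ∧
    Metric.closedBall x ρ ⊆ simplex K

/-- The restriction of the bulk triangulation to the boundary: `G` is a facet of an element of `𝒯`
which lies on the boundary of `Ω`. -/
def IsBoundaryFacet {d : ℕ} (Ω : Set (Space d)) (𝒯 : Finset (Finset (Space d)))
    (G : Finset (Space d)) : Prop :=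
  G.card = d ∧ simplex G ⊆ frontier Ω ∧ ∃ K ∈ 𝒯, G ⊆ K

/-- `𝒯Γ` is a triangulation of the boundary of `Ω` that refines the restriction of `𝒯` to the
boundary. -/
structure IsBoundaryRefinement {d : ℕ} (Ω : Set (Space d)) (𝒯 𝒯Γ : Finset (Finset (Space d))) :
    Prop where
  triangulation : IsTriangulation 𝒯Γ (d - 1) (frontier Ω)
  refines : ∀ F ∈ 𝒯Γ, ∃ G, IsBoundaryFacet Ω 𝒯 G ∧ simplex F ⊆ simplex G

/-! ### The Lagrange finite element space of degree `k` on `𝒯` and its nodal basis -/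

/-- `w` is the vector of barycentric coordinates of `x` with respect to some element of `𝒯`
(extended by zero to all other points). -/
def IsBarycentric {d : ℕ} (𝒯 : Finset (Finset (Space d))) (x : Space d) (w : Space d → ℝ) : Prop :=
  ∃ K ∈ 𝒯, (∀ v ∈ K, 0 ≤ w v) ∧ (∀ v, v ∉ K → w v = 0) ∧ ∑ v ∈ K, w v = 1 ∧
    ∑ v ∈ K, w v • v = x

open scoped Classical in
/-- The hat function of the vertex `v`, i.e. the barycentric coordinate `λ_v(x)`. It does not depend
on the element containing `x`; outside of the triangulated set the value is zero. -/
def hat {d : ℕ} (𝒯 : Finset (Finset (Space d))) (v x : Space d) : ℝ :=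
  if h : ∃ w, IsBarycentric 𝒯 x w then h.choose v else 0

open scoped Classical in
/-- The Lagrange nodes of degree `k`, described by multi-indices `n` of order `k` which are supported
on the vertices of an element. The index `n` stands for the point `∑ v, (n v / k) • v`. -/
def nodes {d : ℕ} (𝒯 : Finset (Finset (Space d))) (k : ℕ) : Finset (Space d →₀ ℕ) :=
  𝒯.biUnion fun K => K.finsuppAntidiag k

/-- The position of a Lagrange node. -/
def nodePoint {d : ℕ} (k : ℕ) (n : Space d →₀ ℕ) : Space d :=
  n.sum fun v a => ((a : ℝ) / (k : ℝ)) • v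

/-- The Lagrange nodal basis function of degree `k` of the node `n`: the continuous function which is
a polynomial of degree at most `k` on every element, takes the value one in the node `n`,
and vanishes in all other nodes. -/
def lagrange {d : ℕ} (𝒯 : Finset (Finset (Space d))) (k : ℕ) (n : Space d →₀ ℕ) (x : Space d) : ℝ :=
  ∏ v ∈ n.support, ∏ m ∈ Finset.range (n v),
    ((k : ℝ) * hat 𝒯 v x - (m : ℝ)) / ((n v : ℝ) - (m : ℝ))

open scoped Classical in
/-- The nodes that do not lie on the boundary. -/
def interiorNodes {d : ℕ} (Ω : Set (Space d)) (𝒯 : Finset (Finset (Space d))) (k : ℕ) :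
    Finset (Space d →₀ ℕ) :=
  (nodes 𝒯 k).filter fun n => nodePoint k n ∉ frontier Ω

open scoped Classical in
/-- The nodes on the boundary. The traces of the corresponding basis functions are
the nodal basis of the multiplier space, the piecewise polynomials of degree `k` on the restriction
of `𝒯` to the boundary. -/
def boundaryNodes {d : ℕ} (Ω : Set (Space d)) (𝒯 : Finset (Finset (Space d))) (k : ℕ) :
    Finset (Space d →₀ ℕ) :=
  (nodes 𝒯 k).filter fun n => nodePoint k n ∈ frontier Ω

/-- The degrees of freedom of the bulk variable `u = (u₁, u₂)`: interior nodes (for `u₁`), then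
boundary nodes (for `u₂`). -/
abbrev BulkDof {d : ℕ} (Ω : Set (Space d)) (𝒯 : Finset (Finset (Space d))) (k : ℕ) : Type :=
  interiorNodes Ω 𝒯 k ⊕ boundaryNodes Ω 𝒯 k

/-- The nodal basis of the bulk finite element space. -/
def bulkBasis {d : ℕ} (Ω : Set (Space d)) (𝒯 : Finset (Finset (Space d))) (k : ℕ) :
    BulkDof Ω 𝒯 k → Space d → ℝ :=
  Sum.elim (fun n => lagrange 𝒯 k n) (fun n => lagrange 𝒯 k n)

/-! ### The finite element space on the boundary -/

/-- `ψ` is a basis of a conforming (i.e. contained in `H¹(Γ)`) finite element space on the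
triangulation `𝒯Γ` of the boundary `Γ`: linearly independent continuous functions on `Γ`
which are polynomial on every element. -/
structure IsSurfaceBasis {d N : ℕ} (Ω : Set (Space d)) (𝒯Γ : Finset (Finset (Space d)))
    (ψ : Fin N → Space d → ℝ) : Prop where
  indep : LinearIndependent ℝ fun j => (frontier Ω).domRestrict (ψ j)
  cont : ∀ j, ContinuousOn (ψ j) (frontier Ω)
  poly : ∀ j, ∀ F ∈ 𝒯Γ, ∃ P : MvPolynomial (Fin d) ℝ,
    ∀ x ∈ simplex F, ψ j x = MvPolynomial.eval (fun i => x i) P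

/-- The surface measure on the boundary of `Ω`. -/
def surfaceMeasure {d : ℕ} (Ω : Set (Space d)) : Measure (Space d) :=
  (μHE[d - 1] : Measure (Space d)).restrict (frontier Ω)

/-- The tangential gradient of `q` at a point `x` of the flat surface element `F`: the gradient of
`q` restricted to the affine hull of `F`, a vector in the direction space of `F`. -/
def tangentialGradient {d : ℕ} (F : Finset (Space d)) (q : Space d → ℝ) (x : Space d) : Space d :=
  gradient (fun y : Space d => q (x + (vectorSpan ℝ (F : Set (Space d))).starProjection y)) 0

/-- A coefficient in `L^∞(μ)` which is uniformly positive. -/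
def IsCoefficient {d : ℕ} (μ : Measure (Space d)) (a : Space d → ℝ) : Prop :=
  AEMeasurable a μ ∧ ∃ a₀ a₁ : ℝ, 0 < a₀ ∧ ∀ᵐ x ∂μ, a₀ ≤ a x ∧ a x ≤ a₁

/-! ### Mass, stiffness and coupling matrices -/

/-- The matrices of the semi-discrete problem. `I`, `B`, `P` are the index sets of `u₁`, of `u₂` (and of
the Lagrange multiplier), and of `p`. -/
structure SystemMatrices (I B P : Type) where
  Mu : Matrix (I ⊕ B) (I ⊕ B) ℝ
  Ku : Matrix (I ⊕ B) (I ⊕ B) ℝ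
  Mp : Matrix P P ℝ
  Kp : Matrix P P ℝ
  Bu : Matrix B (I ⊕ B) ℝ
  Bp : Matrix B P ℝ
  Mlam : Matrix B B ℝ

/-- The matrices of the finite element discretization. -/
def assemble {d N : ℕ} (Ω : Set (Space d)) (α κ : Space d → ℝ)
    (𝒯 𝒯Γ : Finset (Finset (Space d))) (k : ℕ) (ψ : Fin N → Space d → ℝ) :
    SystemMatrices (interiorNodes Ω 𝒯 k) (boundaryNodes Ω 𝒯 k) (Fin N) where
  Mu := Matrix.of fun i j => ∫ x in Ω, bulkBasis Ω 𝒯 k i x * bulkBasis Ω 𝒯 k j x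
  Ku := Matrix.of fun i j => ∫ x in Ω,
    α x * inner ℝ (gradient (bulkBasis Ω 𝒯 k i) x) (gradient (bulkBasis Ω 𝒯 k j) x)
  Mp := Matrix.of fun i j => ∫ x, ψ i x * ψ j x ∂(surfaceMeasure Ω)
  Kp := Matrix.of fun i j => ∑ F ∈ 𝒯Γ, ∫ x in simplex F,
    κ x * inner ℝ (tangentialGradient F (ψ i) x) (tangentialGradient F (ψ j) x) ∂(surfaceMeasure Ω)
  Bu := Matrix.of fun i j =>
    ∫ x, bulkBasis Ω 𝒯 k (Sum.inr i) x * bulkBasis Ω 𝒯 k j x ∂(surfaceMeasure Ω)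
  Bp := Matrix.of fun i j =>
    ∫ x, bulkBasis Ω 𝒯 k (Sum.inr i) x * ψ j x ∂(surfaceMeasure Ω)
  Mlam := Matrix.of fun i j =>
    ∫ x, bulkBasis Ω 𝒯 k (Sum.inr i) x * bulkBasis Ω 𝒯 k (Sum.inr j) x ∂(surfaceMeasure Ω)

/-- The squared (semi-)norm `‖x‖²_A = xᵀ A x`. -/
def normSq {ι : Type} [Fintype ι] (A : Matrix ι ι ℝ) (x : ι → ℝ) : ℝ := x ⬝ᵥ (A *ᵥ x)

/-! ### The semi-discrete problem -/

section Problem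

variable {I B P : Type} [Fintype I] [Fintype B] [Fintype P]

/-- `(u, p, λ)` solves the (linear) semi-discrete differential-algebraic system on `[a, b]`. -/
structure IsSemidiscreteSolution (S : SystemMatrices I B P) (a b : ℝ)
    (fu : ℝ → (I ⊕ B → ℝ)) (fp : ℝ → (P → ℝ))
    (u : ℝ → (I ⊕ B → ℝ)) (p : ℝ → (P → ℝ)) (lam : ℝ → (B → ℝ)) : Prop where
  bulk : ∀ t ∈ Icc a b,
    S.Mu *ᵥ derivWithin u (Icc a b) t + S.Ku *ᵥ u t - S.Buᵀ *ᵥ lam t = fu t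
  surface : ∀ t ∈ Icc a b,
    S.Mp *ᵥ derivWithin p (Icc a b) t + S.Kp *ᵥ p t + S.Bpᵀ *ᵥ lam t = fp t
  constraint : ∀ t ∈ Icc a b, S.Bu *ᵥ u t - S.Bp *ᵥ p t = 0

/-- `u` and `p` are three times continuously differentiable on `[a, b]`, and the number `R` bounds
`max ‖p''‖²_{Mp}` and `∫ ‖u'''‖²_{Mu} + ‖p'''‖²_{Mp} ds`. -/
structure IsRegular (S : SystemMatrices I B P) (a b R : ℝ)
    (u : ℝ → (I ⊕ B → ℝ)) (p : ℝ → (P → ℝ)) : Prop where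
  smooth_u : ContDiffOn ℝ 3 u (Icc a b)
  smooth_p : ContDiffOn ℝ 3 p (Icc a b)
  bound_two : ∀ s ∈ Icc a b, normSq S.Mp (iteratedDerivWithin 2 p (Icc a b) s) ≤ R
  bound_three : ∫ s in a..b, (normSq S.Mu (iteratedDerivWithin 3 u (Icc a b) s)
    + normSq S.Mp (iteratedDerivWithin 3 p (Icc a b) s)) ≤ R

/-! ### The auxiliary splitting scheme -/

/-- The BDF-2 difference quotient `(3 xⁿ - 4 xⁿ⁻¹ + xⁿ⁻²) / (2τ)`. -/
def bdf {X : Type} [AddCommGroup X] [Module ℝ X] (τ : ℝ) (x : ℤ → X) (n : ℤ) : X :=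
  (1 / (2 * τ)) • ((3 : ℝ) • x n - (4 : ℝ) • x (n - 1) + x (n - 2))

/-- The extrapolated difference quotient `(5 xⁿ - 8 xⁿ⁻¹ + 3 xⁿ⁻²) / (2τ)`. -/
def extrapolatedQuotient {X : Type} [AddCommGroup X] [Module ℝ X]
    (τ : ℝ) (x : ℤ → X) (n : ℤ) : X :=
  (1 / (2 * τ)) • ((5 : ℝ) • x n - (8 : ℝ) • x (n - 1) + (3 : ℝ) • x (n - 2))

open scoped Classical in
/-- One step of the auxiliary scheme, computing `ûⁿ = (u₁ⁿ, û₂ⁿ)`, `pⁿ`, `λⁿ` at time `tⁿ = n τ`. -/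
structure IsAuxiliaryStep (S : SystemMatrices I B P) (τ : ℝ)
    (fu : ℝ → (I ⊕ B → ℝ)) (fp : ℝ → (P → ℝ))
    (u : ℤ → (I ⊕ B → ℝ)) (p : ℤ → (P → ℝ)) (lam : ℤ → (B → ℝ)) (n : ℤ) : Prop where
  interior : S.Mu.toBlocks₁₁ *ᵥ bdf τ (fun k => u k ∘ Sum.inl) n
      + S.Ku.toBlocks₁₁ *ᵥ (u n ∘ Sum.inl)
    = fu (n * τ) ∘ Sum.inl
      - S.Mu.toBlocks₁₂ *ᵥ (S.Mlam⁻¹ *ᵥ (S.Bp *ᵥ extrapolatedQuotient τ p (n - 1)))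
      - S.Ku.toBlocks₁₂ *ᵥ (S.Mlam⁻¹ *ᵥ (S.Bp *ᵥ ((2 : ℝ) • p (n - 1) - p (n - 2))))
  multiplier : S.Mu.toBlocks₂₁ *ᵥ bdf τ (fun k => u k ∘ Sum.inl) n
      + S.Ku.toBlocks₂₁ *ᵥ (u n ∘ Sum.inl) - S.Mlam *ᵥ lam n
    = fu (n * τ) ∘ Sum.inr
      - S.Mu.toBlocks₂₂ *ᵥ (S.Mlam⁻¹ *ᵥ (S.Bp *ᵥ extrapolatedQuotient τ p (n - 1)))
      - S.Ku.toBlocks₂₂ *ᵥ (S.Mlam⁻¹ *ᵥ (S.Bp *ᵥ ((2 : ℝ) • p (n - 1) - p (n - 2))))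
  surface : S.Mp *ᵥ bdf τ p n + S.Kp *ᵥ p n + S.Bpᵀ *ᵥ lam n = fp (n * τ)
  trace : S.Mlam *ᵥ (u n ∘ Sum.inr) = S.Bp *ᵥ p n

/-- The sequences `ûⁿ`, `pⁿ`, `λⁿ` are determined by the auxiliary scheme on `[0, T]` from consistent
initial data at `t⁻²`, `t⁻¹`, `t⁰`. -/
structure IsAuxiliarySolution (S : SystemMatrices I B P) (τ T : ℝ)
    (fu : ℝ → (I ⊕ B → ℝ)) (fp : ℝ → (P → ℝ))
    (u : ℤ → (I ⊕ B → ℝ)) (p : ℤ → (P → ℝ)) (lam : ℤ → (B → ℝ)) : Prop where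
  consistent : ∀ k : ℤ, -2 ≤ k → k ≤ 0 → S.Bu *ᵥ u k = S.Bp *ᵥ p k
  step : ∀ n : ℤ, 1 ≤ n → n * τ ≤ T → IsAuxiliaryStep S τ fu fp u p lam n

end Problem

end BulkSurface

end

/-!
The multiplier is eliminated by testing with pairs `(u₁, p)` whose bulk trace is the `L²` projection of
`p` onto the multiplier space. In terms of the total mass form `m` and the total stiffness form `k` on
these pairs, the auxiliary scheme is the implicit two-step backward difference scheme with two
additional terms: since `D x^n - D̃ x^(n-1)` and `x^n - 2 x^(n-1) + x^(n-2)` are differences of order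
three and two, the extrapolation of the boundary values contributes `β(∇³x, ·)` and `γ(∇²x, ·)`, where
`β` and `γ` pair the extension by zero of the boundary values with the bulk mass and stiffness.

Two facts about finite elements make these terms harmless (`exists_isStableSystem`). Scaling gives
that the extension by zero of a boundary function has at most `c₁ h` times the mass of the
function on the boundary (`IsTriangulation.normSq_mass_le`) and at most `c₂ / h` times in
stiffness (`IsTriangulation.normSq_stiffness_le`), where the lower bound for the boundary mass is
transported from the reference simplex by affine parametrizations of the facets
(`IsBoundaryRefinement.sum_sq_le`). The `L²` projection is a contraction
(`IsBoundaryRefinement.normSq_projection_le`). Hence for small `h` and `τ / h` the forms `β` and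
`√τ γ` are small relative to `m` and `k`.

The error `e` is split as `e = a + b` (`splitting_error_bound`). The part `a` solves the implicit scheme with
the consistency errors as right-hand side and zero initial values. Testing with the difference
quotient, and summing by parts in time for the contribution of `γ`, gives `k(a, a) = O(τ³)`, together with
a bound for the sum of the squared second differences of `a` of order `τ⁴`
(`bdf_energy_estimate`, `sum_secondDiff_le`). The part `b` carries the initial errors and the extrapolation
of `e`. Testing with `b + τ D b`, the dissipation of the scheme absorbs the differences of `b`, while
those of `a` are already bounded, so that `τ k(b, b) = O(τ⁴)` (`splitting_energy_estimate`). The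
consistency errors are estimated by Taylor expansion from the left end of each time window, the
second derivative of `p` being needed for the single boundary term of the summation by parts.
-/

namespace BulkSurface

/-! ### Positive semidefinite forms and sums -/

section Forms

variable {X : Type*} [AddCommGroup X] [Module ℝ X]

lemma two_mul_le_add_of_sq_le {x p q : ℝ} (hp : 0 ≤ p) (hq : 0 ≤ q) (h : x ^ 2 ≤ p * q) :
    2 * x ≤ p + q := by
  have h1 : (2 * x) ^ 2 ≤ (p + q) ^ 2 := by nlinarith [sq_nonneg (p - q)]
  exact (abs_le_of_sq_le_sq' h1 (by positivity)).2

/-- A functional that vanishes wherever the quadratic form of `A` does is represented by `A`, even if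
`A` is degenerate. -/
lemma exists_represents [FiniteDimensional ℝ X] {A : LinearMap.BilinForm ℝ X}
    (f : X →ₗ[ℝ] ℝ) (hf : ∀ x, A x x = 0 → f x = 0) :
    ∃ x, ∀ y, A x y = f y := by
  suffices h : f ∈ LinearMap.range A by
    obtain ⟨x, hx⟩ := h
    exact ⟨x, fun y => by rw [hx]⟩
  have h := Subspace.dualCoannihilator_dualAnnihilator_eq (W := LinearMap.range A)
  rw [← h, Submodule.mem_dualAnnihilator]
  intro y hy
  rw [Submodule.mem_dualCoannihilator] at hy
  exact hf y (hy _ ⟨y, rfl⟩)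

lemma form_sq_le {A : LinearMap.BilinForm ℝ X} (hA : A.IsPosSemidef) (x y : X) :
    (A x y) ^ 2 ≤ A x x * A y y :=
  LinearMap.BilinForm.apply_sq_le_of_symm A hA.nonneg ⟨hA.isSymm.eq⟩ x y

lemma form_sub_sub {A : LinearMap.BilinForm ℝ X} (hA : A.IsPosSemidef) (x y : X) :
    A (x - y) (x - y) ≤ 2 * A x x + 2 * A y y := by
  have h := hA.nonneg (x + y)
  have hs := hA.isSymm.eq x y
  simp only [map_add, map_sub, LinearMap.add_apply, LinearMap.sub_apply] at *
  linarith

lemma form_add_add {A : LinearMap.BilinForm ℝ X} (hA : A.IsPosSemidef) (x y : X) :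
    A (x + y) (x + y) ≤ 2 * A x x + 2 * A y y := by
  have h := hA.nonneg (x - y)
  have hs := hA.isSymm.eq x y
  simp only [map_add, map_sub, LinearMap.add_apply, LinearMap.sub_apply] at *
  linarith

/-- The identity behind the `G`-stability of the two-step backward difference formula. -/
lemma two_mul_form_bdf {A : LinearMap.BilinForm ℝ X} (hA : A.IsPosSemidef) (a b c : X) :
    2 * A ((3 : ℝ) • a - (4 : ℝ) • b + c) a =
      (A a a + A ((2 : ℝ) • a - b) ((2 : ℝ) • a - b))
        - (A b b + A ((2 : ℝ) • b - c) ((2 : ℝ) • b - c))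
        + A (a - (2 : ℝ) • b + c) (a - (2 : ℝ) • b + c) := by
  have h1 := hA.isSymm.eq a b
  have h2 := hA.isSymm.eq a c
  have h3 := hA.isSymm.eq b c
  simp only [map_add, map_sub, map_smul, LinearMap.add_apply, LinearMap.sub_apply,
    LinearMap.smul_apply, smul_eq_mul] at *
  linarith

end Forms

/-- A discrete Gronwall inequality which keeps track of a dissipation term `v`. -/
lemma discrete_gronwall {u v r : ℕ → ℝ} {c : ℝ} {N : ℕ} (hc : 0 ≤ c)
    (hv : ∀ n, 0 ≤ v n) (hr : ∀ n, 0 ≤ r n)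
    (h : ∀ n < N, u (n + 1) + v n ≤ (1 + c) * u n + r n) :
    ∀ n ≤ N, u n + ∑ i ∈ Finset.range n, v i
      ≤ (1 + c) ^ n * (u 0 + ∑ i ∈ Finset.range n, r i) := by
  intro n
  induction n with
  | zero => intro _; simp
  | succ n ih =>
    intro hn
    have h1 := ih (by omega)
    have h2 := h n (by omega)
    rw [Finset.sum_range_succ, Finset.sum_range_succ, pow_succ]
    have h3 := mul_le_mul_of_nonneg_left h1 (by linarith : 0 ≤ 1 + c)
    have h4 : 0 ≤ ∑ i ∈ Finset.range n, v i := Finset.sum_nonneg fun i _ => hv i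
    have h5 : r n ≤ (1 + c) ^ n * (1 + c) * r n :=
      le_mul_of_one_le_left (hr n) (by rw [← pow_succ]; exact one_le_pow₀ (by linarith))
    nlinarith [mul_nonneg hc h4]

/-! ### The two-step backward difference scheme with a smooth perturbation -/

section Scheme

variable {X : Type*} [AddCommGroup X] [Module ℝ X]

/-- The second difference `x_{n+2} - 2 x_{n+1} + x_n`. -/
def secondDiff (x : ℕ → X) (n : ℕ) : X := x (n + 2) - (2 : ℝ) • x (n + 1) + x n

/-- The third difference `x_{n+3} - 3 x_{n+2} + 3 x_{n+1} - x_n`. -/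
def thirdDiff (x : ℕ → X) (n : ℕ) : X :=
  x (n + 3) - (3 : ℝ) • x (n + 2) + (3 : ℝ) • x (n + 1) - x n

/-- The unscaled two-step backward difference `3 x_{n+3} - 4 x_{n+2} + x_{n+1}`. -/
def backwardDiff (x : ℕ → X) (n : ℕ) : X :=
  (3 : ℝ) • x (n + 3) - (4 : ℝ) • x (n + 2) + x (n + 1)

lemma thirdDiff_eq (x : ℕ → X) (n : ℕ) :
    thirdDiff x n = secondDiff x (n + 1) - secondDiff x n := by
  simp only [thirdDiff, secondDiff]
  module

/-- The implicit scheme has a solution with zero initial values. The forms may be degenerate, but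
the right-hand sides vanish wherever both forms do. -/
lemma exists_bdf_solution [FiniteDimensional ℝ X] {m k : LinearMap.BilinForm ℝ X}
    (hm : m.IsPosSemidef) (hk : k.IsPosSemidef) {τ : ℝ} (hτ : 0 < τ)
    (F : ℕ → X →ₗ[ℝ] ℝ) (hF : ∀ n x, m x x = 0 → k x x = 0 → F n x = 0) :
    ∃ a : ℕ → X, a 0 = 0 ∧ a 1 = 0 ∧ a 2 = 0 ∧
      ∀ n y, m (backwardDiff a n) y + 2 * τ * k (a (n + 3)) y = F n y := by
  have hstep : ∀ (n : ℕ) (b c : X), ∃ a : X, ∀ y,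
      m ((3 : ℝ) • a - (4 : ℝ) • b + c) y + 2 * τ * k a y = F n y := by
    intro n b c
    obtain ⟨a, ha⟩ := exists_represents (A := (3 : ℝ) • m + (2 * τ) • k) (F n + m ((4 : ℝ) • b - c)) (by
      intro x hx
      have h1 := hm.nonneg x
      have h2 := hk.nonneg x
      simp only [LinearMap.add_apply, LinearMap.smul_apply, smul_eq_mul] at hx ⊢
      have h3 : m x x = 0 := by nlinarith [mul_nonneg hτ.le h2]
      have h4 : k x x = 0 := by
        have : τ * k x x = 0 := by nlinarith
        rcases mul_eq_zero.1 this with h | h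
        · exact absurd h hτ.ne'
        · exact h
      have h5 := form_sq_le hm ((4 : ℝ) • b - c) x
      rw [h3, mul_zero] at h5
      rw [hF n x h3 h4, pow_eq_zero_iff two_ne_zero |>.1 (le_antisymm h5 (sq_nonneg _)), add_zero])
    refine ⟨a, fun y => ?_⟩
    have := ha y
    simp only [LinearMap.add_apply, LinearMap.smul_apply, smul_eq_mul, map_add, map_sub,
      map_smul, LinearMap.sub_apply] at this ⊢
    linarith
  choose g hg using hstep
  -- the pairs of two consecutive values, starting with the last two initial values
  let s : ℕ → X × X := fun n => Nat.rec (0, 0) (fun n q => (q.2, g n q.2 q.1)) n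
  refine ⟨fun n => match n with | 0 => 0 | n + 1 => (s n).1, rfl, rfl, rfl, fun n y => ?_⟩
  exact hg n (s n).2 (s n).1 y

variable {m k : LinearMap.BilinForm ℝ X}

/-- Stability of the implicit scheme, tested with the backward difference quotient. The part `Γ` of the
right-hand side is only bounded in the energy norm; it is treated by summation by parts in time. -/
lemma bdf_energy_estimate (hm : m.IsPosSemidef) (hk : k.IsPosSemidef) {τ T Q G : ℝ} {N : ℕ}
    (hτ : 0 < τ) (hτ1 : τ ≤ 1) (hN : N * τ ≤ T) (hQ : 0 ≤ Q) (hG : 0 ≤ G)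
    {s Γ : ℕ → X →ₗ[ℝ] ℝ} {g t : ℕ → ℝ} (hg : ∀ n, 0 ≤ g n) (ht : ∀ n, 0 ≤ t n)
    (hs : ∀ n < N, ∀ y, (s n y) ^ 2 ≤ g n * m y y)
    (hΓ : ∀ n ≤ N, ∀ y, (Γ n y) ^ 2 ≤ τ ^ 3 * Q * k y y)
    (hΓ' : ∀ n < N, ∀ y, τ * (Γ (n + 1) y - Γ n y) ^ 2 ≤ t n * k y y)
    (hgs : ∑ n ∈ Finset.range N, g n ≤ G * τ ^ 3)
    (hts : ∑ n ∈ Finset.range N, t n ≤ G * τ ^ 5)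
    {a : ℕ → X} (ha1 : a 1 = 0) (ha2 : a 2 = 0)
    (ha : ∀ n < N, ∀ y, m (backwardDiff a n) y + 2 * τ * k (a (n + 3)) y
      = 2 * τ * (s n y + Γ (n + 1) y)) :
    ∀ n ≤ N, k (a (n + 2)) (a (n + 2)) ≤ 8 * Real.exp (2 * T) * (Q + G) * τ ^ 3 ∧
      ∑ i ∈ Finset.range n, m (backwardDiff a i) (backwardDiff a i)
        ≤ 8 * Real.exp (2 * T) * (Q + G) * τ ^ 4 := by
  -- `F` is the energy of the `G`-stability identity, `H` is the boundary term of the summation by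
  -- parts in time, and the constant in `Φ` makes the modified energy nonnegative
  let F : ℕ → ℝ := fun n => k (a (n + 2)) (a (n + 2))
    + k ((2 : ℝ) • a (n + 2) - a (n + 1)) ((2 : ℝ) • a (n + 2) - a (n + 1))
  let H : ℕ → ℝ := fun n => 2 * Γ n ((3 : ℝ) • a (n + 2) - a (n + 1))
  let Φ : ℕ → ℝ := fun n => F n - H n + 4 * τ ^ 3 * Q
  have hF0 : ∀ n, 0 ≤ F n := fun n => add_nonneg (hk.nonneg _) (hk.nonneg _)
  have hz : ∀ n, k ((3 : ℝ) • a (n + 2) - a (n + 1)) ((3 : ℝ) • a (n + 2) - a (n + 1))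
      ≤ 2 * F n := by
    intro n
    have h := form_add_add hk (a (n + 2)) ((2 : ℝ) • a (n + 2) - a (n + 1))
    have e : a (n + 2) + ((2 : ℝ) • a (n + 2) - a (n + 1)) = (3 : ℝ) • a (n + 2) - a (n + 1) := by
      module
    rw [e] at h
    simp only [F]
    linarith
  have hH : ∀ n ≤ N, H n ≤ 1 / 2 * F n + 4 * τ ^ 3 * Q := by
    intro n hn
    refine two_mul_le_add_of_sq_le (mul_nonneg (by norm_num) (hF0 n)) (by positivity) ?_
    refine (hΓ n hn _).trans ?_
    have := mul_le_mul_of_nonneg_left (hz n) (by positivity : 0 ≤ τ ^ 3 * Q)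
    linarith
  have hΦ : ∀ n ≤ N, F n ≤ 2 * Φ n := by
    intro n hn
    have := hH n hn
    simp only [Φ]
    linarith
  have hstep : ∀ n < N, Φ (n + 1) + m (backwardDiff a n) (backwardDiff a n) / (2 * τ)
      ≤ (1 + 2 * τ) * Φ n + (2 * τ * g n + 2 * t n / τ ^ 2) := by
    intro n hn
    set v := backwardDiff a n with hv
    have h1 := ha n hn v
    have h2 := two_mul_form_bdf hk (a (n + 3)) (a (n + 2)) (a (n + 1))
    rw [hk.isSymm.eq] at h2
    have h3 := hk.nonneg (a (n + 3) - (2 : ℝ) • a (n + 2) + a (n + 1))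
    have h4 : 2 * s n v ≤ 2 * τ * g n + m v v / (2 * τ) := by
      have hm0 := hm.nonneg v
      refine two_mul_le_add_of_sq_le (mul_nonneg (by positivity) (hg n)) (by positivity) ?_
      refine (hs n hn v).trans (le_of_eq ?_)
      field_simp
    have h5 : 2 * -(Γ (n + 1) ((3 : ℝ) • a (n + 2) - a (n + 1))
        - Γ n ((3 : ℝ) • a (n + 2) - a (n + 1))) ≤ τ * F n + 2 * t n / τ ^ 2 := by
      have := ht n
      refine two_mul_le_add_of_sq_le (mul_nonneg hτ.le (hF0 n)) (by positivity) ?_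
      have h6 := (hΓ' n hn ((3 : ℝ) • a (n + 2) - a (n + 1))).trans
        (mul_le_mul_of_nonneg_left (hz n) (ht n))
      rw [neg_sq]
      have e : τ * F n * (2 * t n / τ ^ 2) = (t n * (2 * F n)) / τ := by field_simp
      rw [e, le_div_iff₀ hτ]
      linarith
    have h6 : 2 * Γ (n + 1) v = H (n + 1) - H n
        - 2 * (Γ (n + 1) ((3 : ℝ) • a (n + 2) - a (n + 1))
          - Γ n ((3 : ℝ) • a (n + 2) - a (n + 1))) := by
      simp only [hv, H, backwardDiff, map_add, map_sub, map_smul, smul_eq_mul]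
      ring
    have h7 : m v v / (2 * τ) * 2 + 2 * k (a (n + 3)) v = 2 * s n v + 2 * Γ (n + 1) v := by
      have : m v v = 2 * τ * (s n v + Γ (n + 1) v - k (a (n + 3)) v) := by linarith
      rw [this]
      field_simp
      ring
    have h8 : 2 * k (a (n + 3)) v = F (n + 1) - F n
        + k (a (n + 3) - (2 : ℝ) • a (n + 2) + a (n + 1))
            (a (n + 3) - (2 : ℝ) • a (n + 2) + a (n + 1)) := h2
    have h9 := mul_le_mul_of_nonneg_left (hΦ n hn.le) hτ.le
    simp only [Φ] at h9 ⊢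
    linarith
  have hmain := discrete_gronwall (u := Φ)
    (v := fun n => m (backwardDiff a n) (backwardDiff a n) / (2 * τ))
    (r := fun n => 2 * τ * g n + 2 * t n / τ ^ 2) (c := 2 * τ) (N := N) (by positivity)
    (fun n => div_nonneg (hm.nonneg _) (by positivity))
    (fun n => by have := hg n; have := ht n; positivity) hstep
  intro n hn
  have h1 := hmain n hn
  have hΦ0 : Φ 0 = 4 * τ ^ 3 * Q := by simp [Φ, F, H, ha1, ha2]
  have hr : ∑ i ∈ Finset.range n, (2 * τ * g i + 2 * t i / τ ^ 2) ≤ 4 * τ ^ 3 * G := by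
    calc ∑ i ∈ Finset.range n, (2 * τ * g i + 2 * t i / τ ^ 2)
        ≤ ∑ i ∈ Finset.range N, (2 * τ * g i + 2 * t i / τ ^ 2) :=
          Finset.sum_le_sum_of_subset_of_nonneg (Finset.range_mono hn)
            (fun i _ _ => by have := hg i; have := ht i; positivity)
      _ = 2 * τ * ∑ i ∈ Finset.range N, g i + 2 / τ ^ 2 * ∑ i ∈ Finset.range N, t i := by
          rw [Finset.sum_add_distrib, Finset.mul_sum, Finset.mul_sum]
          congr 1
          exact Finset.sum_congr rfl fun i _ => by ring
      _ ≤ 2 * τ * (G * τ ^ 3) + 2 / τ ^ 2 * (G * τ ^ 5) := by gcongr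
      _ = τ * (2 * G * τ ^ 3) + 2 * G * τ ^ 3 := by field_simp
      _ ≤ 1 * (2 * G * τ ^ 3) + 2 * G * τ ^ 3 := by gcongr
      _ = 4 * τ ^ 3 * G := by ring
  have hexp : (1 + 2 * τ) ^ n ≤ Real.exp (2 * T) := by
    calc (1 + 2 * τ) ^ n ≤ (Real.exp (2 * τ)) ^ n := by
          gcongr
          linarith [Real.add_one_le_exp (2 * τ)]
      _ = Real.exp (2 * (n * τ)) := by rw [← Real.exp_nat_mul]; congr 1; ring
      _ ≤ Real.exp (2 * T) := by
          gcongr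
          exact (mul_le_mul_of_nonneg_right (by exact_mod_cast hn) hτ.le).trans hN
  have h2 : Φ n + ∑ i ∈ Finset.range n, m (backwardDiff a i) (backwardDiff a i) / (2 * τ)
      ≤ 4 * Real.exp (2 * T) * (Q + G) * τ ^ 3 := by
    refine h1.trans ?_
    calc _ ≤ Real.exp (2 * T) * (4 * τ ^ 3 * Q + 4 * τ ^ 3 * G) := by
          rw [hΦ0]
          have : 0 ≤ ∑ i ∈ Finset.range n, (2 * τ * g i + 2 * t i / τ ^ 2) :=
            Finset.sum_nonneg fun i _ => by have := hg i; have := ht i; positivity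
          gcongr
      _ = _ := by ring
  have h3 : 0 ≤ ∑ i ∈ Finset.range n, m (backwardDiff a i) (backwardDiff a i) :=
    Finset.sum_nonneg fun i _ => hm.nonneg _
  rw [← Finset.sum_div] at h2
  have h4 := hΦ n hn
  have h5 := hF0 n
  have h6 : k (a (n + 2)) (a (n + 2)) ≤ F n := le_add_of_nonneg_right (hk.nonneg _)
  have h7 : 0 ≤ (∑ i ∈ Finset.range n, m (backwardDiff a i) (backwardDiff a i)) / (2 * τ) := by
    positivity
  refine ⟨by linarith, ?_⟩
  have h8 : (∑ i ∈ Finset.range n, m (backwardDiff a i) (backwardDiff a i)) / (2 * τ)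
      ≤ 4 * Real.exp (2 * T) * (Q + G) * τ ^ 3 := by linarith
  rw [div_le_iff₀ (by positivity)] at h8
  linarith

/-- Second differences are controlled by backward differences, since
`3 (x_{n+3} - x_{n+2}) = backwardDiff x n + (x_{n+2} - x_{n+1})`. -/
lemma sum_secondDiff_le (hm : m.IsPosSemidef) {a : ℕ → X} (ha1 : a 1 = 0) (ha2 : a 2 = 0)
    (n : ℕ) :
    ∑ i ∈ Finset.range n, m (secondDiff a (i + 1)) (secondDiff a (i + 1))
      ≤ 2 * ∑ i ∈ Finset.range n, m (backwardDiff a i) (backwardDiff a i) := by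
  suffices h : ∑ i ∈ Finset.range n, m (secondDiff a (i + 1)) (secondDiff a (i + 1))
      + 4 * m (a (n + 2) - a (n + 1)) (a (n + 2) - a (n + 1))
      ≤ 2 * ∑ i ∈ Finset.range n, m (backwardDiff a i) (backwardDiff a i) by
    linarith [hm.nonneg (a (n + 2) - a (n + 1))]
  induction n with
  | zero => simp [ha1, ha2]
  | succ n ih =>
    rw [Finset.sum_range_succ, Finset.sum_range_succ]
    have h1 := form_add_add hm (backwardDiff a n) (a (n + 2) - a (n + 1))
    have e1 : backwardDiff a n + (a (n + 2) - a (n + 1)) = (3 : ℝ) • (a (n + 3) - a (n + 2)) := by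
      simp only [backwardDiff]; module
    have h2 := form_sub_sub hm (a (n + 3) - a (n + 2)) (a (n + 2) - a (n + 1))
    have e2 : a (n + 3) - a (n + 2) - (a (n + 2) - a (n + 1)) = secondDiff a (n + 1) := by
      simp only [secondDiff]; module
    rw [e1] at h1
    rw [e2] at h2
    simp only [map_smul, LinearMap.smul_apply, smul_eq_mul] at h1
    have e3 : a (n + 1 + 2) - a (n + 1 + 1) = a (n + 3) - a (n + 2) := rfl
    rw [e3]
    have h3 := hm.nonneg (backwardDiff a n)
    have h4 := hm.nonneg (a (n + 2) - a (n + 1))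
    linarith

end Scheme


/-! ### Stability of the scheme with extrapolated boundary values -/

section Extrapolation

variable {X : Type*} [AddCommGroup X] [Module ℝ X]
variable {m k β γ : LinearMap.BilinForm ℝ X}

/-- Stability of the scheme with extrapolated boundary values, tested with `b + τ D b`. The
extrapolation errors `β` (mass) and `γ` (stiffness) are small multiples of second differences; these are
absorbed by the dissipation of the backward difference formula. For the mass term one difference is
first moved to the test function. -/
lemma splitting_energy_estimate (hm : m.IsPosSemidef) (hk : k.IsPosSemidef) {τ : ℝ} {N : ℕ}
    (hτ : 0 < τ)
    (hβ : ∀ x y, 10000 * (β x y) ^ 2 ≤ m x x * m y y)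
    (hγ : ∀ x y, 10000 * τ * (γ x y) ^ 2 ≤ m x x * k y y)
    {a b : ℕ → X}
    (hb : ∀ n < N, ∀ y, m (backwardDiff b n) y + 2 * τ * k (b (n + 3)) y
      = 3 * β (thirdDiff (a + b) n) y + 2 * τ * γ (secondDiff (a + b) (n + 1)) y)
    (ha0 : secondDiff a 0 = 0) {K : ℝ}
    (hK : ∀ j ≤ 2, m (b j) (b j) + τ * k (b j) (b j) ≤ K) :
    ∀ n ≤ N, τ * k (b (n + 2)) (b (n + 2))
      ≤ 60 * K + ∑ i ∈ Finset.range n, m (secondDiff a (i + 1)) (secondDiff a (i + 1)) := by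
  -- `Ψ` is the energy of the test function `b + τ D b`, corrected by the boundary term `W` of the
  -- summation by parts
  let A : ℕ → ℝ := fun n => m (secondDiff a n) (secondDiff a n)
  let D : ℕ → ℝ := fun n => m (secondDiff b n) (secondDiff b n)
  let E : ℕ → ℝ := fun n => m (secondDiff (a + b) n) (secondDiff (a + b) n)
  let G : ℕ → ℝ := fun n => m (b (n + 2)) (b (n + 2))
    + m ((2 : ℝ) • b (n + 2) - b (n + 1)) ((2 : ℝ) • b (n + 2) - b (n + 1))
  let F : ℕ → ℝ := fun n => k (b (n + 2)) (b (n + 2))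
    + k ((2 : ℝ) • b (n + 2) - b (n + 1)) ((2 : ℝ) • b (n + 2) - b (n + 1))
  let W : ℕ → ℝ := fun n => 6 * β (secondDiff (a + b) n) (b (n + 2))
  let Ψ : ℕ → ℝ := fun n => G n + τ * F n - W n + 1 / 2 * D n + τ * k (b (n + 2)) (b (n + 2))
  have hβ' : ∀ x y, 200 * β x y ≤ m x x + m y y := by
    intro x y
    have := two_mul_le_add_of_sq_le (x := 100 * β x y) (hm.nonneg x) (hm.nonneg y)
      (by linarith [hβ x y])
    linarith
  have hγ' : ∀ x y, 200 * (τ * γ x y) ≤ m x x + τ * k y y := by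
    intro x y
    have := two_mul_le_add_of_sq_le (x := 100 * (τ * γ x y)) (hm.nonneg x)
      (mul_nonneg hτ.le (hk.nonneg y)) (by
        have := mul_le_mul_of_nonneg_left (hγ x y) hτ.le
        linarith)
    linarith
  have hE : ∀ n, E n ≤ 2 * A n + 2 * D n := by
    intro n
    have h := form_add_add hm (secondDiff a n) (secondDiff b n)
    have e : secondDiff a n + secondDiff b n = secondDiff (a + b) n := by
      simp only [secondDiff, Pi.add_apply]; module
    rwa [e] at h
  have hA0 : ∀ n, 0 ≤ A n := fun n => hm.nonneg _
  have hD0 : ∀ n, 0 ≤ D n := fun n => hm.nonneg _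
  have hstep : ∀ n < N, Ψ (n + 1) ≤ Ψ n + 1 / 5 * (A n + A (n + 1)) := by
    intro n hn
    set v := backwardDiff b n with hv
    have h1 := hb n hn ((2 : ℝ) • b (n + 3) + v)
    simp only [map_add, map_smul, smul_eq_mul] at h1
    have h2 := two_mul_form_bdf hm (b (n + 3)) (b (n + 2)) (b (n + 1))
    have h3 := two_mul_form_bdf hk (b (n + 3)) (b (n + 2)) (b (n + 1))
    rw [hk.isSymm.eq] at h3
    have h2' : 2 * m v (b (n + 3)) = G (n + 1) - G n + D (n + 1) := h2
    have h3' : 2 * k (b (n + 3)) v = F (n + 1) - F n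
      + k (secondDiff b (n + 1)) (secondDiff b (n + 1)) := h3
    -- mass extrapolation tested with `b`, after summation by parts
    have t1 : 6 * β (thirdDiff (a + b) n) (b (n + 3)) = W (n + 1) - W n
        + 6 * β (secondDiff (a + b) n) (b (n + 2) - b (n + 3)) := by
      simp only [W, thirdDiff_eq, map_sub, LinearMap.sub_apply]
      ring_nf
    have t1' := hβ' (secondDiff (a + b) n) (b (n + 2) - b (n + 3))
    have d1 : m (b (n + 2) - b (n + 3)) (b (n + 2) - b (n + 3))
        ≤ 1 / 2 * m v v + 1 / 2 * D (n + 1) := by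
      have h := form_sub_sub hm ((1 / 2 : ℝ) • secondDiff b (n + 1)) ((1 / 2 : ℝ) • v)
      have e : (1 / 2 : ℝ) • secondDiff b (n + 1) - (1 / 2 : ℝ) • v = b (n + 2) - b (n + 3) := by
        simp only [hv, secondDiff, backwardDiff]; module
      rw [e] at h
      simp only [map_smul, LinearMap.smul_apply, smul_eq_mul] at h
      simp only [D]
      linarith
    -- stiffness extrapolation tested with `b`
    have t2 := hγ' (secondDiff (a + b) (n + 1)) (b (n + 3))
    -- mass extrapolation tested with the difference quotient
    have t3 := hβ' (thirdDiff (a + b) n) ((1 / 2 : ℝ) • v)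
    have d3 : m (thirdDiff (a + b) n) (thirdDiff (a + b) n) ≤ 2 * E (n + 1) + 2 * E n := by
      rw [thirdDiff_eq]
      exact form_sub_sub hm _ _
    -- stiffness extrapolation tested with the difference quotient
    have t4 := hγ' (secondDiff (a + b) (n + 1)) ((1 / 2 : ℝ) • v)
    have d4 : k ((1 / 2 : ℝ) • v) ((1 / 2 : ℝ) • v) ≤ 4 * k (b (n + 3)) (b (n + 3))
        + 4 * k (b (n + 2)) (b (n + 2))
        + 1 / 2 * k (secondDiff b (n + 1)) (secondDiff b (n + 1)) := by
      have h := form_add_add hk (b (n + 3) - b (n + 2)) ((1 / 2 : ℝ) • secondDiff b (n + 1))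
      have e : b (n + 3) - b (n + 2) + (1 / 2 : ℝ) • secondDiff b (n + 1) = (1 / 2 : ℝ) • v := by
        simp only [hv, secondDiff, backwardDiff]; module
      have h' := form_sub_sub hk (b (n + 3)) (b (n + 2))
      rw [e] at h
      have h'' : k ((1 / 2 : ℝ) • secondDiff b (n + 1)) ((1 / 2 : ℝ) • secondDiff b (n + 1))
          = 1 / 4 * k (secondDiff b (n + 1)) (secondDiff b (n + 1)) := by
        simp only [map_smul, LinearMap.smul_apply, smul_eq_mul]; ring
      linarith
    have d4' := mul_le_mul_of_nonneg_left d4 hτ.le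
    have m4 : m ((1 / 2 : ℝ) • v) ((1 / 2 : ℝ) • v) = 1 / 4 * m v v := by
      simp only [map_smul, LinearMap.smul_apply, smul_eq_mul]; ring
    simp only [map_smul, smul_eq_mul] at t3 t4
    simp only [map_smul, smul_eq_mul] at m4 d4 d4'
    have e1 := hE n
    have e2 := hE (n + 1)
    have p1 := hA0 n
    have p2 := hA0 (n + 1)
    have p3 := hD0 n
    have p4 := hD0 (n + 1)
    have p5 := hm.nonneg v
    have p6 := mul_nonneg hτ.le (hk.nonneg (b (n + 3)))
    have p7 := mul_nonneg hτ.le (hk.nonneg (b (n + 2)))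
    have p8 := mul_nonneg hτ.le (hk.nonneg (secondDiff b (n + 1)))
    have h3'' : 2 * (τ * k (b (n + 3)) v) = τ * F (n + 1) - τ * F n
        + τ * k (secondDiff b (n + 1)) (secondDiff b (n + 1)) := by
      linear_combination τ * h3'
    simp only [Ψ]
    change G (n + 1) + τ * F (n + 1) - W (n + 1) + 1 / 2 * D (n + 1)
      + τ * k (b (n + 3)) (b (n + 3)) ≤ _
    simp only [E] at d3 e1 e2
    linarith
  have hA00 : A 0 = 0 := by simp [A, ha0]
  have hsum : ∀ n ≤ N, Ψ n ≤ Ψ 0 + 2 / 5 * ∑ i ∈ Finset.range n, A (i + 1) - 1 / 5 * A n := by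
    intro n
    induction n with
    | zero => intro _; simp [hA00]
    | succ n ih =>
      intro hn
      rw [Finset.sum_range_succ]
      linarith [ih (by omega), hstep n (by omega), hA0 n, hA0 (n + 1)]
  have hW : ∀ n, |W n| ≤ 3 / 100 * (2 * A n + 2 * D n + m (b (n + 2)) (b (n + 2))) := by
    intro n
    have h1 := hβ' (secondDiff (a + b) n) (b (n + 2))
    have h2 := hβ' (-secondDiff (a + b) n) (b (n + 2))
    simp only [map_neg, LinearMap.neg_apply, neg_neg] at h2
    have h3 := hE n
    simp only [E] at h3
    rw [abs_le]
    constructor <;> simp only [W] <;> linarith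
  have hK0 : 0 ≤ K := (add_nonneg (hm.nonneg (b 0)) (mul_nonneg hτ.le (hk.nonneg (b 0)))).trans
    (hK 0 (by norm_num))
  have hΨ0 : Ψ 0 ≤ 60 * K := by
    have k0 := hK 0 (by norm_num)
    have k1 := hK 1 (by norm_num)
    have k2 := hK 2 (by norm_num)
    have q0 := mul_nonneg hτ.le (hk.nonneg (b 0))
    have q1 := mul_nonneg hτ.le (hk.nonneg (b 1))
    have q2 := mul_nonneg hτ.le (hk.nonneg (b 2))
    have r0 := hm.nonneg (b 0)
    have r1 := hm.nonneg (b 1)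
    have r2 := hm.nonneg (b 2)
    have g1 := form_sub_sub hm ((2 : ℝ) • b 2) (b 1)
    have f1 := mul_le_mul_of_nonneg_left (form_sub_sub hk ((2 : ℝ) • b 2) (b 1)) hτ.le
    have e : (b 2 + b 0) - (2 : ℝ) • b 1 = secondDiff b 0 := by simp only [secondDiff]; module
    have d1 := form_sub_sub hm (b 2 + b 0) ((2 : ℝ) • b 1)
    have d2 := form_add_add hm (b 2) (b 0)
    rw [e] at d1
    have w1 := (abs_le.1 (hW 0)).1
    have s1 : m ((2 : ℝ) • b 2) ((2 : ℝ) • b 2) = 4 * m (b 2) (b 2) := by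
      simp only [map_smul, LinearMap.smul_apply, smul_eq_mul]; ring
    have s2 : m ((2 : ℝ) • b 1) ((2 : ℝ) • b 1) = 4 * m (b 1) (b 1) := by
      simp only [map_smul, LinearMap.smul_apply, smul_eq_mul]; ring
    have s3 : k ((2 : ℝ) • b 2) ((2 : ℝ) • b 2) = 4 * k (b 2) (b 2) := by
      simp only [map_smul, LinearMap.smul_apply, smul_eq_mul]; ring
    rw [s1] at g1
    rw [s3] at f1
    rw [s2] at d1
    simp only [zero_add] at w1
    simp only [Ψ, G, F, D, zero_add] at w1 ⊢
    linarith
  intro n hn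
  have h1 := hsum n hn
  have h2 := (abs_le.1 (hW n)).2
  have h3 : 0 ≤ ∑ i ∈ Finset.range n, A (i + 1) := Finset.sum_nonneg fun i _ => hA0 _
  have h4 := hA0 n
  have h5 := hD0 n
  have h6 : m (b (n + 2)) (b (n + 2)) ≤ G n := le_add_of_nonneg_right (hm.nonneg _)
  have h7 : 0 ≤ τ * F n := mul_nonneg hτ.le (add_nonneg (hk.nonneg _) (hk.nonneg _))
  have h8 := hm.nonneg (b (n + 2))
  have h9 : Ψ n = G n + τ * F n - W n + 1 / 2 * D n + τ * k (b (n + 2)) (b (n + 2)) := rfl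
  change _ ≤ 60 * K + ∑ i ∈ Finset.range n, A (i + 1)
  linarith

/-- The error estimate for the splitting scheme, for abstract forms. The error is split into the
part `a` caused by the consistency errors `s` and `Γ` in the implicit scheme, and the part `b` caused by
the extrapolation of the error itself. -/
theorem splitting_error_bound [FiniteDimensional ℝ X] (hm : m.IsPosSemidef) (hk : k.IsPosSemidef)
    {τ T Q G K : ℝ} {N : ℕ}
    (hτ : 0 < τ) (hτ1 : τ ≤ 1) (hN : N * τ ≤ T) (hQ : 0 ≤ Q) (hG : 0 ≤ G)
    (hβ : ∀ x y, 10000 * (β x y) ^ 2 ≤ m x x * m y y)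
    (hγ : ∀ x y, 10000 * τ * (γ x y) ^ 2 ≤ m x x * k y y)
    {s Γ : ℕ → X →ₗ[ℝ] ℝ} {g t : ℕ → ℝ} (hg : ∀ n, 0 ≤ g n) (ht : ∀ n, 0 ≤ t n)
    (hs : ∀ n < N, ∀ y, (s n y) ^ 2 ≤ g n * m y y)
    (hΓ : ∀ n ≤ N, ∀ y, (Γ n y) ^ 2 ≤ τ ^ 3 * Q * k y y)
    (hΓ' : ∀ n < N, ∀ y, τ * (Γ (n + 1) y - Γ n y) ^ 2 ≤ t n * k y y)
    (hgs : ∑ n ∈ Finset.range N, g n ≤ G * τ ^ 3)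
    (hts : ∑ n ∈ Finset.range N, t n ≤ G * τ ^ 5)
    {e : ℕ → X}
    (he : ∀ n < N, ∀ y, m (backwardDiff e n) y + 2 * τ * k (e (n + 3)) y
      = 3 * β (thirdDiff e n) y + 2 * τ * γ (secondDiff e (n + 1)) y
        + 2 * τ * (s n y + Γ (n + 1) y))
    (hK : ∀ j ≤ 2, m (e j) (e j) + τ * k (e j) (e j) ≤ K * τ ^ 4) :
    ∀ n ≤ N, k (e (n + 2)) (e (n + 2))
      ≤ (48 * Real.exp (2 * T) * (Q + G) + 120 * K) * τ ^ 3 := by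
  -- beyond the final time the functionals are irrelevant, and replaced by zero
  obtain ⟨a, ha0, ha1, ha2, ha⟩ := exists_bdf_solution hm hk hτ
    (fun n => if n < N then (2 * τ) • (s n + Γ (n + 1)) else 0) (by
      intro n x hmx hkx
      by_cases hn : n < N
      · have h1 := hs n hn x
        have h2 := hΓ (n + 1) hn x
        rw [hmx, mul_zero] at h1
        rw [hkx, mul_zero] at h2
        have h1' := pow_eq_zero_iff two_ne_zero |>.1 (le_antisymm h1 (sq_nonneg _))
        have h2' := pow_eq_zero_iff two_ne_zero |>.1 (le_antisymm h2 (sq_nonneg _))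
        simp [hn, h1', h2']
      · simp [hn])
  have ha' : ∀ n < N, ∀ y, m (backwardDiff a n) y + 2 * τ * k (a (n + 3)) y
      = 2 * τ * (s n y + Γ (n + 1) y) := by
    intro n hn y
    rw [ha n y, if_pos hn]
    simp only [LinearMap.smul_apply, LinearMap.add_apply, smul_eq_mul]
  have hA := bdf_energy_estimate hm hk hτ hτ1 hN hQ hG hg ht hs hΓ hΓ' hgs hts ha1 ha2 ha'
  have hae : a + (e - a) = e := add_sub_cancel a e
  have hB := splitting_energy_estimate hm hk hτ hβ hγ (a := a) (b := e - a) (N := N)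
    (K := K * τ ^ 4) (by
      intro n hn y
      have h1 := he n hn y
      have h2 := ha' n hn y
      have e1 : backwardDiff (e - a) n = backwardDiff e n - backwardDiff a n := by
        simp only [backwardDiff, Pi.sub_apply]; module
      rw [hae, e1, Pi.sub_apply]
      simp only [map_sub, LinearMap.sub_apply]
      linarith) (by simp [secondDiff, ha0, ha1, ha2]) (by
      intro j hj
      have : a j = 0 := by interval_cases j <;> assumption
      simpa [this] using hK j hj)
  intro n hn
  obtain ⟨h1, h2⟩ := hA n hn
  have h3 := hB n hn
  have h4 := sum_secondDiff_le hm ha1 ha2 n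
  have h5 := form_add_add hk (a (n + 2)) ((e - a) (n + 2))
  have h6 : a (n + 2) + (e - a) (n + 2) = e (n + 2) := by simp
  rw [h6] at h5
  have h7 : k ((e - a) (n + 2)) ((e - a) (n + 2))
      ≤ (60 * K + 16 * Real.exp (2 * T) * (Q + G)) * τ ^ 3 := by
    refine le_of_mul_le_mul_left ?_ hτ
    calc _ ≤ _ := h3
      _ ≤ 60 * (K * τ ^ 4) + 2 * (8 * Real.exp (2 * T) * (Q + G) * τ ^ 4) := by linarith
      _ = _ := by ring
  linarith

end Extrapolation


/-! ### Consistency errors of difference quotients -/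

lemma abs_le_of_abs_deriv_le {f f' : ℝ → ℝ} {t₀ t₁ C : ℝ} {j : ℕ} (h0 : f t₀ = 0)
    (hf : ∀ r ∈ Icc t₀ t₁, HasDerivWithinAt f (f' r) (Icc t₀ t₁) r)
    (hb : ∀ r ∈ Icc t₀ t₁, |f' r| ≤ C * (r - t₀) ^ j) :
    ∀ r ∈ Icc t₀ t₁, |f r| ≤ C * (r - t₀) ^ (j + 1) / (j + 1) := by
  refine image_norm_le_of_norm_deriv_right_le_deriv_boundary (f' := f')
    (B := fun r => C * (r - t₀) ^ (j + 1) / (j + 1)) (B' := fun r => C * (r - t₀) ^ j)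
    (fun r hr => (hf r hr).continuousWithinAt) ?_ (by simp [h0]) ?_ ?_
  · intro r hr
    have h := hf r ⟨hr.1, hr.2.le⟩
    refine (h.mono (Icc_subset_Icc_left hr.1)).mono_of_mem_nhdsWithin ?_
    exact Icc_mem_nhdsGE hr.2
  · intro r
    have h := ((((hasDerivAt_id r).sub_const t₀).pow (j + 1)).const_mul C).div_const ((j : ℝ) + 1)
    refine h.congr_deriv ?_
    have : (j : ℝ) + 1 ≠ 0 := by positivity
    simp only [Nat.cast_add, Nat.cast_one, add_tsub_cancel_right, id_eq, mul_one]
    field_simp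
  · intro r hr
    exact hb r ⟨hr.1, hr.2.le⟩

section Consistency

variable {ι : Type} [Fintype ι]

lemma continuous_normSq (M : Matrix ι ι ℝ) : Continuous (normSq M) :=
  continuous_id.dotProduct (continuous_const.matrix_mulVec continuous_id)

variable {M : Matrix ι ι ℝ} {x : ℝ → ι → ℝ} {a b : ℝ}

lemma hasDerivWithinAt_iteratedDerivWithin (hab : a < b) (hx : ContDiffOn ℝ 3 x (Icc a b)) {i : ℕ}
    (hi : i < 3) {r : ℝ} (hr : r ∈ Icc a b) :
    HasDerivWithinAt (iteratedDerivWithin i x (Icc a b))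
      (iteratedDerivWithin (i + 1) x (Icc a b) r) (Icc a b) r := by
  rw [iteratedDerivWithin_succ]
  exact ((hx.differentiableOn_iteratedDerivWithin (by exact_mod_cast hi)
    (uniqueDiffOn_Icc hab)) r hr).hasDerivWithinAt

lemma intervalIntegrable_normSq (hab : a < b) (hx : ContDiffOn ℝ 3 x (Icc a b)) {t₀ t₁ : ℝ}
    (h01 : t₀ ≤ t₁) (h0 : a ≤ t₀) (h1 : t₁ ≤ b) :
    IntervalIntegrable (fun r => normSq M (iteratedDerivWithin 3 x (Icc a b) r)) volume t₀ t₁ := by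
  refine ContinuousOn.intervalIntegrable ?_
  rw [uIcc_of_le h01]
  exact ((continuous_normSq M).comp_continuousOn
    (hx.continuousOn_iteratedDerivWithin le_rfl (uniqueDiffOn_Icc hab))).mono
      (Icc_subset_Icc h0 h1)

variable [DecidableEq ι]

lemma normSq_eq_toBilin' (M : Matrix ι ι ℝ) (x : ι → ℝ) : normSq M x = Matrix.toBilin' M x x := by
  rw [Matrix.toBilin'_apply', normSq]

lemma hasDerivWithinAt_toBilin' (M : Matrix ι ι ℝ) {x : ℝ → ι → ℝ} {x' : ι → ℝ} {s : Set ℝ}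
    {r : ℝ} (h : HasDerivWithinAt x x' s r) (y : ι → ℝ) :
    HasDerivWithinAt (fun r => Matrix.toBilin' M (x r) y) (Matrix.toBilin' M x' y) s r :=
  ((Matrix.toBilin' M).flip y).toContinuousLinearMap.hasFDerivAt.comp_hasDerivWithinAt r h

/-- The variation of the second derivative, in a form which needs no square roots: `l` is the
weight in Young's inequality. -/
lemma abs_second_deriv_sub_le (hM : (Matrix.toBilin' M).IsPosSemidef) (hab : a < b)
    (hx : ContDiffOn ℝ 3 x (Icc a b)) {t₀ t₁ l : ℝ} (h0 : a ≤ t₀) (h1 : t₁ ≤ b) (hl : 0 < l)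
    (y : ι → ℝ) :
    ∀ r ∈ Icc t₀ t₁, |Matrix.toBilin' M (iteratedDerivWithin 2 x (Icc a b) r) y
        - Matrix.toBilin' M (iteratedDerivWithin 2 x (Icc a b) t₀) y|
      ≤ 1 / 2 * (l * (t₁ - t₀) * normSq M y
        + l⁻¹ * ∫ r in t₀..t₁, normSq M (iteratedDerivWithin 3 x (Icc a b) r)) := by
  intro r hr
  have h01 : t₀ ≤ t₁ := hr.1.trans hr.2
  set x3 := iteratedDerivWithin 3 x (Icc a b) with hx3
  have hderiv : ∀ s ∈ Icc a b, HasDerivWithinAt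
      (fun s => Matrix.toBilin' M (iteratedDerivWithin 2 x (Icc a b) s) y)
      (Matrix.toBilin' M (x3 s) y) (Icc a b) s := fun s hs =>
    hasDerivWithinAt_toBilin' M (hasDerivWithinAt_iteratedDerivWithin hab hx (by norm_num) hs) y
  have hcont3 : ContinuousOn (fun s => Matrix.toBilin' M (x3 s) y) (Icc a b) :=
    ((Matrix.toBilin' M).flip y).toContinuousLinearMap.continuous.comp_continuousOn
      (hx.continuousOn_iteratedDerivWithin le_rfl (uniqueDiffOn_Icc hab))
  have hsub : Icc t₀ r ⊆ Icc a b := Icc_subset_Icc h0 (hr.2.trans h1)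
  have hint : IntervalIntegrable (fun s => Matrix.toBilin' M (x3 s) y) volume t₀ r := by
    refine ContinuousOn.intervalIntegrable ?_
    rw [uIcc_of_le hr.1]
    exact hcont3.mono hsub
  have hFTC := intervalIntegral.integral_eq_sub_of_hasDerivAt_of_le hr.1
    (f := fun s => Matrix.toBilin' M (iteratedDerivWithin 2 x (Icc a b) s) y)
    (f' := fun s => Matrix.toBilin' M (x3 s) y)
    (fun s hs => ((hderiv s (hsub hs)).mono hsub).continuousWithinAt)
    (fun s hs => (hderiv s (hsub ⟨hs.1.le, hs.2.le⟩)).hasDerivAt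
      (Icc_mem_nhds (h0.trans_lt hs.1) (hs.2.trans_le (hr.2.trans h1)))) hint
  have hq := intervalIntegrable_normSq (M := M) hab hx h01 h0 h1
  have hbound : ∀ s, |Matrix.toBilin' M (x3 s) y| ≤ 1 / 2 * (l * normSq M y
      + l⁻¹ * normSq M (x3 s)) := by
    intro s
    have hy := hM.nonneg y
    have hs := hM.nonneg (x3 s)
    have hcs := form_sq_le hM (x3 s) y
    simp only [normSq_eq_toBilin']
    have key : ∀ z : ℝ, z ^ 2 = (Matrix.toBilin' M (x3 s) y) ^ 2 → 2 * z
        ≤ l * Matrix.toBilin' M y y + l⁻¹ * Matrix.toBilin' M (x3 s) (x3 s) := by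
      intro z hz
      refine two_mul_le_add_of_sq_le (by positivity) (by positivity) ?_
      rw [hz]
      refine hcs.trans (le_of_eq ?_)
      field_simp
    rw [abs_le]
    constructor
    · linarith [key (-Matrix.toBilin' M (x3 s) y) (by ring)]
    · linarith [key (Matrix.toBilin' M (x3 s) y) rfl]
  have hq2 : IntervalIntegrable (fun s => 1 / 2 * (l * normSq M y
      + l⁻¹ * normSq M (x3 s))) volume t₀ t₁ :=
    ((intervalIntegrable_const).add (hq.const_mul _)).const_mul _
  rw [← hFTC]
  calc |∫ s in t₀..r, Matrix.toBilin' M (x3 s) y|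
      ≤ ∫ s in t₀..r, |Matrix.toBilin' M (x3 s) y| :=
        intervalIntegral.abs_integral_le_integral_abs hr.1
    _ ≤ ∫ s in t₀..r, 1 / 2 * (l * normSq M y + l⁻¹ * normSq M (x3 s)) := by
        refine intervalIntegral.integral_mono_on hr.1 hint.abs
          (hq2.mono_set (uIcc_subset_uIcc left_mem_uIcc ?_)) (fun s _ => hbound s)
        rw [uIcc_of_le h01]; exact hr
    _ ≤ ∫ s in t₀..t₁, 1 / 2 * (l * normSq M y + l⁻¹ * normSq M (x3 s)) := by
        refine intervalIntegral.integral_mono_interval le_rfl hr.1 hr.2 ?_ hq2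
        exact Filter.Eventually.of_forall fun s => (abs_nonneg _).trans (hbound s)
    _ = _ := by
        rw [intervalIntegral.integral_const_mul, intervalIntegral.integral_add
          intervalIntegrable_const (hq.const_mul _), intervalIntegral.integral_const,
          intervalIntegral.integral_const_mul, smul_eq_mul]
        ring

/-- Taylor's formula for `x` and its derivative, with the expansion point at the left end. -/
lemma taylor_bounds (hab : a < b) (hx : ContDiffOn ℝ 3 x (Icc a b)) {t₀ t₁ I : ℝ} (h0 : a ≤ t₀)
    (h1 : t₁ ≤ b) (y z : ι → ℝ)
    (hI : ∀ r ∈ Icc t₀ t₁, |Matrix.toBilin' M (iteratedDerivWithin 2 x (Icc a b) r) y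
        - Matrix.toBilin' M z y| ≤ I) :
    ∀ r ∈ Icc t₀ t₁,
      |Matrix.toBilin' M (derivWithin x (Icc a b) r - derivWithin x (Icc a b) t₀
          - (r - t₀) • z) y| ≤ I * (r - t₀) ∧
      |Matrix.toBilin' M (x r - x t₀ - (r - t₀) • derivWithin x (Icc a b) t₀
          - ((r - t₀) ^ 2 / 2) • z) y| ≤ I * (r - t₀) ^ 2 / 2 := by
  have hsub : Icc t₀ t₁ ⊆ Icc a b := Icc_subset_Icc h0 h1
  have hd0 : ∀ r ∈ Icc t₀ t₁, HasDerivWithinAt x (derivWithin x (Icc a b) r) (Icc t₀ t₁) r := by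
    intro r hr
    have := hasDerivWithinAt_iteratedDerivWithin hab hx (i := 0) (by norm_num) (hsub hr)
    simp only [iteratedDerivWithin_zero, zero_add, iteratedDerivWithin_one] at this
    exact this.mono hsub
  have hd1 : ∀ r ∈ Icc t₀ t₁, HasDerivWithinAt (derivWithin x (Icc a b))
      (iteratedDerivWithin 2 x (Icc a b) r) (Icc t₀ t₁) r := by
    intro r hr
    have := hasDerivWithinAt_iteratedDerivWithin hab hx (i := 1) (by norm_num) (hsub hr)
    have e : iteratedDerivWithin 1 x (Icc a b) = derivWithin x (Icc a b) := by
      ext1 r; rw [iteratedDerivWithin_one]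
    rw [e] at this
    exact this.mono hsub
  have hlin : ∀ r : ℝ, HasDerivWithinAt (fun r : ℝ => r - t₀) 1 (Icc t₀ t₁) r := fun r =>
    (hasDerivWithinAt_id r _).sub_const _
  have first := abs_le_of_abs_deriv_le (j := 0) (C := I) (t₀ := t₀) (t₁ := t₁)
    (f := fun r => Matrix.toBilin' M (derivWithin x (Icc a b) r - derivWithin x (Icc a b) t₀
          - (r - t₀) • z) y)
    (f' := fun r => Matrix.toBilin' M (iteratedDerivWithin 2 x (Icc a b) r - z) y)
    (by simp) (by
      intro r hr
      refine hasDerivWithinAt_toBilin' M ?_ y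
      exact (((hd1 r hr).sub_const (derivWithin x (Icc a b) t₀)).sub
        ((hlin r).smul_const z)).congr_deriv (by simp)) (by
      intro r hr
      simpa [map_sub] using hI r hr)
  have second := abs_le_of_abs_deriv_le (j := 1) (C := I) (t₀ := t₀) (t₁ := t₁)
    (f := fun r => Matrix.toBilin' M (x r - x t₀ - (r - t₀) • derivWithin x (Icc a b) t₀
          - ((r - t₀) ^ 2 / 2) • z) y)
    (f' := fun r => Matrix.toBilin' M (derivWithin x (Icc a b) r - derivWithin x (Icc a b) t₀
          - (r - t₀) • z) y)
    (by simp) (by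
      intro r hr
      refine hasDerivWithinAt_toBilin' M ?_ y
      have := (((hd0 r hr).sub_const (x t₀)).sub
        ((hlin r).smul_const (derivWithin x (Icc a b) t₀))).sub
        ((((hlin r).pow 2).div_const 2).smul_const z)
      exact this.congr_deriv (by simp)) (by
      intro r hr
      simpa using first r hr)
  intro r hr
  refine ⟨by simpa using first r hr, ?_⟩
  have := second r hr
  norm_num at this ⊢
  exact this

/-- The absorption step shared by the two third order differences. -/
lemma le_of_young {q τ J c : ℝ} (hτ : 0 < τ) (hc : 0 < c)
    (h : ∀ l > 0, q ≤ c * τ ^ 2 * (1 / 2 * (l * (3 * τ) * q + l⁻¹ * J))) :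
    q ≤ 3 * c ^ 2 * τ ^ 5 * J := by
  have h1 := h (1 / (3 * c * τ ^ 3)) (by positivity)
  have e : c * τ ^ 2 * (1 / 2 * (1 / (3 * c * τ ^ 3) * (3 * τ) * q + (1 / (3 * c * τ ^ 3))⁻¹ * J))
      = 1 / 2 * q + 3 / 2 * c ^ 2 * τ ^ 5 * J := by field_simp
  rw [e] at h1
  linarith

lemma normSq_third_difference_le (hM : (Matrix.toBilin' M).IsPosSemidef) (hab : a < b)
    (hx : ContDiffOn ℝ 3 x (Icc a b)) {t₀ τ : ℝ} (hτ : 0 < τ) (h0 : a ≤ t₀)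
    (h1 : t₀ + 3 * τ ≤ b) :
    normSq M (x (t₀ + 3 * τ) - (3 : ℝ) • x (t₀ + 2 * τ) + (3 : ℝ) • x (t₀ + τ) - x t₀)
      ≤ 3 * 12 ^ 2 * τ ^ 5 * ∫ r in t₀..(t₀ + 3 * τ),
        normSq M (iteratedDerivWithin 3 x (Icc a b) r) := by
  refine le_of_young hτ (by norm_num) fun l hl => ?_
  set T := x (t₀ + 3 * τ) - (3 : ℝ) • x (t₀ + 2 * τ) + (3 : ℝ) • x (t₀ + τ) - x t₀ with hT
  have hI := abs_second_deriv_sub_le hM hab hx h0 h1 hl T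
  have ht := taylor_bounds (M := M) hab hx h0 h1 T _ hI
  have t1 := (ht (t₀ + τ) ⟨by linarith, by linarith⟩).2
  have t2 := (ht (t₀ + 2 * τ) ⟨by linarith, by linarith⟩).2
  have t3 := (ht (t₀ + 3 * τ) ⟨by linarith, by linarith⟩).2
  have hq : normSq M T = Matrix.toBilin' M (x (t₀ + 3 * τ) - (3 : ℝ) • x (t₀ + 2 * τ)
      + (3 : ℝ) • x (t₀ + τ) - x t₀) T := by rw [← hT, normSq_eq_toBilin']
  simp only [add_sub_cancel_left] at t1 t2 t3
  set I := 1 / 2 * (l * (3 * τ) * normSq M T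
    + l⁻¹ * ∫ r in t₀..(t₀ + 3 * τ), normSq M (iteratedDerivWithin 3 x (Icc a b) r))
  clear_value I
  rw [hq]
  simp only [map_add, map_sub, map_smul, LinearMap.add_apply, LinearMap.sub_apply,
    LinearMap.smul_apply, smul_eq_mul, abs_le] at t1 t2 t3 ⊢
  linarith

/-- The consistency error of the two-step backward difference formula. -/
lemma normSq_backward_difference_le (hM : (Matrix.toBilin' M).IsPosSemidef) (hab : a < b)
    (hx : ContDiffOn ℝ 3 x (Icc a b)) {t₀ τ : ℝ} (hτ : 0 < τ) (h0 : a ≤ t₀)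
    (h1 : t₀ + 3 * τ ≤ b) :
    normSq M ((3 : ℝ) • x (t₀ + 3 * τ) - (4 : ℝ) • x (t₀ + 2 * τ) + x (t₀ + τ)
        - (2 * τ) • derivWithin x (Icc a b) (t₀ + 3 * τ))
      ≤ 3 * 28 ^ 2 * τ ^ 5 * ∫ r in t₀..(t₀ + 3 * τ),
        normSq M (iteratedDerivWithin 3 x (Icc a b) r) := by
  refine le_of_young hτ (by norm_num) fun l hl => ?_
  set T := (3 : ℝ) • x (t₀ + 3 * τ) - (4 : ℝ) • x (t₀ + 2 * τ) + x (t₀ + τ)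
        - (2 * τ) • derivWithin x (Icc a b) (t₀ + 3 * τ) with hT
  have hI := abs_second_deriv_sub_le hM hab hx h0 h1 hl T
  have ht := taylor_bounds (M := M) hab hx h0 h1 T _ hI
  have t1 := (ht (t₀ + τ) ⟨by linarith, by linarith⟩).2
  have t2 := (ht (t₀ + 2 * τ) ⟨by linarith, by linarith⟩).2
  have t3 := (ht (t₀ + 3 * τ) ⟨by linarith, by linarith⟩).2
  have t3' := (ht (t₀ + 3 * τ) ⟨by linarith, by linarith⟩).1
  have hq : normSq M T = Matrix.toBilin' M ((3 : ℝ) • x (t₀ + 3 * τ) - (4 : ℝ) • x (t₀ + 2 * τ)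
      + x (t₀ + τ) - (2 * τ) • derivWithin x (Icc a b) (t₀ + 3 * τ)) T := by
    rw [← hT, normSq_eq_toBilin']
  simp only [add_sub_cancel_left] at t1 t2 t3 t3'
  set I := 1 / 2 * (l * (3 * τ) * normSq M T
    + l⁻¹ * ∫ r in t₀..(t₀ + 3 * τ), normSq M (iteratedDerivWithin 3 x (Icc a b) r))
  clear_value I
  rw [hq]
  simp only [map_add, map_sub, map_smul, LinearMap.add_apply, LinearMap.sub_apply,
    LinearMap.smul_apply, smul_eq_mul, abs_le] at t1 t2 t3 t3' ⊢
  have t3'' := mul_le_mul_of_nonneg_left t3'.1 hτ.le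
  linarith

lemma normSq_second_difference_le (hM : (Matrix.toBilin' M).IsPosSemidef) (hab : a < b)
    (hx : ContDiffOn ℝ 3 x (Icc a b)) {t₀ τ R : ℝ} (hτ : 0 < τ) (h0 : a ≤ t₀)
    (h1 : t₀ + 2 * τ ≤ b)
    (hR : ∀ r ∈ Icc a b, normSq M (iteratedDerivWithin 2 x (Icc a b) r) ≤ R) :
    normSq M (x (t₀ + 2 * τ) - (2 : ℝ) • x (t₀ + τ) + x t₀) ≤ 9 * τ ^ 4 * R := by
  rw [normSq_eq_toBilin']
  set S := x (t₀ + 2 * τ) - (2 : ℝ) • x (t₀ + τ) + x t₀ with hS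
  set q := Matrix.toBilin' M S S with hq
  have hq0 : 0 ≤ q := hM.nonneg S
  have hR0 : 0 ≤ R := by
    have := hR t₀ ⟨h0, by linarith⟩
    rw [normSq_eq_toBilin'] at this
    exact (hM.nonneg _).trans this
  have hI : ∀ r ∈ Icc t₀ (t₀ + 2 * τ), |Matrix.toBilin' M (iteratedDerivWithin 2 x (Icc a b) r) S
        - Matrix.toBilin' M 0 S| ≤ 1 / 2 * (q / (3 * τ ^ 2) + 3 * τ ^ 2 * R) := by
    intro r hr
    have h2 := hR r ⟨h0.trans hr.1, hr.2.trans h1⟩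
    rw [normSq_eq_toBilin'] at h2
    have h3 := form_sq_le hM (iteratedDerivWithin 2 x (Icc a b) r) S
    have key : ∀ z : ℝ, z ^ 2 = (Matrix.toBilin' M (iteratedDerivWithin 2 x (Icc a b) r) S) ^ 2 →
        2 * z ≤ q / (3 * τ ^ 2) + 3 * τ ^ 2 * R := by
      intro z hz
      refine two_mul_le_add_of_sq_le (by positivity) (by positivity) ?_
      rw [hz]
      refine h3.trans ((mul_le_mul_of_nonneg_right h2 hq0).trans (le_of_eq ?_))
      field_simp
    rw [map_zero, LinearMap.zero_apply, sub_zero, abs_le]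
    constructor
    · linarith [key (-Matrix.toBilin' M (iteratedDerivWithin 2 x (Icc a b) r) S) (by ring)]
    · linarith [key _ rfl]
  have ht := taylor_bounds (M := M) hab hx h0 h1 S 0 hI
  have t1 := (ht (t₀ + τ) ⟨by linarith, by linarith⟩).2
  have t2 := (ht (t₀ + 2 * τ) ⟨by linarith, by linarith⟩).2
  have hqe : q = Matrix.toBilin' M (x (t₀ + 2 * τ) - (2 : ℝ) • x (t₀ + τ) + x t₀) S := by
    rw [hq, ← hS]
  have hfin : q ≤ 3 * τ ^ 2 * (1 / 2 * (q / (3 * τ ^ 2) + 3 * τ ^ 2 * R)) := by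
    set I := 1 / 2 * (q / (3 * τ ^ 2) + 3 * τ ^ 2 * R)
    clear_value I q
    rw [hqe]
    simp only [add_sub_cancel_left, smul_zero, sub_zero, map_add, map_sub, map_smul,
      LinearMap.add_apply, LinearMap.sub_apply, LinearMap.smul_apply, smul_eq_mul, abs_le]
      at t1 t2 ⊢
    nlinarith
  have e : 3 * τ ^ 2 * (1 / 2 * (q / (3 * τ ^ 2) + 3 * τ ^ 2 * R))
      = 1 / 2 * q + 9 / 2 * τ ^ 4 * R := by field_simp; ring
  rw [e] at hfin
  linarith

end Consistency

/-- The integrals over overlapping windows of three time steps add up to at most three integrals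
over the whole time interval. -/
lemma sum_integral_windows_le {f : ℝ → ℝ} {a b τ : ℝ} {N : ℕ} (hτ : 0 < τ)
    (hN : a + (N + 2) * τ ≤ b) (hf : IntervalIntegrable f volume a b)
    (h0 : ∀ r ∈ Icc a b, 0 ≤ f r) :
    ∑ n ∈ Finset.range N, ∫ r in (a + n * τ)..(a + n * τ + 3 * τ), f r
      ≤ 3 * ∫ r in a..b, f r := by
  have hab : a ≤ b := by
    have : 0 ≤ ((N : ℝ) + 2) * τ := by positivity
    linarith
  let V : ℕ → ℝ := fun n => ∫ r in a..(a + n * τ), f r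
  have hmem : ∀ n : ℕ, n ≤ N + 2 → a + n * τ ∈ Icc a b := by
    intro n hn
    have h1 : (n : ℝ) * τ ≤ (N + 2) * τ :=
      mul_le_mul_of_nonneg_right (by exact_mod_cast hn) hτ.le
    have h2 : 0 ≤ (n : ℝ) * τ := by positivity
    exact ⟨by linarith, by linarith⟩
  have hint : ∀ s ∈ Icc a b, ∀ t ∈ Icc a b, IntervalIntegrable f volume s t := by
    intro s hs t ht
    refine hf.mono_set (uIcc_subset_uIcc ?_ ?_) <;> rw [uIcc_of_le hab] <;> assumption
  have hVle : ∀ n : ℕ, n ≤ N + 2 → V n ≤ ∫ r in a..b, f r := by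
    intro n hn
    refine intervalIntegral.integral_mono_interval le_rfl (hmem n hn).1 (hmem n hn).2 ?_ hf
    refine (ae_restrict_iff' measurableSet_Ioc).2 (Filter.Eventually.of_forall fun r hr => ?_)
    exact h0 r ⟨hr.1.le, hr.2⟩
  have hV0 : ∀ n : ℕ, n ≤ N + 2 → 0 ≤ V n := by
    intro n hn
    refine intervalIntegral.integral_nonneg (hmem n hn).1 fun r hr => ?_
    exact h0 r ⟨hr.1, hr.2.trans (hmem n hn).2⟩
  have hsum : ∀ n : ℕ, n ≤ N →
      ∑ i ∈ Finset.range n, ∫ r in (a + i * τ)..(a + i * τ + 3 * τ), f r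
        ≤ V (n + 2) + V (n + 1) + V n := by
    intro n
    induction n with
    | zero =>
      intro _
      have := hV0 2 (by omega)
      have := hV0 1 (by omega)
      have := hV0 0 (by omega)
      simp only [Finset.range_zero, Finset.sum_empty, zero_add]
      linarith
    | succ n ih =>
      intro hn
      rw [Finset.sum_range_succ]
      have e : a + (n : ℝ) * τ + 3 * τ = a + ((n + 3 : ℕ) : ℝ) * τ := by push_cast; ring
      have h1 := intervalIntegral.integral_interval_sub_left
        (hint a ⟨le_rfl, hab⟩ _ (hmem (n + 3) (by omega)))
        (hint a ⟨le_rfl, hab⟩ _ (hmem n (by omega)))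
      rw [e, ← h1]
      have := ih (by omega)
      change _ + (V (n + 3) - V n) ≤ V (n + 3) + V (n + 2) + V (n + 1)
      linarith
  linarith [hsum N le_rfl, hVle (N + 2) le_rfl, hVle (N + 1) (by omega), hVle N (by omega)]


/-! ### The error equation -/

section Differences

variable {X Y : Type*} [AddCommGroup X] [Module ℝ X] [AddCommGroup Y] [Module ℝ Y]

lemma backwardDiff_sub (x y : ℕ → X) (n : ℕ) :
    backwardDiff (x - y) n = backwardDiff x n - backwardDiff y n := by
  simp only [backwardDiff, Pi.sub_apply]; module

lemma secondDiff_sub (x y : ℕ → X) (n : ℕ) :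
    secondDiff (x - y) n = secondDiff x n - secondDiff y n := by
  simp only [secondDiff, Pi.sub_apply]; module

lemma thirdDiff_sub (x y : ℕ → X) (n : ℕ) :
    thirdDiff (x - y) n = thirdDiff x n - thirdDiff y n := by
  simp only [thirdDiff, Pi.sub_apply]; module

end Differences

open scoped Classical in
/-- The properties of the finite element matrices on which the error estimate relies. The vector
`Sum.elim 0 w` holds the coefficients of the extension by zero of a boundary function to the bulk
nodes; mass and stiffness of this extension are small compared to the mass on the boundary. -/
structure IsStableSystem {I B P : Type} [Fintype I] [Fintype B] [Fintype P]
    (S : SystemMatrices I B P) (τ : ℝ) : Prop where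
  mu : S.Mu.PosSemidef
  ku : S.Ku.PosSemidef
  mp : S.Mp.PosSemidef
  kp : S.Kp.PosSemidef
  mlam_symm : S.Mlamᵀ = S.Mlam
  mlam_unit : IsUnit S.Mlam.det
  bu : ∀ v, S.Bu *ᵥ v = S.Mlam *ᵥ (v ∘ Sum.inr)
  mass_extension : ∀ w : B → ℝ, 10000 * normSq S.Mu (Sum.elim 0 w) ≤ normSq S.Mlam w
  stiffness_extension : ∀ w : B → ℝ, 10000 * τ * normSq S.Ku (Sum.elim 0 w) ≤ normSq S.Mlam w
  projection : ∀ q, normSq S.Mlam (S.Mlam⁻¹ *ᵥ (S.Bp *ᵥ q)) ≤ normSq S.Mp q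

lemma isPosSemidef_toBilin' {ι : Type} [Fintype ι] [DecidableEq ι] {M : Matrix ι ι ℝ}
    (h : M.PosSemidef) : (Matrix.toBilin' M).IsPosSemidef where
  eq x y := by
    have : Mᵀ = M := h.1
    rw [Matrix.toBilin'_apply', Matrix.toBilin'_apply', dotProduct_comm,
      dotProduct_mulVec y, ← mulVec_transpose, this]
  nonneg x := by
    rw [Matrix.toBilin'_apply']
    exact h.dotProduct_mulVec_nonneg x

section Reduction

open scoped Classical

variable {I B P : Type} [Fintype I] [Fintype B] [Fintype P]

/-- The `L²` projection from the surface space to the multiplier space, in coefficients. -/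
noncomputable def traceProjection (S : SystemMatrices I B P) : (P → ℝ) →ₗ[ℝ] (B → ℝ) :=
  (S.Mlam⁻¹).mulVecLin ∘ₗ S.Bp.mulVecLin

/-- The bulk coefficients whose interior part is `x.1` and whose trace is the projection
of the surface function `x.2`. -/
noncomputable def bulkPart (S : SystemMatrices I B P) : (I → ℝ) × (P → ℝ) →ₗ[ℝ] (I ⊕ B → ℝ) where
  toFun x := Sum.elim x.1 (traceProjection S x.2)
  map_add' x y := by ext (i | i) <;> simp
  map_smul' c x := by ext (i | i) <;> simp

/-- The bulk coefficients that vanish in the interior nodes and whose trace is the projection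
of the surface function `x.2`. -/
noncomputable def boundaryPart (S : SystemMatrices I B P) : (I → ℝ) × (P → ℝ) →ₗ[ℝ] (I ⊕ B → ℝ) where
  toFun x := Sum.elim 0 (traceProjection S x.2)
  map_add' x y := by ext (i | i) <;> simp
  map_smul' c x := by ext (i | i) <;> simp

/-- The total mass form, on the functions that satisfy the coupling condition. -/
noncomputable def massForm (S : SystemMatrices I B P) : LinearMap.BilinForm ℝ ((I → ℝ) × (P → ℝ)) :=
  (Matrix.toBilin' S.Mu).compl₁₂ (bulkPart S) (bulkPart S)
    + (Matrix.toBilin' S.Mp).compl₁₂ (LinearMap.snd ℝ _ _) (LinearMap.snd ℝ _ _)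

/-- The total stiffness form, on the functions that satisfy the coupling condition. -/
noncomputable def stiffnessForm (S : SystemMatrices I B P) : LinearMap.BilinForm ℝ ((I → ℝ) × (P → ℝ)) :=
  (Matrix.toBilin' S.Ku).compl₁₂ (bulkPart S) (bulkPart S)
    + (Matrix.toBilin' S.Kp).compl₁₂ (LinearMap.snd ℝ _ _) (LinearMap.snd ℝ _ _)

lemma massForm_apply (S : SystemMatrices I B P) (x y : (I → ℝ) × (P → ℝ)) :
    massForm S x y = Matrix.toBilin' S.Mu (bulkPart S x) (bulkPart S y)
      + Matrix.toBilin' S.Mp x.2 y.2 := rfl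

lemma stiffnessForm_apply (S : SystemMatrices I B P) (x y : (I → ℝ) × (P → ℝ)) :
    stiffnessForm S x y = Matrix.toBilin' S.Ku (bulkPart S x) (bulkPart S y)
      + Matrix.toBilin' S.Kp x.2 y.2 := rfl

variable {S : SystemMatrices I B P} {τ : ℝ}

lemma IsStableSystem.massForm_posSemidef (hS : IsStableSystem S τ) :
    (massForm S).IsPosSemidef where
  eq x y := by
    have h1 := (isPosSemidef_toBilin' hS.mu).isSymm.eq (bulkPart S x) (bulkPart S y)
    have h2 := (isPosSemidef_toBilin' hS.mp).isSymm.eq x.2 y.2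
    rw [massForm_apply, massForm_apply, h1, h2]
  nonneg x := add_nonneg ((isPosSemidef_toBilin' hS.mu).nonneg _)
    ((isPosSemidef_toBilin' hS.mp).nonneg _)

lemma IsStableSystem.stiffnessForm_posSemidef (hS : IsStableSystem S τ) :
    (stiffnessForm S).IsPosSemidef where
  eq x y := by
    have h1 := (isPosSemidef_toBilin' hS.ku).isSymm.eq (bulkPart S x) (bulkPart S y)
    have h2 := (isPosSemidef_toBilin' hS.kp).isSymm.eq x.2 y.2
    rw [stiffnessForm_apply, stiffnessForm_apply, h1, h2]
  nonneg x := add_nonneg ((isPosSemidef_toBilin' hS.ku).nonneg _)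
    ((isPosSemidef_toBilin' hS.kp).nonneg _)

lemma IsStableSystem.mlam_mulVec_traceProjection (hS : IsStableSystem S τ) (q : P → ℝ) :
    S.Mlam *ᵥ traceProjection S q = S.Bp *ᵥ q := by
  simp [traceProjection, Matrix.mulVec_mulVec, ← Matrix.mul_assoc,
    Matrix.mul_nonsing_inv _ hS.mlam_unit]

lemma IsStableSystem.eq_traceProjection (hS : IsStableSystem S τ) {v : B → ℝ} {q : P → ℝ}
    (h : S.Mlam *ᵥ v = S.Bp *ᵥ q) : v = traceProjection S q := by
  have := congrArg (S.Mlam⁻¹ *ᵥ ·) h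
  simpa [traceProjection, Matrix.mulVec_mulVec, Matrix.nonsing_inv_mul _ hS.mlam_unit] using this

lemma IsStableSystem.bulkPart_eq (hS : IsStableSystem S τ) {v : I ⊕ B → ℝ} {q : P → ℝ}
    (h : S.Bu *ᵥ v = S.Bp *ᵥ q) : bulkPart S (v ∘ Sum.inl, q) = v := by
  rw [hS.bu] at h
  have := hS.eq_traceProjection h
  ext (i | i)
  · rfl
  · exact (congrFun this i).symm

lemma IsStableSystem.mass_boundaryPart (hS : IsStableSystem S τ) (x : (I → ℝ) × (P → ℝ)) :
    10000 * normSq S.Mu (boundaryPart S x) ≤ normSq S.Mp x.2 :=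
  (hS.mass_extension _).trans (hS.projection x.2)

lemma IsStableSystem.stiffness_boundaryPart (hS : IsStableSystem S τ)
    (x : (I → ℝ) × (P → ℝ)) :
    10000 * τ * normSq S.Ku (boundaryPart S x) ≤ normSq S.Mp x.2 :=
  (hS.stiffness_extension _).trans (hS.projection x.2)

lemma IsStableSystem.normSq_mp_le (hS : IsStableSystem S τ) (x : (I → ℝ) × (P → ℝ)) :
    normSq S.Mp x.2 ≤ massForm S x x := by
  rw [massForm_apply, ← normSq_eq_toBilin' S.Mp]
  linarith [(isPosSemidef_toBilin' hS.mu).nonneg (bulkPart S x)]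

lemma IsStableSystem.le_massForm (hS : IsStableSystem S τ) (x : (I → ℝ) × (P → ℝ)) :
    Matrix.toBilin' S.Mu (bulkPart S x) (bulkPart S x) ≤ massForm S x x := by
  rw [massForm_apply]
  linarith [(isPosSemidef_toBilin' hS.mp).nonneg x.2]

lemma IsStableSystem.le_stiffnessForm (hS : IsStableSystem S τ) (x : (I → ℝ) × (P → ℝ)) :
    Matrix.toBilin' S.Ku (bulkPart S x) (bulkPart S x) ≤ stiffnessForm S x x := by
  rw [stiffnessForm_apply]
  linarith [(isPosSemidef_toBilin' hS.kp).nonneg x.2]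

/-- The multiplier drops out of the equations tested with functions that satisfy the coupling
condition. -/
lemma IsStableSystem.multiplier_cancel (hS : IsStableSystem S τ) (lam : B → ℝ)
    (y : (I → ℝ) × (P → ℝ)) :
    bulkPart S y ⬝ᵥ Sum.elim (0 : I → ℝ) (S.Mlam *ᵥ lam) = y.2 ⬝ᵥ (S.Bpᵀ *ᵥ lam) := by
  have h1 : bulkPart S y ⬝ᵥ Sum.elim (0 : I → ℝ) (S.Mlam *ᵥ lam)
      = traceProjection S y.2 ⬝ᵥ (S.Mlam *ᵥ lam) := by
    simp [dotProduct, Fintype.sum_sum_type, bulkPart]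
  rw [h1, dotProduct_mulVec, ← mulVec_transpose, hS.mlam_symm, hS.mlam_mulVec_traceProjection,
    dotProduct_mulVec, vecMul_transpose]

lemma IsStableSystem.transpose_bu_mulVec (hS : IsStableSystem S τ) (lam : B → ℝ) :
    S.Buᵀ *ᵥ lam = Sum.elim (0 : I → ℝ) (S.Mlam *ᵥ lam) := by
  have h : ∀ v : I ⊕ B → ℝ, v ⬝ᵥ (S.Buᵀ *ᵥ lam) = v ⬝ᵥ Sum.elim (0 : I → ℝ) (S.Mlam *ᵥ lam) := by
    intro v
    have h1 : v ⬝ᵥ Sum.elim (0 : I → ℝ) (S.Mlam *ᵥ lam) = (v ∘ Sum.inr) ⬝ᵥ (S.Mlam *ᵥ lam) := by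
      simp [dotProduct, Fintype.sum_sum_type]
    rw [dotProduct_mulVec, vecMul_transpose, hS.bu, h1, dotProduct_mulVec, ← mulVec_transpose,
      hS.mlam_symm]
  ext i
  simpa using h (Pi.single i 1)

lemma mulVec_elim (M : Matrix (I ⊕ B) (I ⊕ B) ℝ) (x : I → ℝ) (y : B → ℝ) :
    M *ᵥ Sum.elim x y = Sum.elim (M.toBlocks₁₁ *ᵥ x + M.toBlocks₁₂ *ᵥ y)
      (M.toBlocks₂₁ *ᵥ x + M.toBlocks₂₂ *ᵥ y) := by
  conv_lhs => rw [← Matrix.fromBlocks_toBlocks M]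
  rw [Matrix.fromBlocks_mulVec]
  simp

/-- The semi-discrete problem, tested with a function that satisfies the coupling condition. -/
lemma IsStableSystem.tested_semidiscrete (hS : IsStableSystem S τ) {a b t : ℝ}
    {fu : ℝ → (I ⊕ B → ℝ)} {fp : ℝ → (P → ℝ)} {u : ℝ → (I ⊕ B → ℝ)} {p : ℝ → (P → ℝ)}
    {lam : ℝ → (B → ℝ)} (h : IsSemidiscreteSolution S a b fu fp u p lam) (ht : t ∈ Icc a b)
    (y : (I → ℝ) × (P → ℝ)) :
    Matrix.toBilin' S.Mu (derivWithin u (Icc a b) t) (bulkPart S y)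
      + Matrix.toBilin' S.Mp (derivWithin p (Icc a b) t) y.2
      + stiffnessForm S (u t ∘ Sum.inl, p t) y
      = bulkPart S y ⬝ᵥ fu t + y.2 ⬝ᵥ fp t := by
  have h1 := congrArg (bulkPart S y ⬝ᵥ ·) (h.bulk t ht)
  have h2 := congrArg (y.2 ⬝ᵥ ·) (h.surface t ht)
  have h3 : bulkPart S (u t ∘ Sum.inl, p t) = u t :=
    hS.bulkPart_eq (sub_eq_zero.1 (h.constraint t ht))
  have s1 := (isPosSemidef_toBilin' hS.mu).isSymm.eq (derivWithin u (Icc a b) t) (bulkPart S y)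
  have s2 := (isPosSemidef_toBilin' hS.mp).isSymm.eq (derivWithin p (Icc a b) t) y.2
  have s3 := (isPosSemidef_toBilin' hS.ku).isSymm.eq (u t) (bulkPart S y)
  have s4 := (isPosSemidef_toBilin' hS.kp).isSymm.eq (p t) y.2
  rw [hS.transpose_bu_mulVec] at h1
  simp only [dotProduct_add, dotProduct_sub, hS.multiplier_cancel, Matrix.toBilin'_apply'] at h1 h2 s1 s2 s3 s4
  rw [stiffnessForm_apply, h3]
  simp only [Matrix.toBilin'_apply']
  linarith

/-- One step of the auxiliary scheme, tested with a function that satisfies the coupling condition.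
Compared to the implicit scheme the boundary values of the bulk variable are replaced by
extrapolations, which gives rise to third and second differences. -/
lemma IsStableSystem.tested_step (hS : IsStableSystem S τ) (hτ : 0 < τ)
    {fu : ℝ → (I ⊕ B → ℝ)} {fp : ℝ → (P → ℝ)} {u : ℤ → (I ⊕ B → ℝ)} {p : ℤ → (P → ℝ)}
    {lam : ℤ → (B → ℝ)} {n : ℕ} (h : IsAuxiliaryStep S τ fu fp u p lam ((n : ℤ) + 1))
    {x : ℕ → (I → ℝ) × (P → ℝ)}
    (hx : ∀ j : ℕ, x j = (u ((j : ℤ) - 2) ∘ Sum.inl, p ((j : ℤ) - 2)))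
    (y : (I → ℝ) × (P → ℝ)) :
    massForm S (backwardDiff x n) y + 2 * τ * stiffnessForm S (x (n + 3)) y
      = 2 * τ * (bulkPart S y ⬝ᵥ fu (((n : ℤ) + 1 : ℤ) * τ) + y.2 ⬝ᵥ fp (((n : ℤ) + 1 : ℤ) * τ))
        + 3 * Matrix.toBilin' S.Mu (boundaryPart S (thirdDiff x n)) (bulkPart S y)
        + 2 * τ * Matrix.toBilin' S.Ku (boundaryPart S (secondDiff x (n + 1))) (bulkPart S y) := by
  have h1 := h.interior
  have h2 := h.multiplier
  have h3 := h.surface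
  have e3 : ((n : ℤ) + 1) = ((n + 3 : ℕ) : ℤ) - 2 := by push_cast; ring
  have e2 : ((n : ℤ) + 1) - 1 = ((n + 2 : ℕ) : ℤ) - 2 := by push_cast; ring
  have e1 : ((n : ℤ) + 1) - 2 = ((n + 1 : ℕ) : ℤ) - 2 := by push_cast; ring
  have e0 : ((n + 2 : ℕ) : ℤ) - 2 - 2 = (n : ℤ) - 2 := by push_cast; ring
  have e1' : ((n + 2 : ℕ) : ℤ) - 2 - 1 = ((n + 1 : ℕ) : ℤ) - 2 := by push_cast; ring
  set F := fu (((n : ℤ) + 1 : ℤ) * τ)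
  set H := fp (((n : ℤ) + 1 : ℤ) * τ)
  set l := lam ((n : ℤ) + 1)
  have x1 : ∀ j : ℕ, u ((j : ℤ) - 2) ∘ Sum.inl = (x j).1 := fun j => by rw [hx]
  have x2 : ∀ j : ℕ, p ((j : ℤ) - 2) = (x j).2 := fun j => by rw [hx]
  simp only [bdf, extrapolatedQuotient, e1, e2] at h1 h2 h3
  simp only [e0, e1'] at h1 h2
  rw [e3] at h1 h2 h3
  simp only [x1, x2] at h1 h2 h3
  have b1 : (1 / (2 * τ)) • ((3 : ℝ) • (x (n + 3)).1 - (4 : ℝ) • (x (n + 2)).1 + (x (n + 1)).1)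
      = (1 / (2 * τ)) • (backwardDiff x n).1 := rfl
  have b2 : (1 / (2 * τ)) • ((3 : ℝ) • (x (n + 3)).2 - (4 : ℝ) • (x (n + 2)).2 + (x (n + 1)).2)
      = (1 / (2 * τ)) • (backwardDiff x n).2 := rfl
  have b3 : (1 / (2 * τ)) • ((5 : ℝ) • (x (n + 2)).2 - (8 : ℝ) • (x (n + 1)).2
      + (3 : ℝ) • (x n).2)
      = (1 / (2 * τ)) • ((backwardDiff x n).2 - (3 : ℝ) • (thirdDiff x n).2) := by
    simp only [backwardDiff, thirdDiff, Prod.snd_add, Prod.snd_sub, Prod.smul_snd]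
    module
  have b4 : (2 : ℝ) • (x (n + 2)).2 - (x (n + 1)).2
      = (x (n + 3)).2 - (secondDiff x (n + 1)).2 := by
    simp only [secondDiff, Prod.snd_add, Prod.snd_sub, Prod.smul_snd]
    module
  have proj : ∀ q, S.Mlam⁻¹ *ᵥ (S.Bp *ᵥ q) = traceProjection S q := fun q => rfl
  -- the two bulk rows of the scheme, written as one equation
  have hbulk : S.Mu *ᵥ ((1 / (2 * τ)) • (bulkPart S (backwardDiff x n)
        - (3 : ℝ) • boundaryPart S (thirdDiff x n)))
      + S.Ku *ᵥ (bulkPart S (x (n + 3)) - boundaryPart S (secondDiff x (n + 1)))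
      - Sum.elim (0 : I → ℝ) (S.Mlam *ᵥ l) = F := by
    have c1 : (1 / (2 * τ)) • (bulkPart S (backwardDiff x n)
        - (3 : ℝ) • boundaryPart S (thirdDiff x n))
        = Sum.elim ((1 / (2 * τ)) • (backwardDiff x n).1)
          (traceProjection S ((1 / (2 * τ)) •
            ((backwardDiff x n).2 - (3 : ℝ) • (thirdDiff x n).2))) := by
      ext (i | i) <;> simp [bulkPart, boundaryPart]
    have c2 : bulkPart S (x (n + 3)) - boundaryPart S (secondDiff x (n + 1))
        = Sum.elim (x (n + 3)).1
          (traceProjection S ((x (n + 3)).2 - (secondDiff x (n + 1)).2)) := by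
      ext (i | i) <;> simp [bulkPart, boundaryPart]
    rw [c1, c2, mulVec_elim, mulVec_elim]
    rw [b1, b3, b4] at h1 h2
    rw [proj, proj] at h1 h2
    ext (i | i)
    · have := congrFun h1 i
      simp only [Pi.add_apply, Pi.sub_apply, Sum.elim_inl, Pi.zero_apply,
        Function.comp_apply] at this ⊢
      linarith
    · have := congrFun h2 i
      simp only [Pi.add_apply, Pi.sub_apply, Sum.elim_inr, Function.comp_apply] at this ⊢
      linarith
  have t1 := congrArg (bulkPart S y ⬝ᵥ ·) hbulk
  have t2 := congrArg (y.2 ⬝ᵥ ·) h3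
  rw [b2] at t2
  have s1 := (isPosSemidef_toBilin' hS.mu).isSymm.eq (bulkPart S (backwardDiff x n)) (bulkPart S y)
  have s2 := (isPosSemidef_toBilin' hS.mu).isSymm.eq (boundaryPart S (thirdDiff x n))
    (bulkPart S y)
  have s3 := (isPosSemidef_toBilin' hS.ku).isSymm.eq (bulkPart S (x (n + 3))) (bulkPart S y)
  have s4 := (isPosSemidef_toBilin' hS.ku).isSymm.eq (boundaryPart S (secondDiff x (n + 1)))
    (bulkPart S y)
  have s5 := (isPosSemidef_toBilin' hS.mp).isSymm.eq (backwardDiff x n).2 y.2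
  have s6 := (isPosSemidef_toBilin' hS.kp).isSymm.eq (x (n + 3)).2 y.2
  simp only [dotProduct_add, dotProduct_sub, mulVec_smul, mulVec_sub, dotProduct_smul, smul_eq_mul,
    hS.multiplier_cancel, Matrix.toBilin'_apply'] at t1 t2 s1 s2 s3 s4 s5 s6
  rw [massForm_apply, stiffnessForm_apply]
  simp only [Matrix.toBilin'_apply']
  rw [s1, s2, s3, s4, s5, s6, ← t1, ← t2]
  field_simp
  ring

end Reduction


/-! ### The error estimate for stable systems -/

section ErrorBound

open scoped Classical

variable {I B P : Type} [Fintype I] [Fintype B] [Fintype P] {S : SystemMatrices I B P} {τ : ℝ}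

/-- The error estimate for stable systems of matrices. The error of the pair `(u₁, p)` satisfies the
perturbed difference scheme of `splitting_error_bound` for the total mass and stiffness forms; the
consistency functionals collect the error of the difference formula and the differences of the
exact solution which the extrapolation introduces. -/
theorem IsStableSystem.error_bound (hS : IsStableSystem S τ) (hτ : 0 < τ) (hτ1 : τ ≤ 1)
    {T R C₀ : ℝ} (hT : 0 < T)
    {fu : ℝ → (I ⊕ B → ℝ)} {fp : ℝ → (P → ℝ)} {u : ℝ → (I ⊕ B → ℝ)} {p : ℝ → (P → ℝ)}
    {lam : ℝ → (B → ℝ)} (hsol : IsSemidiscreteSolution S (-2 * τ) T fu fp u p lam)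
    (hreg : IsRegular S (-2 * τ) T R u p)
    {uhat : ℤ → (I ⊕ B → ℝ)} {phat : ℤ → (P → ℝ)} {lamhat : ℤ → (B → ℝ)}
    (hcons : ∀ j : ℤ, -2 ≤ j → j ≤ 0 → S.Bu *ᵥ uhat j = S.Bp *ᵥ phat j)
    (hstep : ∀ n : ℤ, 1 ≤ n → n * τ ≤ T → IsAuxiliaryStep S τ fu fp uhat phat lamhat n)
    (hinit : ∀ j : ℤ, -2 ≤ j → j ≤ 0 →
      normSq S.Mu (uhat j - u (j * τ)) + τ * normSq S.Ku (uhat j - u (j * τ))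
        + normSq S.Mp (phat j - p (j * τ)) + τ * normSq S.Kp (phat j - p (j * τ))
        ≤ C₀ * τ ^ 4) (n : ℤ) (hn : -2 ≤ n) (hnT : n * τ ≤ T) :
    normSq S.Ku (uhat n - u (n * τ)) + normSq S.Kp (phat n - p (n * τ))
      ≤ (270000 * Real.exp (2 * T) * R + 120 * C₀) * τ ^ 3 := by
  have hab : -2 * τ < T := by linarith
  have mu0 := fun v => (isPosSemidef_toBilin' hS.mu).nonneg v
  have ku0 := fun v => (isPosSemidef_toBilin' hS.ku).nonneg v
  have mp0 := fun v => (isPosSemidef_toBilin' hS.mp).nonneg v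
  have kp0 := fun v => (isPosSemidef_toBilin' hS.kp).nonneg v
  have hR0 : 0 ≤ R := by
    have := hreg.bound_two T ⟨hab.le, le_rfl⟩
    rw [normSq_eq_toBilin'] at this
    exact (mp0 _).trans this
  have hC0 : 0 ≤ C₀ := by
    have := hinit 0 (by norm_num) le_rfl
    simp only [normSq_eq_toBilin'] at this
    have h1 := mul_nonneg hτ.le (ku0 (uhat 0 - u ((0 : ℤ) * τ)))
    have h2 := mul_nonneg hτ.le (kp0 (phat 0 - p ((0 : ℤ) * τ)))
    have h3 := mu0 (uhat 0 - u ((0 : ℤ) * τ))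
    have h4 := mp0 (phat 0 - p ((0 : ℤ) * τ))
    have : 0 ≤ C₀ * τ ^ 4 := by linarith
    exact nonneg_of_mul_nonneg_left this (by positivity)
  rcases le_or_gt n 0 with hn0 | hn0
  · have h := hinit n hn hn0
    simp only [normSq_eq_toBilin'] at h ⊢
    have h3 := mu0 (uhat n - u (n * τ))
    have h4 := mp0 (phat n - p (n * τ))
    have h5 : τ * (Matrix.toBilin' S.Ku (uhat n - u (n * τ)) (uhat n - u (n * τ))
        + Matrix.toBilin' S.Kp (phat n - p (n * τ)) (phat n - p (n * τ)))
        ≤ τ * ((0 + 1 * C₀) * τ ^ 3) := by linarith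
    refine (le_of_mul_le_mul_left h5 hτ).trans ?_
    gcongr
    · positivity
    · norm_num
  obtain ⟨N, rfl⟩ : ∃ N : ℕ, n = N := ⟨n.toNat, by omega⟩
  have hNT : (N : ℝ) * τ ≤ T := by exact_mod_cast hnT
  -- all sequences are shifted by two, so that the initial data have the indices 0, 1, 2
  let t : ℕ → ℝ := fun j => (((j : ℤ) - 2 : ℤ) : ℝ) * τ
  let xh : ℕ → (I → ℝ) × (P → ℝ) := fun j => (uhat ((j : ℤ) - 2) ∘ Sum.inl, phat ((j : ℤ) - 2))
  let x : ℕ → (I → ℝ) × (P → ℝ) := fun j => (u (t j) ∘ Sum.inl, p (t j))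
  have ht : ∀ j : ℕ, t j = -2 * τ + j * τ := by intro j; simp only [t]; push_cast; ring
  have htmem : ∀ j ≤ N + 2, t j ∈ Icc (-2 * τ) T := by
    intro j hj
    rw [ht]
    have h1 : (j : ℝ) * τ ≤ (N + 2) * τ :=
      mul_le_mul_of_nonneg_right (by exact_mod_cast hj) hτ.le
    have h2 : 0 ≤ (j : ℝ) * τ := by positivity
    exact ⟨by linarith, by linarith⟩
  have hbx : ∀ j ≤ N + 2, bulkPart S (x j) = u (t j) := fun j hj =>
    hS.bulkPart_eq (sub_eq_zero.1 (hsol.constraint _ (htmem j hj)))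
  have hbxh : ∀ j ≤ N + 2, bulkPart S (xh j) = uhat ((j : ℤ) - 2) := by
    intro j hj
    refine hS.bulkPart_eq ?_
    rcases le_or_gt j 2 with h | h
    · exact hcons _ (by omega) (by omega)
    · rw [hS.bu]
      have hle : ((((j : ℤ) - 2 : ℤ)) : ℝ) * τ ≤ T := (htmem j hj).2
      exact (hstep _ (by omega) hle).trace
  -- the derivatives of the exact solution at the times of the scheme
  let u' : ℕ → I ⊕ B → ℝ := fun j => derivWithin u (Icc (-2 * τ) T) (t j)
  let p' : ℕ → P → ℝ := fun j => derivWithin p (Icc (-2 * τ) T) (t j)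
  let δu : ℕ → I ⊕ B → ℝ := fun n => backwardDiff (fun j => u (t j)) n - (2 * τ) • u' (n + 3)
  let δp : ℕ → P → ℝ := fun n => backwardDiff (fun j => p (t j)) n - (2 * τ) • p' (n + 3)
  let s : ℕ → (I → ℝ) × (P → ℝ) →ₗ[ℝ] ℝ := fun n => (1 / (2 * τ)) •
    ((3 : ℝ) • (Matrix.toBilin' S.Mu (boundaryPart S (thirdDiff x n))) ∘ₗ bulkPart S
      - (Matrix.toBilin' S.Mu (δu n)) ∘ₗ bulkPart S
      - (Matrix.toBilin' S.Mp (δp n)) ∘ₗ LinearMap.snd ℝ _ _)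
  let Γ : ℕ → (I → ℝ) × (P → ℝ) →ₗ[ℝ] ℝ := fun n =>
    (Matrix.toBilin' S.Ku (boundaryPart S (secondDiff x n))) ∘ₗ bulkPart S
  let β : LinearMap.BilinForm ℝ ((I → ℝ) × (P → ℝ)) :=
    (Matrix.toBilin' S.Mu).compl₁₂ (boundaryPart S) (bulkPart S)
  let γ : LinearMap.BilinForm ℝ ((I → ℝ) × (P → ℝ)) :=
    (Matrix.toBilin' S.Ku).compl₁₂ (boundaryPart S) (bulkPart S)
  have hβ1 : ∀ z y, 10000 * (β z y) ^ 2 ≤ normSq S.Mp z.2 * massForm S y y := by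
    intro z y
    have h1 := form_sq_le (isPosSemidef_toBilin' hS.mu) (boundaryPart S z) (bulkPart S y)
    have h2 := hS.mass_boundaryPart z
    have h3 := hS.le_massForm y
    rw [normSq_eq_toBilin'] at h2
    calc 10000 * (β z y) ^ 2 ≤ 10000 * (Matrix.toBilin' S.Mu (boundaryPart S z) (boundaryPart S z)
          * Matrix.toBilin' S.Mu (bulkPart S y) (bulkPart S y)) :=
          mul_le_mul_of_nonneg_left h1 (by norm_num)
      _ = 10000 * Matrix.toBilin' S.Mu (boundaryPart S z) (boundaryPart S z)
          * Matrix.toBilin' S.Mu (bulkPart S y) (bulkPart S y) := by ring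
      _ ≤ normSq S.Mp z.2 * massForm S y y :=
          mul_le_mul h2 h3 (mu0 _) (by rw [normSq_eq_toBilin']; exact mp0 _)
  have hγ1 : ∀ z y, 10000 * τ * (γ z y) ^ 2 ≤ normSq S.Mp z.2 * stiffnessForm S y y := by
    intro z y
    have h1 := form_sq_le (isPosSemidef_toBilin' hS.ku) (boundaryPart S z) (bulkPart S y)
    have h2 := hS.stiffness_boundaryPart z
    have h3 := hS.le_stiffnessForm y
    rw [normSq_eq_toBilin'] at h2
    calc 10000 * τ * (γ z y) ^ 2
        ≤ 10000 * τ * (Matrix.toBilin' S.Ku (boundaryPart S z) (boundaryPart S z)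
          * Matrix.toBilin' S.Ku (bulkPart S y) (bulkPart S y)) :=
          mul_le_mul_of_nonneg_left h1 (by positivity)
      _ = 10000 * τ * Matrix.toBilin' S.Ku (boundaryPart S z) (boundaryPart S z)
          * Matrix.toBilin' S.Ku (bulkPart S y) (bulkPart S y) := by ring
      _ ≤ normSq S.Mp z.2 * stiffnessForm S y y :=
          mul_le_mul h2 h3 (ku0 _) (by rw [normSq_eq_toBilin']; exact mp0 _)
  have hm0 := fun y => hS.massForm_posSemidef.nonneg y
  have hk0 := fun y => hS.stiffnessForm_posSemidef.nonneg y
  -- the integrals of the third derivatives over the time windows of the difference quotients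
  let f : ℝ → ℝ := fun r => normSq S.Mu (iteratedDerivWithin 3 u (Icc (-2 * τ) T) r)
    + normSq S.Mp (iteratedDerivWithin 3 p (Icc (-2 * τ) T) r)
  let J : ℕ → ℝ := fun n => ∫ r in (-2 * τ + n * τ)..(-2 * τ + n * τ + 3 * τ), f r
  have hf0 : ∀ r, 0 ≤ f r := by
    intro r
    simp only [f, normSq_eq_toBilin']
    exact add_nonneg (mu0 _) (mp0 _)
  have hJ0 : ∀ n, 0 ≤ J n := fun n => intervalIntegral.integral_nonneg (by linarith) fun r _ => hf0 r
  have hJsum : ∑ n ∈ Finset.range N, J n ≤ 3 * R := by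
    refine (sum_integral_windows_le hτ (b := T) (by linarith) ?_ fun r _ => hf0 r).trans ?_
    · exact (intervalIntegrable_normSq hab hreg.smooth_u hab.le le_rfl le_rfl).add
        (intervalIntegrable_normSq hab hreg.smooth_p hab.le le_rfl le_rfl)
    · exact mul_le_mul_of_nonneg_left hreg.bound_three (by norm_num)
  have htime : ∀ n : ℕ, t (n + 1) = t n + τ ∧ t (n + 2) = t n + 2 * τ ∧ t (n + 3) = t n + 3 * τ := by
    intro n
    simp only [ht]
    push_cast
    refine ⟨by ring, by ring, by ring⟩
  have hwin : ∀ n < N, -2 * τ ≤ t n ∧ t n + 3 * τ ≤ T := by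
    intro n hn
    refine ⟨(htmem n (by omega)).1, ?_⟩
    rw [← (htime n).2.2]
    exact (htmem (n + 3) (by omega)).2
  have hJsplit : ∀ n < N, J n
      = (∫ r in (t n)..(t n + 3 * τ), normSq S.Mu (iteratedDerivWithin 3 u (Icc (-2 * τ) T) r))
        + ∫ r in (t n)..(t n + 3 * τ),
          normSq S.Mp (iteratedDerivWithin 3 p (Icc (-2 * τ) T) r) := by
    intro n hn
    obtain ⟨h1, h2⟩ := hwin n hn
    simp only [J, ← ht]
    exact intervalIntegral.integral_add
      (intervalIntegrable_normSq hab hreg.smooth_u (by linarith) h1 h2)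
      (intervalIntegrable_normSq hab hreg.smooth_p (by linarith) h1 h2)
  have hJu0 : ∀ n, 0 ≤ ∫ r in (t n)..(t n + 3 * τ),
      normSq S.Mu (iteratedDerivWithin 3 u (Icc (-2 * τ) T) r) := fun n =>
    intervalIntegral.integral_nonneg (by linarith) fun r _ => by
      rw [normSq_eq_toBilin']; exact mu0 _
  have hthird : ∀ n < N, normSq S.Mp (thirdDiff x n).2 ≤ 432 * τ ^ 5 * J n := by
    intro n hn
    obtain ⟨h1, h2⟩ := hwin n hn
    have h := normSq_third_difference_le (isPosSemidef_toBilin' hS.mp) hab hreg.smooth_p hτ h1 h2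
    rw [← (htime n).1, ← (htime n).2.1, ← (htime n).2.2] at h
    refine le_trans h ?_
    rw [hJsplit n hn, ← (htime n).2.2]
    have := hJu0 n
    rw [← (htime n).2.2] at this
    rw [show (3 : ℝ) * 12 ^ 2 = 432 by norm_num]
    gcongr
    linarith
  have hdelta : ∀ n < N, normSq S.Mu (δu n) + normSq S.Mp (δp n) ≤ 2352 * τ ^ 5 * J n := by
    intro n hn
    obtain ⟨h1, h2⟩ := hwin n hn
    have hp := normSq_backward_difference_le (isPosSemidef_toBilin' hS.mp) hab hreg.smooth_p hτ h1 h2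
    have hu := normSq_backward_difference_le (isPosSemidef_toBilin' hS.mu) hab hreg.smooth_u hτ h1 h2
    rw [hJsplit n hn]
    rw [← (htime n).1, ← (htime n).2.1, ← (htime n).2.2] at hp hu
    rw [← (htime n).2.2]
    refine (add_le_add hu hp).trans (le_of_eq ?_)
    norm_num
    ring
  have hsecond : ∀ n ≤ N, normSq S.Mp (secondDiff x n).2 ≤ 9 * τ ^ 4 * R := by
    intro n hn
    have h1 := (htmem n (by omega)).1
    have h2 := (htmem (n + 2) (by omega)).2
    rw [(htime n).2.1] at h2
    have h := normSq_second_difference_le (isPosSemidef_toBilin' hS.mp) hab hreg.smooth_p hτ h1 h2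
      hreg.bound_two
    rwa [← (htime n).1, ← (htime n).2.1] at h
  have main := splitting_error_bound hS.massForm_posSemidef hS.stiffnessForm_posSemidef (β := β)
    (γ := γ) (T := T) (Q := 9 * R) (G := 5616 * R) (K := C₀) (N := N) (s := s) (Γ := Γ)
    (g := fun n => 1872 * τ ^ 3 * J n) (t := fun n => 432 * τ ^ 5 * J n) (e := xh - x)
    hτ hτ1 hNT (by positivity) (by positivity)
    (fun z y => (hβ1 z y).trans (mul_le_mul_of_nonneg_right (hS.normSq_mp_le z) (hm0 y)))
    (fun z y => (hγ1 z y).trans (mul_le_mul_of_nonneg_right (hS.normSq_mp_le z) (hk0 y)))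
    (fun n => by have := hJ0 n; positivity) (fun n => by have := hJ0 n; positivity)
    (by
      intro n hn y
      have b1 := hβ1 (thirdDiff x n) y
      have b2 := form_sq_le (isPosSemidef_toBilin' hS.mu) (δu n) (bulkPart S y)
      have b3 := form_sq_le (isPosSemidef_toBilin' hS.mp) (δp n) y.2
      have c2 : (Matrix.toBilin' S.Mu (δu n) (bulkPart S y)) ^ 2
          ≤ normSq S.Mu (δu n) * massForm S y y := by
        rw [normSq_eq_toBilin']
        exact b2.trans (mul_le_mul_of_nonneg_left (hS.le_massForm y) (mu0 _))
      have c3 : (Matrix.toBilin' S.Mp (δp n) y.2) ^ 2 ≤ normSq S.Mp (δp n) * massForm S y y := by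
        have := hS.normSq_mp_le y
        rw [normSq_eq_toBilin'] at this ⊢
        exact b3.trans (mul_le_mul_of_nonneg_left this (mp0 _))
      have d1 := mul_le_mul_of_nonneg_right (hthird n hn) (hm0 y)
      have d2 := mul_le_mul_of_nonneg_right (hdelta n hn) (hm0 y)
      set A := β (thirdDiff x n) y with hA
      set D := Matrix.toBilin' S.Mu (δu n) (bulkPart S y) with hD
      set E := Matrix.toBilin' S.Mp (δp n) y.2 with hE
      have hs : s n y = (3 * A - D - E) / (2 * τ) := by
        have : s n y = 1 / (2 * τ) * (3 * A - D - E) := rfl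
        rw [this]; ring
      have h3 : (3 * A - D - E) ^ 2 ≤ 27 * A ^ 2 + 3 * D ^ 2 + 3 * E ^ 2 := by
        nlinarith [sq_nonneg (3 * A + D), sq_nonneg (3 * A + E), sq_nonneg (D - E)]
      rw [hs, div_pow, div_le_iff₀ (by positivity)]
      have e : 1872 * τ ^ 3 * J n * massForm S y y * (2 * τ) ^ 2
          = 7488 * τ ^ 5 * J n * massForm S y y := by ring
      rw [e]
      linarith [sq_nonneg A])
    (by
      intro n hn y
      have h1 := hγ1 (secondDiff x n) y
      have h2 := mul_le_mul_of_nonneg_right (hsecond n hn) (hk0 y)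
      change (γ (secondDiff x n) y) ^ 2 ≤ _
      refine le_of_mul_le_mul_left ?_ hτ
      have h3 := mul_nonneg hτ.le (sq_nonneg (γ (secondDiff x n) y))
      calc τ * (γ (secondDiff x n) y) ^ 2 ≤ 9 * τ ^ 4 * R * stiffnessForm S y y := by linarith
        _ = τ * (τ ^ 3 * (9 * R) * stiffnessForm S y y) := by ring)
    (by
      intro n hn y
      have h1 := hγ1 (thirdDiff x n) y
      have h2 := mul_le_mul_of_nonneg_right (hthird n hn) (hk0 y)
      have e : Γ (n + 1) y - Γ n y = γ (thirdDiff x n) y := by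
        rw [thirdDiff_eq, map_sub, LinearMap.sub_apply]; rfl
      rw [e]
      have h3 := mul_nonneg hτ.le (sq_nonneg (γ (thirdDiff x n) y))
      linarith)
    (by
      rw [← Finset.mul_sum]
      calc 1872 * τ ^ 3 * ∑ n ∈ Finset.range N, J n ≤ 1872 * τ ^ 3 * (3 * R) := by gcongr
        _ = 5616 * R * τ ^ 3 := by ring)
    (by
      rw [← Finset.mul_sum]
      calc 432 * τ ^ 5 * ∑ n ∈ Finset.range N, J n ≤ 432 * τ ^ 5 * (3 * R) := by gcongr
        _ = 1296 * R * τ ^ 5 := by ring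
        _ ≤ 5616 * R * τ ^ 5 := by gcongr; norm_num)
    (by
      intro n hn y
      have hle : (((n : ℤ) + 1 : ℤ) : ℝ) * τ ≤ T := by
        have := (htmem (n + 3) (by omega)).2
        rw [ht] at this
        push_cast at this ⊢
        linarith
      have ht3 : (((n : ℤ) + 1 : ℤ) : ℝ) * τ = t (n + 3) := by
        rw [ht]; push_cast; ring
      have h1 := hS.tested_step hτ (hstep ((n : ℤ) + 1) (by omega) hle) (x := xh) (fun j => rfl) y
      have h2 := hS.tested_semidiscrete hsol (htmem (n + 3) (by omega)) y
      rw [ht3] at h1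
      have h3 : massForm S (backwardDiff x n) y
          = Matrix.toBilin' S.Mu (backwardDiff (fun j => u (t j)) n) (bulkPart S y)
            + Matrix.toBilin' S.Mp (backwardDiff (fun j => p (t j)) n) y.2 := by
        rw [massForm_apply]
        congr 3
        simp only [backwardDiff, map_add, map_sub, map_smul]
        rw [hbx (n + 3) (by omega), hbx (n + 2) (by omega), hbx (n + 1) (by omega)]
      have h4 : 2 * τ * s n y = 3 * β (thirdDiff x n) y
          - Matrix.toBilin' S.Mu (δu n) (bulkPart S y) - Matrix.toBilin' S.Mp (δp n) y.2 := by
        have : s n y = 1 / (2 * τ) * (3 * β (thirdDiff x n) y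
          - Matrix.toBilin' S.Mu (δu n) (bulkPart S y) - Matrix.toBilin' S.Mp (δp n) y.2) := rfl
        rw [this]; field_simp
      have h5 : Γ (n + 1) y = γ (secondDiff x (n + 1)) y := rfl
      have h6 : Matrix.toBilin' S.Mu (δu n) (bulkPart S y)
          = Matrix.toBilin' S.Mu (backwardDiff (fun j => u (t j)) n) (bulkPart S y)
            - 2 * τ * Matrix.toBilin' S.Mu (u' (n + 3)) (bulkPart S y) := by
        simp only [δu, map_sub, map_smul, LinearMap.sub_apply, LinearMap.smul_apply, smul_eq_mul]
      have h7 : Matrix.toBilin' S.Mp (δp n) y.2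
          = Matrix.toBilin' S.Mp (backwardDiff (fun j => p (t j)) n) y.2
            - 2 * τ * Matrix.toBilin' S.Mp (p' (n + 3)) y.2 := by
        simp only [δp, map_sub, map_smul, LinearMap.sub_apply, LinearMap.smul_apply, smul_eq_mul]
      have h8 : Matrix.toBilin' S.Mu (boundaryPart S (thirdDiff xh n)) (bulkPart S y)
          = β (thirdDiff xh n) y := rfl
      have h9 : Matrix.toBilin' S.Ku (boundaryPart S (secondDiff xh (n + 1))) (bulkPart S y)
          = γ (secondDiff xh (n + 1)) y := rfl
      have h10 : stiffnessForm S (u (t (n + 3)) ∘ Sum.inl, p (t (n + 3))) y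
          = stiffnessForm S (x (n + 3)) y := rfl
      rw [h8, h9] at h1
      rw [h10] at h2
      have h2' := congrArg (2 * τ * ·) h2
      simp only [mul_add] at h2'
      rw [backwardDiff_sub, secondDiff_sub, thirdDiff_sub, Pi.sub_apply, mul_add (2 * τ) (s n y), h4,
        h5, h6, h7]
      simp only [map_sub, LinearMap.sub_apply]
      rw [h3]
      linarith)
    (by
      intro j hj
      have h := hinit ((j : ℤ) - 2) (by omega) (by omega)
      rw [massForm_apply, stiffnessForm_apply, Pi.sub_apply, map_sub, hbx j (by omega),
        hbxh j (by omega)]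
      simp only [normSq_eq_toBilin'] at h
      calc _ = _ := ?_
        _ ≤ _ := h
      simp only [xh, x, t, Prod.snd_sub]
      ring)
  have h := main N le_rfl
  rw [stiffnessForm_apply, Pi.sub_apply, map_sub, hbx _ le_rfl, hbxh _ le_rfl] at h
  have e : (((N + 2 : ℕ) : ℤ) - 2) = (N : ℤ) := by push_cast; ring
  have e' : t (N + 2) = ((N : ℤ) : ℝ) * τ := by simp only [t, e]
  simp only [xh, x, Prod.snd_sub, e, e'] at h
  rw [normSq_eq_toBilin', normSq_eq_toBilin']
  refine h.trans (le_of_eq ?_)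
  ring

end ErrorBound


/-! ### Barycentric coordinates and Lagrange functions on a triangulation -/

section Triangulation

open scoped Classical

variable {d : ℕ}

/-- `w` is the vector of barycentric coordinates of `x` in the simplex with vertices `K`, extended by
zero to all other points. -/
def BarycentricIn (K : Finset (Space d)) (x : Space d) (w : Space d → ℝ) : Prop :=
  (∀ v ∈ K, 0 ≤ w v) ∧ (∀ v, v ∉ K → w v = 0) ∧ ∑ v ∈ K, w v = 1 ∧ ∑ v ∈ K, w v • v = x

lemma mem_simplex_iff {K : Finset (Space d)} {x : Space d} :
    x ∈ simplex K ↔ ∃ w, BarycentricIn K x w := by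
  rw [simplex, Finset.mem_convexHull']
  constructor
  · rintro ⟨w, h0, h1, h2⟩
    refine ⟨fun v => if v ∈ K then w v else 0, fun v hv => by simpa [hv] using h0 v hv,
      fun v hv => by simp [hv], ?_, ?_⟩
    · rw [← h1]; exact Finset.sum_congr rfl fun v hv => by simp [hv]
    · rw [← h2]; exact Finset.sum_congr rfl fun v hv => by simp [hv]
  · rintro ⟨w, h0, -, h1, h2⟩
    exact ⟨w, h0, h1, h2⟩

lemma BarycentricIn.mono {K L : Finset (Space d)} {x : Space d} {w : Space d → ℝ} (hKL : K ⊆ L)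
    (h : BarycentricIn K x w) : BarycentricIn L x w := by
  obtain ⟨h0, h1, h2, h3⟩ := h
  refine ⟨fun v _ => ?_, fun v hv => h1 v fun h => hv (hKL h), ?_, ?_⟩
  · by_cases hv : v ∈ K
    · exact h0 v hv
    · rw [h1 v hv]
  · rw [← h2]
    exact (Finset.sum_subset hKL fun v _ hv => h1 v hv).symm
  · rw [← h3]
    exact (Finset.sum_subset hKL fun v _ hv => by rw [h1 v hv, zero_smul]).symm

lemma BarycentricIn.unique {K : Finset (Space d)}
    (hK : AffineIndependent ℝ (fun v : K => (v : Space d))) {x : Space d} {w w' : Space d → ℝ}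
    (h : BarycentricIn K x w) (h' : BarycentricIn K x w') : w = w' := by
  have := hK.eq_zero_of_sum_eq_zero_subtype (w := fun v => w v - w' v)
    (by rw [Finset.sum_sub_distrib, h.2.2.1, h'.2.2.1, sub_self])
    (by simp only [sub_smul]; rw [Finset.sum_sub_distrib, h.2.2.2, h'.2.2.2, sub_self])
  funext v
  by_cases hv : v ∈ K
  · exact sub_eq_zero.1 (this v hv)
  · rw [h.2.1 v hv, h'.2.1 v hv]

lemma BarycentricIn.le_one {K : Finset (Space d)} {x : Space d} {w : Space d → ℝ}
    (h : BarycentricIn K x w) (v : Space d) : w v ≤ 1 := by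
  by_cases hv : v ∈ K
  · rw [← h.2.2.1]
    exact Finset.single_le_sum h.1 hv
  · rw [h.2.1 v hv]; exact zero_le_one

lemma BarycentricIn.nonneg {K : Finset (Space d)} {x : Space d} {w : Space d → ℝ}
    (h : BarycentricIn K x w) (v : Space d) : 0 ≤ w v := by
  by_cases hv : v ∈ K
  · exact h.1 v hv
  · rw [h.2.1 v hv]

variable {𝒯 : Finset (Finset (Space d))} {r : ℕ} {S : Set (Space d)}

/-- The hat functions are well defined, since elements meet in common faces: they agree with the
barycentric coordinates of any element. -/
lemma IsTriangulation.hat_eq (hT : IsTriangulation 𝒯 r S) {K : Finset (Space d)} (hK : K ∈ 𝒯)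
    {x : Space d} {w : Space d → ℝ} (hw : BarycentricIn K x w) (v : Space d) :
    hat 𝒯 v x = w v := by
  have hex : ∃ w, IsBarycentric 𝒯 x w := ⟨w, K, hK, hw⟩
  rw [hat, dif_pos hex]
  obtain ⟨L, hL, hwL⟩ := hex.choose_spec
  have hx : x ∈ simplex (K ∩ L) := by
    rw [← hT.inter K hK L hL]
    exact ⟨mem_simplex_iff.2 ⟨_, hw⟩, mem_simplex_iff.2 ⟨_, hwL⟩⟩
  obtain ⟨w', hw'⟩ := mem_simplex_iff.1 hx
  rw [hw.unique (hT.indep K hK) (hw'.mono Finset.inter_subset_left),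
    BarycentricIn.unique (hT.indep L hL) hwL (hw'.mono Finset.inter_subset_right)]

lemma IsTriangulation.barycentricIn_hat (hT : IsTriangulation 𝒯 r S) {K G : Finset (Space d)}
    (hK : K ∈ 𝒯) (hG : G ⊆ K) {x : Space d} (hx : x ∈ simplex G) :
    BarycentricIn G x (fun v => hat 𝒯 v x) := by
  obtain ⟨w, hw⟩ := mem_simplex_iff.1 hx
  have : (fun v => hat 𝒯 v x) = w := funext fun v => hT.hat_eq hK (hw.mono hG) v
  rwa [this]

/-- On an element the hat functions are affine. -/
lemma IsTriangulation.exists_affine_eq_hat (hT : IsTriangulation 𝒯 d S) {K : Finset (Space d)}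
    (hK : K ∈ 𝒯) (v : Space d) :
    ∃ l : Space d →ᵃ[ℝ] ℝ, ∀ x ∈ simplex K, hat 𝒯 v x = l x := by
  by_cases hv : v ∈ K
  · have htot : affineSpan ℝ (range fun v : K => (v : Space d)) = ⊤ := by
      rw [(hT.indep K hK).affineSpan_eq_top_iff_card_eq_finrank_add_one]
      simp [hT.card_eq K hK]
    let b : AffineBasis K ℝ (Space d) := ⟨_, hT.indep K hK, htot⟩
    refine ⟨b.coord ⟨v, hv⟩, fun x hx => ?_⟩
    have hw := hT.barycentricIn_hat hK subset_rfl hx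
    have h1 : ∑ i : K, hat 𝒯 (i : Space d) x = 1 := by
      rw [Finset.sum_coe_sort K (fun v => hat 𝒯 v x)]; exact hw.2.2.1
    have h2 : Finset.univ.affineCombination ℝ b (fun i : K => hat 𝒯 (i : Space d) x) = x := by
      rw [Finset.affineCombination_eq_linear_combination _ _ _ h1]
      change ∑ i : K, hat 𝒯 (i : Space d) x • (i : Space d) = x
      rw [Finset.sum_coe_sort K (fun v => hat 𝒯 v x • v)]; exact hw.2.2.2
    conv_rhs => rw [← h2]
    rw [b.coord_apply_combination_of_mem (Finset.mem_univ _) h1]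
  · refine ⟨0, fun x hx => ?_⟩
    exact (hT.barycentricIn_hat hK subset_rfl hx).2.1 v hv

/-- An affine function with values in `[0, 1]` on a ball of radius `ρ` has the slope at most `1 / ρ`. -/
lemma abs_affine_sub_le {l : Space d →ᵃ[ℝ] ℝ} {c : Space d} {ρ : ℝ} (hρ : 0 < ρ)
    (hl : ∀ x ∈ Metric.closedBall c ρ, 0 ≤ l x ∧ l x ≤ 1) (x y : Space d) :
    |l x - l y| ≤ ρ⁻¹ * ‖x - y‖ := by
  have hlin : l x - l y = l.linear (x - y) := by
    have := l.linearMap_vsub x y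
    simpa using this.symm
  rcases eq_or_ne (x - y) 0 with h | h
  · rw [hlin, h]; simp
  have hn : 0 < ‖x - y‖ := norm_pos_iff.2 h
  have h1 := hl (c + (ρ / ‖x - y‖) • (x - y)) (by
    rw [mem_closedBall_iff_norm, add_sub_cancel_left, norm_smul, norm_div, norm_norm,
      Real.norm_of_nonneg hρ.le, div_mul_cancel₀ _ hn.ne'])
  have h2 := hl c (Metric.mem_closedBall_self hρ.le)
  have h3 : l (c + (ρ / ‖x - y‖) • (x - y)) = ρ / ‖x - y‖ * l.linear (x - y) + l c := by
    have := l.map_vadd c ((ρ / ‖x - y‖) • (x - y))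
    rw [vadd_eq_add, vadd_eq_add, add_comm] at this
    rw [this, map_smul, smul_eq_mul]
  rw [h3] at h1
  have h4 : |ρ / ‖x - y‖ * l.linear (x - y)| ≤ 1 := by rw [abs_le]; constructor <;> linarith
  rw [abs_mul, abs_of_pos (by positivity), div_mul_eq_mul_div, div_le_one hn] at h4
  rw [hlin, inv_mul_eq_div, le_div_iff₀ hρ, mul_comm]
  exact h4

lemma IsTriangulation.abs_hat_sub_le (hT : IsTriangulation 𝒯 d S) {K : Finset (Space d)}
    (hK : K ∈ 𝒯) {c : Space d} {ρ : ℝ} (hρ : 0 < ρ) (hc : Metric.closedBall c ρ ⊆ simplex K)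
    (v : Space d) {x y : Space d} (hx : x ∈ simplex K) (hy : y ∈ simplex K) :
    |hat 𝒯 v x - hat 𝒯 v y| ≤ ρ⁻¹ * ‖x - y‖ := by
  obtain ⟨l, hl⟩ := hT.exists_affine_eq_hat hK v
  rw [hl x hx, hl y hy]
  refine abs_affine_sub_le (c := c) hρ (fun z hz => ?_) x y
  rw [← hl z (hc hz)]
  have := hT.barycentricIn_hat hK subset_rfl (hc hz)
  exact ⟨this.nonneg v, this.le_one v⟩

lemma isCompact_simplex (K : Finset (Space d)) : IsCompact (simplex K) :=
  K.finite_toSet.isCompact_convexHull (𝕜 := ℝ)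

lemma IsTriangulation.isCompact (hT : IsTriangulation 𝒯 r S) : IsCompact S := by
  rw [← hT.cover]
  exact 𝒯.isCompact_biUnion fun K _ => isCompact_simplex K

lemma continuousOn_biUnion_simplex {Y : Type*} [TopologicalSpace Y] {f : Space d → Y}
    (𝒮 : Finset (Finset (Space d))) (h : ∀ K ∈ 𝒮, ContinuousOn f (simplex K)) :
    ContinuousOn f (⋃ K ∈ 𝒮, simplex K) := by
  induction 𝒮 using Finset.induction_on with
  | empty => simp
  | insert K 𝒮 _ ih =>
    rw [Finset.set_biUnion_insert]
    refine ContinuousOn.union_of_isClosed (h K (Finset.mem_insert_self _ _))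
      (ih fun L hL => h L (Finset.mem_insert_of_mem hL)) (isCompact_simplex K).isClosed ?_
    exact (𝒮.isCompact_biUnion fun K _ => isCompact_simplex K).isClosed

lemma IsTriangulation.continuousOn_hat (hT : IsTriangulation 𝒯 d S) (v : Space d) :
    ContinuousOn (hat 𝒯 v) S := by
  rw [← hT.cover]
  refine continuousOn_biUnion_simplex 𝒯 fun K hK => ?_
  obtain ⟨l, hl⟩ := hT.exists_affine_eq_hat hK v
  exact (l.continuous_of_finiteDimensional.continuousOn).congr hl

lemma IsTriangulation.continuousOn_lagrange (hT : IsTriangulation 𝒯 d S) (k : ℕ)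
    (n : Space d →₀ ℕ) : ContinuousOn (lagrange 𝒯 k n) S := by
  unfold lagrange
  refine continuousOn_finsetProd _ fun v _ => continuousOn_finsetProd _ fun m _ => ?_
  exact ((continuousOn_const.mul (hT.continuousOn_hat v)).sub continuousOn_const).div_const _

lemma lagrange_eq_zero {k : ℕ} {n : Space d →₀ ℕ} {x v : Space d} (hv : v ∈ n.support)
    (h : hat 𝒯 v x = 0) : lagrange 𝒯 k n x = 0 := by
  refine Finset.prod_eq_zero hv (Finset.prod_eq_zero (i := 0) ?_ ?_)
  · exact Finset.mem_range.2 (Nat.pos_of_ne_zero (Finsupp.mem_support_iff.1 hv))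
  · simp [h]

lemma IsTriangulation.lagrange_eq_zero_of_not_subset (hT : IsTriangulation 𝒯 r S)
    {K G : Finset (Space d)} (hK : K ∈ 𝒯) (hG : G ⊆ K) {k : ℕ} {n : Space d →₀ ℕ} {x : Space d}
    (hx : x ∈ simplex G) (hn : ¬ n.support ⊆ G) : lagrange 𝒯 k n x = 0 := by
  obtain ⟨v, hv, hvG⟩ := Finset.not_subset.1 hn
  exact lagrange_eq_zero hv ((hT.barycentricIn_hat hK hG hx).2.1 v hvG)

lemma abs_prod_sub_prod_le {ι : Type*} (s : Finset ι) {f g : ι → ℝ} {M : ℝ} (hM : 1 ≤ M)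
    (hf : ∀ i ∈ s, |f i| ≤ M) (hg : ∀ i ∈ s, |g i| ≤ M) :
    |∏ i ∈ s, f i - ∏ i ∈ s, g i| ≤ M ^ s.card * ∑ i ∈ s, |f i - g i| := by
  induction s using Finset.induction_on with
  | empty => simp
  | insert a s ha ih =>
    rw [Finset.prod_insert ha, Finset.prod_insert ha, Finset.sum_insert ha,
      Finset.card_insert_of_notMem ha]
    have ih' := ih (fun i hi => hf i (Finset.mem_insert_of_mem hi))
      (fun i hi => hg i (Finset.mem_insert_of_mem hi))
    have hP : |∏ i ∈ s, f i| ≤ M ^ s.card := by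
      rw [Finset.abs_prod]
      rw [← Finset.prod_const]
      exact Finset.prod_le_prod (fun _ _ => abs_nonneg _)
        fun i hi => hf i (Finset.mem_insert_of_mem hi)
    have e : f a * ∏ i ∈ s, f i - g a * ∏ i ∈ s, g i
        = (f a - g a) * ∏ i ∈ s, f i + g a * (∏ i ∈ s, f i - ∏ i ∈ s, g i) := by ring
    rw [e]
    have h0 : 0 ≤ ∑ i ∈ s, |f i - g i| := Finset.sum_nonneg fun i _ => abs_nonneg _
    calc _ ≤ |(f a - g a) * ∏ i ∈ s, f i| + |g a * (∏ i ∈ s, f i - ∏ i ∈ s, g i)| := abs_add_le _ _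
      _ ≤ |f a - g a| * M ^ s.card + M * (M ^ s.card * ∑ i ∈ s, |f i - g i|) := by
          rw [abs_mul, abs_mul]
          gcongr
          exact hg a (Finset.mem_insert_self _ _)
      _ ≤ |f a - g a| * M ^ (s.card + 1) + M * (M ^ s.card * ∑ i ∈ s, |f i - g i|) := by
          gcongr
          omega
      _ = _ := by ring

/-- The linear factors of a Lagrange function are bounded by the degree. -/
lemma abs_lagrange_factor_le {k a m : ℕ} (hm : m < a) (ha : a ≤ k) {t : ℝ} (h0 : 0 ≤ t)
    (h1 : t ≤ 1) : |((k : ℝ) * t - m) / ((a : ℝ) - m)| ≤ k := by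
  have h2 : (1 : ℝ) ≤ (a : ℝ) - m := by
    have : (m : ℝ) + 1 ≤ a := by exact_mod_cast hm
    linarith
  have h3 : (m : ℝ) ≤ k := by exact_mod_cast (hm.le.trans ha)
  have h4 : (0 : ℝ) ≤ k := Nat.cast_nonneg k
  have h5 : (0 : ℝ) ≤ m := Nat.cast_nonneg m
  have h6 : (k : ℝ) * t ≤ k := mul_le_of_le_one_right h4 h1
  have h7 : 0 ≤ (k : ℝ) * t := mul_nonneg h4 h0
  rw [abs_div, abs_of_pos (by linarith : (0 : ℝ) < (a : ℝ) - m), div_le_iff₀ (by linarith)]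
  have h8 : |(k : ℝ) * t - m| ≤ k := by rw [abs_le]; constructor <;> linarith
  exact h8.trans (le_mul_of_one_le_right h4 h2)

lemma lagrange_eq_prod_sigma (k : ℕ) (n : Space d →₀ ℕ) (x : Space d) :
    lagrange 𝒯 k n x = ∏ q ∈ n.support.sigma fun v => Finset.range (n v),
      ((k : ℝ) * hat 𝒯 q.1 x - (q.2 : ℝ)) / ((n q.1 : ℝ) - (q.2 : ℝ)) := by
  rw [Finset.prod_sigma]; rfl

lemma mem_nodes_iff {k : ℕ} {n : Space d →₀ ℕ} :
    n ∈ nodes 𝒯 k ↔ ∃ K ∈ 𝒯, ∑ v ∈ K, n v = k ∧ n.support ⊆ K := by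
  simp [nodes]

lemma sum_support_of_mem_nodes {k : ℕ} {n : Space d →₀ ℕ} (hn : n ∈ nodes 𝒯 k) :
    ∑ v ∈ n.support, n v = k := by
  obtain ⟨K, -, h1, h2⟩ := mem_nodes_iff.1 hn
  rw [← h1]
  exact Finset.sum_subset h2 fun v _ hv => Finsupp.notMem_support_iff.1 hv

lemma le_of_mem_nodes {k : ℕ} {n : Space d →₀ ℕ} (hn : n ∈ nodes 𝒯 k) (v : Space d) :
    n v ≤ k := by
  by_cases hv : v ∈ n.support
  · rw [← sum_support_of_mem_nodes hn]
    exact Finset.single_le_sum (f := fun v => n v) (fun _ _ => Nat.zero_le _) hv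
  · rw [Finsupp.notMem_support_iff.1 hv]; exact Nat.zero_le _

lemma IsTriangulation.abs_lagrange_le (hT : IsTriangulation 𝒯 r S) {K : Finset (Space d)}
    (hK : K ∈ 𝒯) {k : ℕ} {n : Space d →₀ ℕ} (hn : n ∈ nodes 𝒯 k) {x : Space d}
    (hx : x ∈ simplex K) : |lagrange 𝒯 k n x| ≤ (k : ℝ) ^ k := by
  have hw := hT.barycentricIn_hat hK subset_rfl hx
  rw [lagrange_eq_prod_sigma, Finset.abs_prod]
  refine (Finset.prod_le_prod (g := fun _ => (k : ℝ)) (fun _ _ => abs_nonneg _)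
    fun q hq => ?_).trans (le_of_eq ?_)
  · rw [Finset.mem_sigma, Finset.mem_range] at hq
    exact abs_lagrange_factor_le hq.2 (le_of_mem_nodes hn _) (hw.nonneg _) (hw.le_one _)
  · rw [Finset.prod_const, Finset.card_sigma]
    simp only [Finset.card_range]
    rw [sum_support_of_mem_nodes hn]

/-- On an element which contains a ball of radius `ρ` the Lagrange functions have Lipschitz constants
proportional to `1 / ρ`. -/
lemma IsTriangulation.abs_lagrange_sub_le (hT : IsTriangulation 𝒯 d S) {K : Finset (Space d)}
    (hK : K ∈ 𝒯) {k : ℕ} (hk : 1 ≤ k) {n : Space d →₀ ℕ} (hn : n ∈ nodes 𝒯 k)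
    {c : Space d} {ρ : ℝ} (hρ : 0 < ρ) (hc : Metric.closedBall c ρ ⊆ simplex K)
    {x y : Space d} (hx : x ∈ simplex K) (hy : y ∈ simplex K) :
    |lagrange 𝒯 k n x - lagrange 𝒯 k n y| ≤ (k : ℝ) ^ (k + 2) * ρ⁻¹ * ‖x - y‖ := by
  have hwx := hT.barycentricIn_hat hK subset_rfl hx
  have hwy := hT.barycentricIn_hat hK subset_rfl hy
  rw [lagrange_eq_prod_sigma, lagrange_eq_prod_sigma]
  have hcard : (n.support.sigma fun v => Finset.range (n v)).card = k := by
    rw [Finset.card_sigma]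
    simp only [Finset.card_range]
    rw [sum_support_of_mem_nodes hn]
  have hk1 : (1 : ℝ) ≤ k := by exact_mod_cast hk
  refine (abs_prod_sub_prod_le _ hk1 (fun q hq => ?_) (fun q hq => ?_)).trans ?_
  · rw [Finset.mem_sigma, Finset.mem_range] at hq
    exact abs_lagrange_factor_le hq.2 (le_of_mem_nodes hn _) (hwx.nonneg _) (hwx.le_one _)
  · rw [Finset.mem_sigma, Finset.mem_range] at hq
    exact abs_lagrange_factor_le hq.2 (le_of_mem_nodes hn _) (hwy.nonneg _) (hwy.le_one _)
  have hsum : ∑ q ∈ n.support.sigma fun v => Finset.range (n v),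
      |((k : ℝ) * hat 𝒯 q.1 x - (q.2 : ℝ)) / ((n q.1 : ℝ) - (q.2 : ℝ))
        - ((k : ℝ) * hat 𝒯 q.1 y - (q.2 : ℝ)) / ((n q.1 : ℝ) - (q.2 : ℝ))|
      ≤ (k : ℝ) * (k * (ρ⁻¹ * ‖x - y‖)) := by
    refine (Finset.sum_le_card_nsmul _ _ (k * (ρ⁻¹ * ‖x - y‖)) fun q hq => ?_).trans (le_of_eq ?_)
    · rw [Finset.mem_sigma, Finset.mem_range] at hq
      have h2 : (1 : ℝ) ≤ (n q.1 : ℝ) - q.2 := by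
        have : (q.2 : ℝ) + 1 ≤ n q.1 := by exact_mod_cast hq.2
        linarith
      have h3 := hT.abs_hat_sub_le hK hρ hc q.1 hx hy
      rw [← sub_div, abs_div, abs_of_pos (by linarith : (0 : ℝ) < (n q.1 : ℝ) - q.2),
        div_le_iff₀ (by linarith)]
      have e : (k : ℝ) * hat 𝒯 q.1 x - q.2 - ((k : ℝ) * hat 𝒯 q.1 y - q.2)
          = k * (hat 𝒯 q.1 x - hat 𝒯 q.1 y) := by ring
      rw [e, abs_mul, abs_of_nonneg (by linarith : (0 : ℝ) ≤ k)]
      refine (mul_le_mul_of_nonneg_left h3 (by linarith)).trans ?_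
      exact le_mul_of_one_le_right (by positivity) h2
    · rw [hcard, nsmul_eq_mul]
  rw [hcard]
  calc _ ≤ (k : ℝ) ^ k * ((k : ℝ) * (k * (ρ⁻¹ * ‖x - y‖))) := by gcongr
    _ = _ := by ring

/-! ### Nodes on the boundary -/

lemma barycentricIn_nodePoint {k : ℕ} (hk : 1 ≤ k) {n : Space d →₀ ℕ} (hn : n ∈ nodes 𝒯 k) :
    BarycentricIn n.support (nodePoint k n) (fun v => (n v : ℝ) / k) := by
  have hk0 : (k : ℝ) ≠ 0 := by positivity
  refine ⟨fun v _ => by positivity, fun v hv => by simp [Finsupp.notMem_support_iff.1 hv], ?_, rfl⟩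
  rw [← Finset.sum_div, ← Nat.cast_sum, sum_support_of_mem_nodes hn, div_self hk0]

variable {Ω : Set (Space d)} {𝒯Γ : Finset (Finset (Space d))}

/-- The boundary is covered by the boundary facets. -/
lemma IsBoundaryRefinement.exists_facet (hB : IsBoundaryRefinement Ω 𝒯 𝒯Γ) {x : Space d}
    (hx : x ∈ frontier Ω) : ∃ G, IsBoundaryFacet Ω 𝒯 G ∧ x ∈ simplex G := by
  rw [← hB.triangulation.cover] at hx
  obtain ⟨F, hF, hxF⟩ := mem_iUnion₂.1 hx
  obtain ⟨G, hG, hFG⟩ := hB.refines F hF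
  exact ⟨G, hG, hFG hxF⟩

/-- The basis functions of the interior nodes vanish on the boundary: if such a function does not
vanish at a point of a boundary facet, then all vertices of its node belong to this facet, and so does
the node. -/
lemma IsBoundaryRefinement.lagrange_eq_zero (hB : IsBoundaryRefinement Ω 𝒯 𝒯Γ)
    (hT : IsTriangulation 𝒯 r S) {k : ℕ} (hk : 1 ≤ k) {n : Space d →₀ ℕ}
    (hn : n ∈ interiorNodes Ω 𝒯 k) {x : Space d} (hx : x ∈ frontier Ω) :
    lagrange 𝒯 k n x = 0 := by
  obtain ⟨G, ⟨-, hGΓ, K, hK, hGK⟩, hxG⟩ := hB.exists_facet hx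
  rw [interiorNodes, Finset.mem_filter] at hn
  by_contra h
  have hsub : n.support ⊆ G := by
    by_contra h'
    exact h (hT.lagrange_eq_zero_of_not_subset hK hGK hxG h')
  exact hn.2 (hGΓ (mem_simplex_iff.2 ⟨_, (barycentricIn_nodePoint hk hn.1).mono hsub⟩))

/-- The vertices of a boundary node belong to a common boundary facet: the hat functions of all of them
are positive at the node. -/
lemma IsBoundaryRefinement.exists_facet_of_mem_boundaryNodes (hB : IsBoundaryRefinement Ω 𝒯 𝒯Γ)
    (hT : IsTriangulation 𝒯 r S) {k : ℕ} (hk : 1 ≤ k) {n : Space d →₀ ℕ}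
    (hn : n ∈ boundaryNodes Ω 𝒯 k) : ∃ G, IsBoundaryFacet Ω 𝒯 G ∧ n.support ⊆ G := by
  rw [boundaryNodes, Finset.mem_filter] at hn
  obtain ⟨G, hG, hxG⟩ := hB.exists_facet hn.2
  refine ⟨G, hG, fun v hv => ?_⟩
  obtain ⟨-, -, K, hK, hGK⟩ := hG
  obtain ⟨L, hL, -, hnL⟩ := mem_nodes_iff.1 hn.1
  have h1 := hT.hat_eq hL ((barycentricIn_nodePoint hk hn.1).mono hnL) v
  by_contra h
  have h2 := (hT.barycentricIn_hat hK hGK hxG).2.1 v h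
  simp only at h2
  rw [h1] at h2
  have hk0 : (k : ℝ) ≠ 0 := by positivity
  have : (n v : ℝ) = 0 := by simpa [hk0] using h2
  exact (Finsupp.mem_support_iff.1 hv) (by exact_mod_cast this)

end Triangulation


/-! ### Gram matrices -/

section Gram

variable {X E ι : Type} [MeasurableSpace X] {μ : Measure X} [NormedAddCommGroup E]
  [InnerProductSpace ℝ E] {a : X → ℝ} {f : ι → X → E}

lemma integrable_gram [IsFiniteMeasure μ] {a₁ L : ℝ} (ha : AEMeasurable a μ)
    (ha1 : ∀ᵐ x ∂μ, |a x| ≤ a₁) (hf : ∀ i, AEStronglyMeasurable (f i) μ)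
    (hL : ∀ i, ∀ᵐ x ∂μ, ‖f i x‖ ≤ L) (i j : ι) :
    Integrable (fun x => a x * inner ℝ (f i x) (f j x)) μ := by
  refine Integrable.of_bound (C := a₁ * (L * L))
    (ha.aestronglyMeasurable.mul ((hf i).inner (hf j))) ?_
  filter_upwards [ha1, hL i, hL j] with x h1 h2 h3
  rw [norm_mul, Real.norm_eq_abs]
  have h4 : 0 ≤ L := (norm_nonneg _).trans h2
  exact mul_le_mul h1 ((norm_inner_le_norm _ _).trans (mul_le_mul h2 h3 (norm_nonneg _) h4))
    (norm_nonneg _) ((abs_nonneg _).trans h1)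

variable [Fintype ι]

lemma mul_norm_sum_sq (c : ℝ) (w : ι → ℝ) (g : ι → E) :
    c * ‖∑ i, w i • g i‖ ^ 2 = ∑ i, ∑ j, w i * w j * (c * inner ℝ (g i) (g j)) := by
  rw [← real_inner_self_eq_norm_sq, sum_inner, Finset.mul_sum]
  refine Finset.sum_congr rfl fun i _ => ?_
  rw [inner_sum, Finset.mul_sum]
  refine Finset.sum_congr rfl fun j _ => ?_
  rw [real_inner_smul_left, real_inner_smul_right]
  ring

lemma normSq_gram
    (hint : ∀ i j, Integrable (fun x => a x * inner ℝ (f i x) (f j x)) μ) (w : ι → ℝ) :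
    normSq (Matrix.of fun i j => ∫ x, a x * inner ℝ (f i x) (f j x) ∂μ) w
      = ∫ x, a x * ‖∑ i, w i • f i x‖ ^ 2 ∂μ := by
  simp_rw [mul_norm_sum_sq]
  rw [integral_finsetSum _ fun i _ => integrable_finsetSum _ fun j _ => (hint i j).const_mul _]
  simp only [normSq, dotProduct, Matrix.mulVec, Matrix.of_apply]
  refine Finset.sum_congr rfl fun i _ => ?_
  rw [integral_finsetSum _ fun j _ => (hint i j).const_mul _, Finset.mul_sum]
  refine Finset.sum_congr rfl fun j _ => ?_
  rw [integral_const_mul]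
  ring

lemma posSemidef_of_normSq_nonneg {A : Matrix ι ι ℝ} (h : Aᵀ = A) (h0 : ∀ w, 0 ≤ normSq A w) :
    A.PosSemidef := by
  refine Matrix.PosSemidef.of_dotProduct_mulVec_nonneg ?_ fun x => ?_
  · rw [Matrix.IsHermitian, Matrix.conjTranspose_eq_transpose_of_trivial, h]
  · simpa [normSq] using h0 x

lemma posSemidef_gram (ha : ∀ᵐ x ∂μ, 0 ≤ a x)
    (hint : ∀ i j, Integrable (fun x => a x * inner ℝ (f i x) (f j x)) μ) :
    (Matrix.of fun i j => ∫ x, a x * inner ℝ (f i x) (f j x) ∂μ).PosSemidef := by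
  refine posSemidef_of_normSq_nonneg ?_ fun w => ?_
  · ext i j
    simp only [Matrix.transpose_apply, Matrix.of_apply]
    simp_rw [real_inner_comm]
  · rw [normSq_gram hint]
    refine integral_nonneg_of_ae ?_
    filter_upwards [ha] with x hx
    exact mul_nonneg hx (sq_nonneg _)

/-- A sum with at most `m` terms different from zero. -/
lemma norm_sum_sq_le_of_card_le (w : ι → ℝ) (g : ι → E) {m : ℕ} {s : Finset ι}
    (hs : s.card ≤ m) (hg : ∀ i ∉ s, g i = 0) :
    ‖∑ i, w i • g i‖ ^ 2 ≤ m * ∑ i, (w i) ^ 2 * ‖g i‖ ^ 2 := by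
  have e : ∑ i, w i • g i = ∑ i ∈ s, w i • g i :=
    (Finset.sum_subset (Finset.subset_univ s) fun i _ hi => by rw [hg i hi, smul_zero]).symm
  rw [e]
  calc ‖∑ i ∈ s, w i • g i‖ ^ 2 ≤ (∑ i ∈ s, ‖w i • g i‖) ^ 2 := by
        gcongr; exact norm_sum_le _ _
    _ ≤ s.card * ∑ i ∈ s, ‖w i • g i‖ ^ 2 := sq_sum_le_card_mul_sum_sq
    _ ≤ m * ∑ i, (w i) ^ 2 * ‖g i‖ ^ 2 := by
        gcongr
        calc ∑ i ∈ s, ‖w i • g i‖ ^ 2 ≤ ∑ i, ‖w i • g i‖ ^ 2 :=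
              Finset.sum_le_sum_of_subset_of_nonneg (Finset.subset_univ s)
                fun _ _ _ => sq_nonneg _
          _ = _ := Finset.sum_congr rfl fun i _ => by
              rw [norm_smul, mul_pow, Real.norm_eq_abs, sq_abs]

/-- The Gram matrix of bounded functions with small supports, of which only few overlap, is bounded
by a multiple of the identity. -/
lemma normSq_gram_le [IsFiniteMeasure μ] {a₁ L V : ℝ} {m : ℕ} {U : ι → Set X}
    (ha : AEMeasurable a μ) (ha0 : ∀ᵐ x ∂μ, 0 ≤ a x) (ha1 : ∀ᵐ x ∂μ, a x ≤ a₁)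
    (ha₁ : 0 ≤ a₁)
    (hf : ∀ i, AEStronglyMeasurable (f i) μ) (hL : ∀ i, ∀ᵐ x ∂μ, ‖f i x‖ ≤ L)
    (hU : ∀ i, MeasurableSet (U i)) (hV : ∀ i, μ.real (U i) ≤ V)
    (hfU : ∀ i, ∀ᵐ x ∂μ, f i x ≠ 0 → x ∈ U i)
    (hm : ∀ᵐ x ∂μ, ∃ s : Finset ι, s.card ≤ m ∧ ∀ i ∉ s, f i x = 0) (w : ι → ℝ) :
    normSq (Matrix.of fun i j => ∫ x, a x * inner ℝ (f i x) (f j x) ∂μ) w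
      ≤ a₁ * m * L ^ 2 * V * ∑ i, (w i) ^ 2 := by
  have hint := integrable_gram ha (a₁ := a₁) (by
    filter_upwards [ha0, ha1] with x h0 h1
    rwa [abs_of_nonneg h0]) hf hL
  rw [normSq_gram hint]
  have hbound : ∀ᵐ x ∂μ, a x * ‖∑ i, w i • f i x‖ ^ 2
      ≤ ∑ i, (U i).indicator (fun _ => a₁ * m * L ^ 2 * (w i) ^ 2) x := by
    filter_upwards [ha0, ha1, hm, ae_all_iff.2 hL, ae_all_iff.2 hfU] with x h0 h1 h2 h3 h4
    obtain ⟨s, hs, hs0⟩ := h2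
    have h5 := norm_sum_sq_le_of_card_le w (fun i => f i x) hs hs0
    calc _ ≤ a₁ * (m * ∑ i, (w i) ^ 2 * ‖f i x‖ ^ 2) :=
          mul_le_mul h1 h5 (sq_nonneg _) ha₁
      _ = ∑ i, a₁ * m * (w i) ^ 2 * ‖f i x‖ ^ 2 := by
          rw [Finset.mul_sum, Finset.mul_sum]
          exact Finset.sum_congr rfl fun i _ => by ring
      _ ≤ _ := by
          refine Finset.sum_le_sum fun i _ => ?_
          by_cases hx : f i x = 0
          · rw [hx, norm_zero]
            simp only [ne_eq, OfNat.ofNat_ne_zero, not_false_eq_true, zero_pow, mul_zero]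
            exact indicator_nonneg (fun _ _ => by positivity) _
          · rw [indicator_of_mem (h4 i hx)]
            have : ‖f i x‖ ^ 2 ≤ L ^ 2 := by
              have := h3 i
              gcongr
            calc _ ≤ a₁ * m * (w i) ^ 2 * L ^ 2 := by gcongr
              _ = _ := by ring
  have hintU : ∀ i, Integrable ((U i).indicator (fun _ => a₁ * m * L ^ 2 * (w i) ^ 2)) μ :=
    fun i => (integrable_const _).indicator (hU i)
  calc _ ≤ ∫ x, ∑ i, (U i).indicator (fun _ => a₁ * m * L ^ 2 * (w i) ^ 2) x ∂μ := by
        refine integral_mono_ae ?_ (integrable_finsetSum _ fun i _ => hintU i) hbound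
        simp_rw [mul_norm_sum_sq]
        exact integrable_finsetSum _ fun i _ => integrable_finsetSum _ fun j _ =>
          (hint i j).const_mul _
    _ = ∑ i, μ.real (U i) * (a₁ * m * L ^ 2 * (w i) ^ 2) := by
        rw [integral_finsetSum _ fun i _ => hintU i]
        refine Finset.sum_congr rfl fun i _ => ?_
        rw [integral_indicator (hU i), setIntegral_const, smul_eq_mul]
    _ ≤ ∑ i, V * (a₁ * m * L ^ 2 * (w i) ^ 2) := by
        refine Finset.sum_le_sum fun i _ => ?_
        have := hV i
        gcongr
    _ = _ := by
        rw [← Finset.mul_sum, ← Finset.mul_sum]; ring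

end Gram


/-! ### Upper bounds for the bulk matrices -/

section Bulk

open scoped Classical

variable {d : ℕ} {𝒯 : Finset (Finset (Space d))} {Ω : Set (Space d)} {k : ℕ} {σ : ℝ}

/-- The multi-index of a degree of freedom. -/
def dofNode (i : BulkDof Ω 𝒯 k) : Space d →₀ ℕ := Sum.elim (fun n => n.1) (fun n => n.1) i

lemma bulkBasis_eq (i : BulkDof Ω 𝒯 k) : bulkBasis Ω 𝒯 k i = lagrange 𝒯 k (dofNode i) := by
  cases i <;> rfl

lemma dofNode_mem (i : BulkDof Ω 𝒯 k) : dofNode i ∈ nodes 𝒯 k := by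
  rcases i with i | i
  · exact (Finset.mem_filter.1 i.2).1
  · exact (Finset.mem_filter.1 i.2).1

lemma dofNode_injective : Function.Injective (dofNode : BulkDof Ω 𝒯 k → Space d →₀ ℕ) := by
  rintro (i | i) (j | j) h
  · exact congrArg _ (Subtype.ext h)
  · have h1 := (Finset.mem_filter.1 i.2).2
    have h2 := (Finset.mem_filter.1 j.2).2
    have h' : i.1 = j.1 := h
    rw [h'] at h1
    exact absurd h2 h1
  · have h1 := (Finset.mem_filter.1 i.2).2
    have h2 := (Finset.mem_filter.1 j.2).2
    have h' : i.1 = j.1 := h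
    rw [h'] at h1
    exact absurd h1 h2
  · exact congrArg _ (Subtype.ext h)

/-- The number of nodes of an element depends only on the degree and the dimension. -/
lemma card_dofNode_le {G : Finset (Space d)} {r : ℕ} (hG : G.card = r) :
    (Finset.univ.filter fun i : BulkDof Ω 𝒯 k => (dofNode i).support ⊆ G).card
      ≤ r.multichoose k := by
  rw [← hG, ← Finset.card_finsuppAntidiag_nat_eq_multichoose]
  refine Finset.card_le_card_of_injOn dofNode (fun i hi => ?_) dofNode_injective.injOn
  have hi' : (dofNode i).support ⊆ G := by simpa using hi
  rw [Finset.mem_coe, Finset.mem_finsuppAntidiag]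
  refine ⟨?_, hi'⟩
  exact (Finset.sum_subset hi' fun v _ hv => Finsupp.notMem_support_iff.1 hv).symm.trans
    (sum_support_of_mem_nodes (dofNode_mem i))

lemma support_nonempty (hk : 1 ≤ k) {n : Space d →₀ ℕ} (hn : n ∈ nodes 𝒯 k) :
    n.support.Nonempty := by
  rw [Finset.nonempty_iff_ne_empty]
  intro h
  have := sum_support_of_mem_nodes hn
  rw [h, Finset.sum_empty] at this
  omega

/-- A vertex in the support of a node (zero, if the support is empty). All elements on which the basis
function does not vanish share this vertex. -/
noncomputable def nodeVertex (n : Space d →₀ ℕ) : Space d := if h : n.support.Nonempty then h.choose else 0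

lemma nodeVertex_mem {n : Space d →₀ ℕ} (h : n.support.Nonempty) : nodeVertex n ∈ n.support := by
  rw [nodeVertex, dif_pos h]; exact h.choose_spec

lemma diam_le_meshWidth {K : Finset (Space d)} (hK : K ∈ 𝒯) :
    Metric.diam (simplex K) ≤ meshWidth 𝒯 :=
  le_ciSup (f := fun K : 𝒯 => Metric.diam (simplex (K : Finset (Space d))))
    (Set.finite_range _).bddAbove ⟨K, hK⟩

lemma subset_simplex {K : Finset (Space d)} {v : Space d} (hv : v ∈ K) : v ∈ simplex K :=
  subset_convexHull ℝ _ (Finset.mem_coe.2 hv)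

lemma mem_closedBall_nodeVertex (hk : 1 ≤ k) {K : Finset (Space d)} (hK : K ∈ 𝒯)
    {n : Space d →₀ ℕ} (hn : n ∈ nodes 𝒯 k) (hnK : n.support ⊆ K) {x : Space d}
    (hx : x ∈ simplex K) : x ∈ Metric.closedBall (nodeVertex n) (meshWidth 𝒯) := by
  rw [Metric.mem_closedBall]
  refine le_trans ?_ (diam_le_meshWidth hK)
  exact Metric.dist_le_diam_of_mem (isCompact_simplex K).isBounded hx
    (subset_simplex (hnK (nodeVertex_mem (support_nonempty hk hn))))

/-- Almost every point of the domain lies in the interior of an element. -/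
lemma IsTriangulation.ae_mem_interior (hT : IsTriangulation 𝒯 d (closure Ω)) :
    ∀ᵐ x ∂(volume : Measure (Space d)).restrict Ω, x ∈ Ω → ∃ K ∈ 𝒯, x ∈ interior (simplex K) := by
  have h0 : ∀ᵐ x ∂(volume : Measure (Space d)), ∀ K ∈ 𝒯, x ∉ frontier (simplex K) := by
    rw [Filter.eventually_all_finset]
    intro K _
    exact measure_eq_zero_iff_ae_notMem.1 ((convex_convexHull ℝ _).addHaar_frontier _)
  filter_upwards [ae_restrict_of_ae h0] with x hx hxΩ
  have : x ∈ ⋃ K ∈ 𝒯, simplex K := by rw [hT.cover]; exact subset_closure hxΩ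
  obtain ⟨K, hK, hxK⟩ := mem_iUnion₂.1 this
  refine ⟨K, hK, ?_⟩
  by_contra h
  exact hx K hK ⟨subset_closure hxK, h⟩

lemma IsTriangulation.norm_gradient_le (hT : IsTriangulation 𝒯 d (closure Ω)) (hk : 1 ≤ k)
    {K : Finset (Space d)} (hK : K ∈ 𝒯) {n : Space d →₀ ℕ} (hn : n ∈ nodes 𝒯 k)
    {c : Space d} {ρ : ℝ} (hρ : 0 < ρ) (hc : Metric.closedBall c ρ ⊆ simplex K)
    {x : Space d} (hx : x ∈ interior (simplex K)) :
    ‖gradient (lagrange 𝒯 k n) x‖ ≤ (k : ℝ) ^ (k + 2) * ρ⁻¹ := by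
  rw [gradient, LinearIsometryEquiv.norm_map]
  refine norm_fderiv_le_of_lip' ℝ (by positivity) ?_
  filter_upwards [isOpen_interior.mem_nhds hx] with y hy
  exact hT.abs_lagrange_sub_le hK hk hn hρ hc (interior_subset hy) (interior_subset hx)

lemma IsTriangulation.gradient_eq_zero (hT : IsTriangulation 𝒯 d (closure Ω))
    {K : Finset (Space d)} (hK : K ∈ 𝒯) {n : Space d →₀ ℕ} (hn : ¬ n.support ⊆ K)
    {x : Space d} (hx : x ∈ interior (simplex K)) : gradient (lagrange 𝒯 k n) x = 0 := by
  have : lagrange 𝒯 k n =ᶠ[nhds x] fun _ => 0 := by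
    filter_upwards [isOpen_interior.mem_nhds hx] with y hy
    exact hT.lagrange_eq_zero_of_not_subset hK subset_rfl (interior_subset hy) hn
  rw [gradient, this.fderiv_eq]
  simp

lemma measurable_gradient (f : Space d → ℝ) : Measurable (gradient f) :=
  (InnerProductSpace.toDual ℝ (Space d)).symm.continuous.measurable.comp (measurable_fderiv ℝ f)

lemma isOpen_of_interior_closure (hΩ : interior (closure Ω) = Ω) : IsOpen Ω :=
  hΩ ▸ isOpen_interior

lemma IsTriangulation.isFiniteMeasure_restrict (hT : IsTriangulation 𝒯 d (closure Ω)) :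
    IsFiniteMeasure ((volume : Measure (Space d)).restrict Ω) :=
  ⟨by
    rw [Measure.restrict_apply_univ]
    exact (measure_mono subset_closure).trans_lt hT.isCompact.measure_lt_top⟩

lemma IsTriangulation.exists_mem (hT : IsTriangulation 𝒯 d (closure Ω)) {x : Space d}
    (hx : x ∈ closure Ω) : ∃ K ∈ 𝒯, x ∈ simplex K := by
  rw [← hT.cover] at hx
  exact mem_iUnion₂.1 hx |>.imp fun K h => ⟨h.1, h.2⟩

lemma IsTriangulation.aestronglyMeasurable_bulkBasis (hT : IsTriangulation 𝒯 d (closure Ω))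
    (hΩ : interior (closure Ω) = Ω) (i : BulkDof Ω 𝒯 k) :
    AEStronglyMeasurable (bulkBasis Ω 𝒯 k i) ((volume : Measure (Space d)).restrict Ω) := by
  rw [bulkBasis_eq]
  exact ((hT.continuousOn_lagrange k _).mono subset_closure).aestronglyMeasurable
    (isOpen_of_interior_closure hΩ).measurableSet

lemma IsTriangulation.norm_bulkBasis_le (hT : IsTriangulation 𝒯 d (closure Ω))
    (i : BulkDof Ω 𝒯 k) {x : Space d} (hx : x ∈ closure Ω) :
    ‖bulkBasis Ω 𝒯 k i x‖ ≤ (k : ℝ) ^ k := by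
  obtain ⟨K, hK, hxK⟩ := hT.exists_mem hx
  rw [bulkBasis_eq, Real.norm_eq_abs]
  exact hT.abs_lagrange_le hK (dofNode_mem i) hxK

lemma assemble_Mu_eq {N : ℕ} (α κ : Space d → ℝ) (𝒯Γ : Finset (Finset (Space d)))
    (ψ : Fin N → Space d → ℝ) :
    (assemble Ω α κ 𝒯 𝒯Γ k ψ).Mu = Matrix.of fun i j => ∫ x in Ω,
      (fun _ => (1 : ℝ)) x * inner ℝ (bulkBasis Ω 𝒯 k i x) (bulkBasis Ω 𝒯 k j x) := by
  ext i j
  simp [assemble, mul_comm]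

lemma measureReal_closedBall_le {μ : Measure (Space d)} (hμ : μ ≤ volume) (x : Space d) {h : ℝ}
    (hh : 0 ≤ h) : μ.real (Metric.closedBall x h)
      ≤ h ^ d * (volume : Measure (Space d)).real (Metric.ball 0 1) := by
  refine (ENNReal.toReal_mono measure_closedBall_lt_top.ne (hμ _)).trans (le_of_eq ?_)
  have := Measure.addHaar_real_closedBall (volume : Measure (Space d)) x hh
  simpa [Measure.real] using this

/-- The bulk mass of a coefficient vector is bounded by `h ^ d` times its Euclidean norm. -/
lemma IsTriangulation.normSq_mass_le {N : ℕ} (hT : IsTriangulation 𝒯 d (closure Ω))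
    (hΩ : interior (closure Ω) = Ω) (hk : 1 ≤ k) (hh : 0 ≤ meshWidth 𝒯) (α κ : Space d → ℝ)
    (𝒯Γ : Finset (Finset (Space d))) (ψ : Fin N → Space d → ℝ) (w : BulkDof Ω 𝒯 k → ℝ) :
    normSq (assemble Ω α κ 𝒯 𝒯Γ k ψ).Mu w
      ≤ 1 * ((d + 1).multichoose k : ℕ) * ((k : ℝ) ^ k) ^ 2
        * (meshWidth 𝒯 ^ d * (volume : Measure (Space d)).real (Metric.ball 0 1))
        * ∑ i, (w i) ^ 2 := by
  have := hT.isFiniteMeasure_restrict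
  have hΩo := (isOpen_of_interior_closure hΩ).measurableSet
  rw [assemble_Mu_eq]
  refine normSq_gram_le (U := fun i => Metric.closedBall (nodeVertex (dofNode i)) (meshWidth 𝒯))
    aemeasurable_const (by simp) (by simp) zero_le_one
    (fun i => hT.aestronglyMeasurable_bulkBasis hΩ i) (fun i => ?_) (fun i => measurableSet_closedBall)
    (fun i => measureReal_closedBall_le Measure.restrict_le_self _ hh) (fun i => ?_) ?_ w
  · exact (ae_restrict_iff' hΩo).2 (.of_forall fun x hx =>
      hT.norm_bulkBasis_le i (subset_closure hx))
  · refine (ae_restrict_iff' hΩo).2 (.of_forall fun x hx hne => ?_)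
    obtain ⟨K, hK, hxK⟩ := hT.exists_mem (subset_closure hx)
    refine mem_closedBall_nodeVertex hk hK (dofNode_mem i) ?_ hxK
    by_contra h
    rw [bulkBasis_eq] at hne
    exact hne (hT.lagrange_eq_zero_of_not_subset hK subset_rfl hxK h)
  · refine (ae_restrict_iff' hΩo).2 (.of_forall fun x hx => ?_)
    obtain ⟨K, hK, hxK⟩ := hT.exists_mem (subset_closure hx)
    refine ⟨_, card_dofNode_le (hT.card_eq K hK), fun i hi => ?_⟩
    rw [bulkBasis_eq]
    exact hT.lagrange_eq_zero_of_not_subset hK subset_rfl hxK (by simpa using hi)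

lemma IsTriangulation.posSemidef_mass {N : ℕ} (hT : IsTriangulation 𝒯 d (closure Ω))
    (hΩ : interior (closure Ω) = Ω) (α κ : Space d → ℝ)
    (𝒯Γ : Finset (Finset (Space d))) (ψ : Fin N → Space d → ℝ) :
    (assemble Ω α κ 𝒯 𝒯Γ k ψ).Mu.PosSemidef := by
  have := hT.isFiniteMeasure_restrict
  rw [assemble_Mu_eq]
  refine posSemidef_gram (by simp) fun i j => integrable_gram (a₁ := 1) aemeasurable_const (by simp)
    (fun i => hT.aestronglyMeasurable_bulkBasis hΩ i)
    (fun i => (ae_restrict_iff' (isOpen_of_interior_closure hΩ).measurableSet).2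
      (.of_forall fun x hx => hT.norm_bulkBasis_le i (subset_closure hx))) i j

/-- The gradients of the basis functions are bounded by the inverse of the mesh width. -/
lemma IsTriangulation.ae_norm_gradient_le (hT : IsTriangulation 𝒯 d (closure Ω))
    (hΩ : interior (closure Ω) = Ω) (hk : 1 ≤ k) (hh : 0 < meshWidth 𝒯) (hσ : QuasiUniform σ 𝒯)
    (i : BulkDof Ω 𝒯 k) : ∀ᵐ x ∂(volume : Measure (Space d)).restrict Ω,
      ‖gradient (bulkBasis Ω 𝒯 k i) x‖ ≤ (k : ℝ) ^ (k + 2) * (σ / meshWidth 𝒯) := by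
  have hΩo := (isOpen_of_interior_closure hΩ).measurableSet
  filter_upwards [hT.ae_mem_interior, ae_restrict_mem hΩo] with x hx hxΩ
  obtain ⟨K, hK, hxK⟩ := hx hxΩ
  obtain ⟨c, ρ, hρ, hle, hc⟩ := hσ K hK
  rw [bulkBasis_eq]
  refine (hT.norm_gradient_le hk hK (dofNode_mem i) hρ hc hxK).trans ?_
  gcongr
  rw [inv_eq_one_div, div_le_div_iff₀ hρ hh]
  linarith

/-- The bulk stiffness of a coefficient vector is bounded by `h ^ (d - 2)` times its Euclidean norm,
which is the inverse inequality. -/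
lemma IsTriangulation.normSq_stiffness_le {N : ℕ} (hT : IsTriangulation 𝒯 d (closure Ω))
    (hΩ : interior (closure Ω) = Ω) (hk : 1 ≤ k) (hh : 0 < meshWidth 𝒯) (hσ : QuasiUniform σ 𝒯)
    {α : Space d → ℝ} (hα : AEMeasurable α (volume.restrict Ω)) {a₁ : ℝ} (ha₁ : 0 ≤ a₁)
    (hα0 : ∀ᵐ x ∂(volume.restrict Ω), 0 ≤ α x) (hα1 : ∀ᵐ x ∂(volume.restrict Ω), α x ≤ a₁)
    (κ : Space d → ℝ)
    (𝒯Γ : Finset (Finset (Space d))) (ψ : Fin N → Space d → ℝ) (w : BulkDof Ω 𝒯 k → ℝ) :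
    normSq (assemble Ω α κ 𝒯 𝒯Γ k ψ).Ku w
      ≤ a₁ * ((d + 1).multichoose k : ℕ) * ((k : ℝ) ^ (k + 2) * (σ / meshWidth 𝒯)) ^ 2
        * (meshWidth 𝒯 ^ d * (volume : Measure (Space d)).real (Metric.ball 0 1))
        * ∑ i, (w i) ^ 2 := by
  have := hT.isFiniteMeasure_restrict
  have hΩo := (isOpen_of_interior_closure hΩ).measurableSet
  refine normSq_gram_le (U := fun i => Metric.closedBall (nodeVertex (dofNode i)) (meshWidth 𝒯))
    hα hα0 hα1 ha₁
    (fun i => (measurable_gradient _).aestronglyMeasurable)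
    (fun i => hT.ae_norm_gradient_le hΩ hk hh hσ i) (fun i => measurableSet_closedBall)
    (fun i => measureReal_closedBall_le Measure.restrict_le_self _ hh.le) (fun i => ?_) ?_ w
  · filter_upwards [hT.ae_mem_interior, ae_restrict_mem hΩo] with x hx hxΩ hne
    obtain ⟨K, hK, hxK⟩ := hx hxΩ
    refine mem_closedBall_nodeVertex hk hK (dofNode_mem i) ?_ (interior_subset hxK)
    by_contra h
    rw [bulkBasis_eq] at hne
    exact hne (hT.gradient_eq_zero hK h hxK)
  · filter_upwards [hT.ae_mem_interior, ae_restrict_mem hΩo] with x hx hxΩ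
    obtain ⟨K, hK, hxK⟩ := hx hxΩ
    refine ⟨_, card_dofNode_le (hT.card_eq K hK), fun i hi => ?_⟩
    rw [bulkBasis_eq]
    exact hT.gradient_eq_zero hK (by simpa using hi) hxK

lemma IsTriangulation.posSemidef_stiffness {N : ℕ} (hT : IsTriangulation 𝒯 d (closure Ω))
    (hΩ : interior (closure Ω) = Ω) (hk : 1 ≤ k) (hh : 0 < meshWidth 𝒯) (hσ : QuasiUniform σ 𝒯)
    {α : Space d → ℝ} (hα : AEMeasurable α (volume.restrict Ω)) {a₁ : ℝ}
    (hα0 : ∀ᵐ x ∂(volume.restrict Ω), 0 ≤ α x) (hα1 : ∀ᵐ x ∂(volume.restrict Ω), α x ≤ a₁)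
    (κ : Space d → ℝ)
    (𝒯Γ : Finset (Finset (Space d))) (ψ : Fin N → Space d → ℝ) :
    (assemble Ω α κ 𝒯 𝒯Γ k ψ).Ku.PosSemidef := by
  have := hT.isFiniteMeasure_restrict
  refine posSemidef_gram hα0 fun i j => integrable_gram (a₁ := a₁) hα ?_
    (fun i => (measurable_gradient _).aestronglyMeasurable)
    (fun i => hT.ae_norm_gradient_le hΩ hk hh hσ i) i j
  filter_upwards [hα0, hα1] with x h0 h1
  rwa [abs_of_nonneg h0]

end Bulk


/-! ### The reference simplex -/

section Reference

variable {r : ℕ}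

/-- The barycentric coordinates of the reference simplex in `ℝ^r`, whose vertices are the origin
and the unit vectors. -/
noncomputable def refCoord (r : ℕ) : Fin (r + 1) → Space r →ᵃ[ℝ] ℝ :=
  Fin.cons
    (AffineMap.const ℝ (Space r) (1 : ℝ)
      - (∑ i, (EuclideanSpace.proj i : Space r →L[ℝ] ℝ) : Space r →L[ℝ] ℝ).toLinearMap.toAffineMap)
    (fun i => (EuclideanSpace.proj i : Space r →L[ℝ] ℝ).toLinearMap.toAffineMap)

lemma refCoord_zero (y : Space r) : refCoord r 0 y = 1 - ∑ i, y i := by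
  simp [refCoord]

lemma refCoord_succ (i : Fin r) (y : Space r) : refCoord r i.succ y = y i := by
  simp [refCoord]

lemma continuous_refCoord (i : Fin (r + 1)) : Continuous (refCoord r i) :=
  (refCoord r i).continuous_of_finiteDimensional

lemma sum_refCoord (y : Space r) : ∑ i, refCoord r i y = 1 := by
  simp [Fin.sum_univ_succ, refCoord_zero, refCoord_succ]

/-- The point of `ℝ^r` with prescribed barycentric coordinates. -/
def refPoint (b : Fin (r + 1) → ℝ) : Space r := WithLp.toLp 2 fun i => b i.succ

lemma refCoord_refPoint {b : Fin (r + 1) → ℝ} (hb : ∑ i, b i = 1) (i : Fin (r + 1)) :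
    refCoord r i (refPoint b) = b i := by
  rw [Fin.sum_univ_succ] at hb
  cases i using Fin.cases with
  | zero => rw [refCoord_zero]; simp only [refPoint]; linarith
  | succ i => rw [refCoord_succ]; rfl

lemma refPoint_refCoord (y : Space r) : refPoint (fun i => refCoord r i y) = y := by
  ext i
  simp [refPoint, refCoord_succ]

/-- The closed reference simplex. -/
def refSimplex (r : ℕ) : Set (Space r) := {y | ∀ i, 0 ≤ refCoord r i y}

lemma refSimplex_eq_image : refSimplex r = refPoint '' stdSimplex ℝ (Fin (r + 1)) := by
  ext y
  constructor
  · intro hy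
    exact ⟨fun i => refCoord r i y, ⟨hy, sum_refCoord y⟩, refPoint_refCoord y⟩
  · rintro ⟨b, ⟨hb0, hb1⟩, rfl⟩ i
    rw [refCoord_refPoint hb1]
    exact hb0 i

lemma isCompact_refSimplex : IsCompact (refSimplex r) := by
  rw [refSimplex_eq_image]
  refine (isCompact_stdSimplex ℝ _).image ?_
  exact (PiLp.continuous_toLp 2 _).comp (continuous_pi fun i => continuous_apply _)

lemma measurableSet_refSimplex : MeasurableSet (refSimplex r) :=
  isCompact_refSimplex.isClosed.measurableSet

lemma convex_refSimplex : Convex ℝ (refSimplex r) := by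
  rw [refSimplex, ofPred_forall]
  exact convex_iInter fun i => (convex_Ici (0 : ℝ)).affine_preimage (refCoord r i)

lemma isOpen_setOf_refCoord_pos : IsOpen {y : Space r | ∀ i, 0 < refCoord r i y} := by
  rw [ofPred_forall]
  exact isOpen_iInter_of_finite fun i => isOpen_lt continuous_const (continuous_refCoord i)

lemma refSimplex_subset_closure_interior :
    refSimplex r ⊆ closure (interior (refSimplex r)) := by
  rw [convex_refSimplex.closure_interior_eq_closure_of_nonempty_interior]
  · exact subset_closure
  have h : ∑ _i : Fin (r + 1), ((r : ℝ) + 1)⁻¹ = 1 := by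
    simp only [Finset.sum_const, Finset.card_univ, Fintype.card_fin, nsmul_eq_mul]
    push_cast
    exact mul_inv_cancel₀ (by positivity)
  refine ⟨refPoint fun _ => ((r : ℝ) + 1)⁻¹, interior_maximal (t := {y | ∀ i, 0 < refCoord r i y})
    (fun y hy i => (hy i).le) isOpen_setOf_refCoord_pos fun i => ?_⟩
  rw [refCoord_refPoint h]
  positivity

lemma volume_setOf_refCoord_eq_zero (i : Fin (r + 1)) :
    (volume : Measure (Space r)) {y | refCoord r i y = 0} = 0 := by
  have e : {y | refCoord r i y = 0}
      = ((AffineSubspace.mk' (0 : ℝ) ⊥).comap (refCoord r i) : Set (Space r)) := by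
    ext y
    simp [AffineSubspace.mem_mk']
  rw [e]
  refine Measure.addHaar_affineSubspace _ _ fun h => ?_
  have h1 : refPoint (Pi.single i 1) ∈ (AffineSubspace.mk' (0 : ℝ) ⊥).comap (refCoord r i) := by
    rw [h]; trivial
  have h2 : ∑ j, (Pi.single i 1 : Fin (r + 1) → ℝ) j = 1 := by simp
  rw [AffineSubspace.mem_comap, refCoord_refPoint h2] at h1
  simp [AffineSubspace.mem_mk'] at h1

lemma ae_refCoord_ne_zero : ∀ᵐ y ∂(volume : Measure (Space r)), ∀ i, refCoord r i y ≠ 0 :=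
  ae_all_iff.2 fun i => by
    have := measure_eq_zero_iff_ae_notMem.1 (volume_setOf_refCoord_eq_zero i)
    exact this

lemma volume_refSimplex_lt_top : (volume : Measure (Space r)) (refSimplex r) < ⊤ :=
  isCompact_refSimplex.measure_lt_top

/-- The Lagrange function of degree `k` on the reference simplex of the node whose barycentric
coordinates are `a i / k`. -/
noncomputable def refLagrange (k : ℕ) (a : Fin (r + 1) → ℕ) (y : Space r) : ℝ :=
  ∏ i, ∏ m ∈ Finset.range (a i), ((k : ℝ) * refCoord r i y - (m : ℝ)) / ((a i : ℝ) - (m : ℝ))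

lemma continuous_refLagrange (k : ℕ) (a : Fin (r + 1) → ℕ) : Continuous (refLagrange k a) := by
  unfold refLagrange
  refine continuous_finsetProd _ fun i _ => continuous_finsetProd _ fun m _ => ?_
  exact ((continuous_const.mul (continuous_refCoord i)).sub continuous_const).div_const _

lemma refLagrange_self {k : ℕ} {a : Fin (r + 1) → ℕ} {y : Space r}
    (hy : ∀ i, (k : ℝ) * refCoord r i y = a i) : refLagrange k a y = 1 := by
  refine Finset.prod_eq_one fun i _ => Finset.prod_eq_one fun m hm => ?_
  rw [hy, div_self]
  have : (m : ℝ) < a i := by exact_mod_cast Finset.mem_range.1 hm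
  exact sub_ne_zero.2 this.ne'

lemma refLagrange_of_ne {k : ℕ} {a b : Fin (r + 1) → ℕ} (hab : a ≠ b) (hsum : ∑ i, a i = ∑ i, b i)
    {y : Space r} (hy : ∀ i, (k : ℝ) * refCoord r i y = b i) : refLagrange k a y = 0 := by
  obtain ⟨i, hi⟩ : ∃ i, b i < a i := by
    by_contra! h
    exact hab (funext fun i => (Finset.sum_eq_sum_iff_of_le fun i _ => h i).1 hsum i
      (Finset.mem_univ i))
  refine Finset.prod_eq_zero (Finset.mem_univ i)
    (Finset.prod_eq_zero (Finset.mem_range.2 hi) ?_)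
  rw [hy, sub_self, zero_div]

/-- The multi-indices of the Lagrange nodes of degree `k` of an `r`-simplex. -/
abbrev RefNode (r k : ℕ) : Type := Finset.piAntidiag (Finset.univ : Finset (Fin (r + 1))) k

lemma RefNode.sum_eq {k : ℕ} (a : RefNode r k) : ∑ i, a.1 i = k :=
  (Finset.mem_piAntidiag.1 a.2).1

/-- A nodal value is bounded by the `L²` norm on the reference simplex: the `L²` inner product is
positive definite on the polynomials of degree `k`. -/
lemma exists_refLagrange_bound (r : ℕ) {k : ℕ} (hk : 1 ≤ k) : ∃ c : ℝ, 0 ≤ c ∧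
    ∀ (W : RefNode r k → ℝ) (b : RefNode r k),
      (W b) ^ 2 ≤ c * ∫ y in refSimplex r, (∑ a, W a * refLagrange k a.1 y) ^ 2 := by
  classical
  set μ : Measure (Space r) := volume.restrict (refSimplex r) with hμ
  have : IsFiniteMeasure μ := ⟨by rw [hμ, Measure.restrict_apply_univ]; exact volume_refSimplex_lt_top⟩
  set f : RefNode r k → Space r → ℝ := fun a => refLagrange k a.1 with hf
  have hint : ∀ a b, Integrable (fun y => (fun _ => (1 : ℝ)) y * inner ℝ (f a y) (f b y)) μ := by
    intro a b
    have hc : Continuous fun y => (fun _ => (1 : ℝ)) y * inner ℝ (f a y) (f b y) :=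
      continuous_const.mul ((continuous_refLagrange k a.1).inner (continuous_refLagrange k b.1))
    exact hc.continuousOn.integrableOn_compact isCompact_refSimplex
  set M : Matrix (RefNode r k) (RefNode r k) ℝ :=
    Matrix.of fun a b => ∫ y, (fun _ => (1 : ℝ)) y * inner ℝ (f a y) (f b y) ∂μ with hM
  have hpsd : M.PosSemidef := posSemidef_gram (by simp) hint
  have hA := isPosSemidef_toBilin' hpsd
  have hval : ∀ W, Matrix.toBilin' M W W = ∫ y, (∑ a, W a * f a y) ^ 2 ∂μ := by
    intro W
    rw [← normSq_eq_toBilin', hM, normSq_gram hint]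
    simp
  have hker : ∀ b, ∀ W, Matrix.toBilin' M W W = 0 → LinearMap.proj (R := ℝ) b W = 0 := by
    intro b W h
    rw [hval] at h
    have hc : Continuous fun y => ∑ a, W a * f a y :=
      continuous_finsetSum _ fun a _ => continuous_const.mul (continuous_refLagrange k a.1)
    have h1 : (fun y => (∑ a, W a * f a y) ^ 2) =ᵐ[μ] 0 := by
      refine (integral_eq_zero_iff_of_nonneg (fun y => sq_nonneg (∑ a, W a * f a y)) ?_).1 h
      exact (hc.pow 2).continuousOn.integrableOn_compact isCompact_refSimplex
    have h2 : EqOn (fun y => (∑ a, W a * f a y) ^ 2) 0 (refSimplex r) :=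
      Measure.eqOn_of_ae_eq h1 (hc.pow 2).continuousOn continuousOn_const
        refSimplex_subset_closure_interior
    -- evaluation at the node of `b`
    have hk0 : (k : ℝ) ≠ 0 := by positivity
    have hb1 : ∑ i, (b.1 i : ℝ) / k = 1 := by
      rw [← Finset.sum_div, ← Nat.cast_sum, b.sum_eq, div_self hk0]
    have hy : ∀ i, (k : ℝ) * refCoord r i (refPoint fun i => (b.1 i : ℝ) / k) = b.1 i := by
      intro i
      rw [refCoord_refPoint hb1]
      field_simp
    have h3 := h2 (x := refPoint fun i => (b.1 i : ℝ) / k) (fun i => by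
      rw [refCoord_refPoint hb1]; positivity)
    have h4 : ∑ a, W a * f a (refPoint fun i => (b.1 i : ℝ) / k) = W b := by
      rw [Finset.sum_eq_single b]
      · simp only [hf]; rw [refLagrange_self hy, mul_one]
      · intro a _ hab
        simp only [hf]
        rw [refLagrange_of_ne (fun h => hab (Subtype.ext h)) (by rw [a.sum_eq, b.sum_eq]) hy,
          mul_zero]
      · simp
    simp only [h4, Pi.zero_apply] at h3
    simpa using h3
  -- the nodal values are represented by elements `z b`, and the Cauchy–Schwarz inequality applies
  choose z hz using fun b => exists_represents (A := Matrix.toBilin' M) (LinearMap.proj b) (hker b)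
  refine ⟨∑ b, Matrix.toBilin' M (z b) (z b), Finset.sum_nonneg fun b _ => hA.nonneg _,
    fun W b => ?_⟩
  have h1 := form_sq_le hA (z b) W
  rw [hz, LinearMap.proj_apply] at h1
  refine h1.trans ?_
  rw [← hval]
  refine mul_le_mul_of_nonneg_right ?_ (hA.nonneg W)
  exact Finset.single_le_sum (f := fun b => Matrix.toBilin' M (z b) (z b))
    (fun b _ => hA.nonneg _) (Finset.mem_univ b)

end Reference


/-! ### Affine parametrizations of simplices and the surface measure -/

section Param

open scoped Classical

variable {d r : ℕ} {v : Fin (r + 1) → Space d} {G : Finset (Space d)}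

/-- The affine map from `ℝ^r` that maps the vertices of the reference simplex to `v`. -/
noncomputable def param (v : Fin (r + 1) → Space d) (y : Space r) : Space d :=
  ∑ i, refCoord r i y • v i

/-- The linear part of `param v`. -/
noncomputable def paramLinear (v : Fin (r + 1) → Space d) : Space r →ₗ[ℝ] Space d :=
  ∑ i : Fin r, ((EuclideanSpace.proj i : Space r →L[ℝ] ℝ).toLinearMap).smulRight (v i.succ - v 0)

lemma paramLinear_apply (v : Fin (r + 1) → Space d) (y : Space r) :
    paramLinear v y = ∑ i : Fin r, y i • (v i.succ - v 0) := by
  simp [paramLinear]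

lemma param_eq (v : Fin (r + 1) → Space d) (y : Space r) : param v y = v 0 + paramLinear v y := by
  rw [param, Fin.sum_univ_succ, refCoord_zero, paramLinear_apply]
  simp only [refCoord_succ, smul_sub, Finset.sum_sub_distrib, ← Finset.sum_smul, sub_smul, one_smul]
  abel

lemma param_sub (v : Fin (r + 1) → Space d) (y z : Space r) :
    param v y - param v z = paramLinear v (y - z) := by
  rw [param_eq, param_eq, map_sub]; abel

lemma continuous_param (v : Fin (r + 1) → Space d) : Continuous (param v) :=
  continuous_finsetSum _ fun i _ => (continuous_refCoord i).smul continuous_const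

lemma sum_refCoord_sub (y z : Space r) : ∑ i, (refCoord r i y - refCoord r i z) = 0 := by
  rw [Finset.sum_sub_distrib, sum_refCoord, sum_refCoord, sub_self]

lemma injective_param (hv : AffineIndependent ℝ v) : Function.Injective (param v) := by
  intro y z h
  have := (affineIndependent_iff.1 hv) Finset.univ (fun i => refCoord r i y - refCoord r i z)
    (sum_refCoord_sub y z) (by
      simp only [sub_smul]
      rw [Finset.sum_sub_distrib, sub_eq_zero]
      exact h)
  rw [← refPoint_refCoord y, ← refPoint_refCoord z]
  congr 1
  funext i
  exact sub_eq_zero.1 (this i (Finset.mem_univ i))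

lemma injective_paramLinear (hv : AffineIndependent ℝ v) :
    Function.Injective (paramLinear v) := by
  intro y z h
  refine injective_param hv ?_
  rw [param_eq, param_eq, h]

/-- A family of numbers indexed by the vertices as a function on the space, extended by zero. -/
noncomputable def spread (v : Fin (r + 1) → Space d) (f : Fin (r + 1) → ℝ) (x : Space d) : ℝ :=
  ∑ i, if v i = x then f i else 0

lemma spread_apply (hv : Function.Injective v) (f : Fin (r + 1) → ℝ) (i : Fin (r + 1)) :
    spread v f (v i) = f i := by
  simp [spread, hv.eq_iff]

lemma spread_of_notMem (f : Fin (r + 1) → ℝ) {x : Space d} (hx : x ∉ range v) :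
    spread v f x = 0 := by
  refine Finset.sum_eq_zero fun i _ => if_neg fun h => hx ⟨i, h⟩

lemma sum_spread (hG : range v ⊆ G) (f : Fin (r + 1) → ℝ) :
    ∑ x ∈ G, spread v f x = ∑ i, f i := by
  simp only [spread]
  rw [Finset.sum_comm]
  refine Finset.sum_congr rfl fun i _ => ?_
  rw [Finset.sum_ite_eq, if_pos (Finset.mem_coe.1 (hG ⟨i, rfl⟩))]

lemma sum_spread_smul (hG : range v ⊆ G) (f : Fin (r + 1) → ℝ) :
    ∑ x ∈ G, spread v f x • x = ∑ i, f i • v i := by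
  simp only [spread, Finset.sum_smul, ite_smul, zero_smul]
  rw [Finset.sum_comm]
  refine Finset.sum_congr rfl fun i _ => ?_
  rw [Finset.sum_ite_eq, if_pos (Finset.mem_coe.1 (hG ⟨i, rfl⟩))]

lemma exists_enumeration (hcard : G.card = r + 1)
    (hG : AffineIndependent ℝ (fun v : G => (v : Space d))) :
    ∃ v : Fin (r + 1) → Space d, AffineIndependent ℝ v ∧ range v = G := by
  let e := (G.equivFinOfCardEq hcard).symm
  refine ⟨fun i => (e i : Space d), hG.comp_embedding e.toEmbedding, ?_⟩
  ext x
  constructor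
  · rintro ⟨i, rfl⟩
    exact (e i).2
  · intro hx
    exact ⟨e.symm ⟨x, hx⟩, by simp⟩

lemma barycentricIn_param (hv : AffineIndependent ℝ v) (hG : range v = G) {y : Space r}
    (hy : y ∈ refSimplex r) : BarycentricIn G (param v y) (spread v fun i => refCoord r i y) := by
  refine ⟨fun x hx => ?_, fun x hx => spread_of_notMem _ (by rwa [hG]), ?_, ?_⟩
  · rw [← Finset.mem_coe, ← hG] at hx
    obtain ⟨i, rfl⟩ := hx
    rw [spread_apply hv.injective]
    exact hy i
  · rw [sum_spread hG.le, sum_refCoord]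
  · rw [sum_spread_smul hG.le]; rfl

lemma image_param (hv : AffineIndependent ℝ v) (hG : range v = G) :
    param v '' refSimplex r = simplex G := by
  ext x
  constructor
  · rintro ⟨y, hy, rfl⟩
    exact mem_simplex_iff.2 ⟨_, barycentricIn_param hv hG hy⟩
  · intro hx
    obtain ⟨w, hw⟩ := mem_simplex_iff.1 hx
    have himg : Finset.univ.image v = G := by
      apply Finset.coe_injective
      rw [Finset.coe_image, Finset.coe_univ, image_univ, hG]
    have h1 : ∑ i, w (v i) = 1 := by
      rw [← hw.2.2.1, ← himg, Finset.sum_image hv.injective.injOn]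
    have h2 : ∑ i, w (v i) • v i = x := by
      rw [← hw.2.2.2, ← himg, Finset.sum_image hv.injective.injOn]
    refine ⟨refPoint fun i => w (v i), fun i => ?_, ?_⟩
    · rw [refCoord_refPoint h1]
      exact hw.nonneg _
    · rw [param]
      simp only [refCoord_refPoint h1]
      exact h2

lemma measurableEmbedding_param (hv : AffineIndependent ℝ v) : MeasurableEmbedding (param v) :=
  (continuous_param v).measurableEmbedding (injective_param hv)

/-- The parametrization scales the surface measure by a constant factor. -/
lemma euclideanHausdorffMeasure_image_param (v : Fin (r + 1) → Space d) (s : Set (Space r)) :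
    (μHE[r] : Measure (Space d)) (param v '' s)
      = ENNReal.ofReal (paramLinear v).normDet * volume s := by
  have h1 : param v '' s = (fun x => v 0 + x) '' (paramLinear v '' s) := by
    rw [image_image]
    exact image_congr fun y _ => param_eq v y
  have h2 := (paramLinear v).euclideanHausdorffMeasure_image_eq_normDet_mul_volume s
  rw [finrank_euclideanSpace_fin] at h2
  rw [h1, (isometry_add_left (v 0)).euclideanHausdorffMeasure_image, h2]

lemma restrict_range_param (hv : AffineIndependent ℝ v) :
    (μHE[r] : Measure (Space d)).restrict (range (param v))
      = ENNReal.ofReal (paramLinear v).normDet • (volume : Measure (Space r)).map (param v) := by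
  ext s hs
  rw [Measure.restrict_apply hs, ← image_preimage_eq_inter_range,
    euclideanHausdorffMeasure_image_param, Measure.smul_apply, smul_eq_mul,
    (measurableEmbedding_param hv).map_apply]

lemma restrict_image_param (hv : AffineIndependent ℝ v) (s : Set (Space r)) :
    (μHE[r] : Measure (Space d)).restrict (param v '' s)
      = ENNReal.ofReal (paramLinear v).normDet
        • ((volume : Measure (Space r)).restrict s).map (param v) := by
  rw [← Measure.restrict_restrict_of_subset (image_subset_range (param v) s),
    restrict_range_param hv, Measure.restrict_smul, (measurableEmbedding_param hv).restrict_map,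
    preimage_image_eq _ (injective_param hv)]

lemma setIntegral_image_param (hv : AffineIndependent ℝ v) (s : Set (Space r)) (F : Space d → ℝ) :
    ∫ x in param v '' s, F x ∂(μHE[r] : Measure (Space d))
      = (paramLinear v).normDet * ∫ y in s, F (param v y) := by
  rw [restrict_image_param hv, integral_smul_measure, (measurableEmbedding_param hv).integral_map,
    ENNReal.toReal_ofReal (LinearMap.normDet_nonneg _), smul_eq_mul]

lemma ae_restrict_simplex (hv : AffineIndependent ℝ v) (hG : range v = G) {p : Space d → Prop}
    (hp : ∀ᵐ y ∂(volume : Measure (Space r)), y ∈ refSimplex r → p (param v y)) :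
    ∀ᵐ x ∂(μHE[r] : Measure (Space d)).restrict (simplex G), p x := by
  rw [← image_param hv hG, restrict_image_param hv]
  refine Measure.ae_smul_measure ?_ _
  rw [(measurableEmbedding_param hv).ae_map_iff]
  exact (ae_restrict_iff' measurableSet_refSimplex).2 hp

lemma euclideanHausdorffMeasure_simplex_lt_top (hcard : G.card = r + 1)
    (hG : AffineIndependent ℝ (fun v : G => (v : Space d))) :
    (μHE[r] : Measure (Space d)) (simplex G) < ⊤ := by
  obtain ⟨v, hv, hvG⟩ := exists_enumeration hcard hG
  rw [← image_param hv hvG, euclideanHausdorffMeasure_image_param]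
  exact ENNReal.mul_lt_top ENNReal.ofReal_lt_top volume_refSimplex_lt_top

lemma IsTriangulation.isFiniteMeasure_restrict_euclideanHausdorff
    {𝒮 : Finset (Finset (Space d))} {S : Set (Space d)} (hS : IsTriangulation 𝒮 r S) :
    IsFiniteMeasure ((μHE[r] : Measure (Space d)).restrict S) := by
  refine ⟨?_⟩
  rw [Measure.restrict_apply_univ, ← hS.cover]
  refine (measure_biUnion_finset_le _ _).trans_lt (ENNReal.sum_lt_top.2 fun K hK => ?_)
  exact euclideanHausdorffMeasure_simplex_lt_top (hS.card_eq K hK) (hS.indep K hK)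

/-- Moving a point `c` of a simplex in a direction parallel to the face with the vertices `v` changes
the barycentric coordinates of these vertices only, and by the coordinates `f` of the direction. -/
lemma nonneg_of_mem_simplex {K : Finset (Space d)}
    (hK : AffineIndependent ℝ (fun v : K => (v : Space d))) (hv : Function.Injective v)
    (hvK : range v ⊆ K) {c : Space d} {w : Space d → ℝ} (hw : BarycentricIn K c w)
    {f : Fin (r + 1) → ℝ} (hf : ∑ i, f i = 0) (hmem : c + ∑ i, f i • v i ∈ simplex K)
    (i : Fin (r + 1)) : 0 ≤ w (v i) + f i := by
  obtain ⟨w', hw'⟩ := mem_simplex_iff.1 hmem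
  have := hK.eq_zero_of_sum_eq_zero_subtype (w := fun x => w' x - w x - spread v f x)
    (by rw [Finset.sum_sub_distrib, Finset.sum_sub_distrib, hw.2.2.1, hw'.2.2.1, sum_spread hvK,
      hf]; simp)
    (by
      simp only [sub_smul]
      rw [Finset.sum_sub_distrib, Finset.sum_sub_distrib, hw.2.2.2, hw'.2.2.2, sum_spread_smul hvK]
      abel)
  have h := this (v i) (hvK ⟨i, rfl⟩)
  rw [spread_apply hv] at h
  have := hw'.nonneg (v i)
  linarith

/-- A face of a simplex that contains a ball is at least as large as a ball of the same radius in the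
dimension of the face: the part of the ball parallel to the face can be translated into the face. -/
lemma volume_closedBall_le_of_subset_simplex {K : Finset (Space d)}
    (hK : AffineIndependent ℝ (fun v : K => (v : Space d))) (hv : AffineIndependent ℝ v)
    (hvK : range v ⊆ K) {c : Space d} {ρ : ℝ} (hρ : 0 < ρ)
    (hc : Metric.closedBall c ρ ⊆ simplex K) :
    (volume : Measure (Space r)) (Metric.closedBall 0 ρ)
      ≤ ENNReal.ofReal (paramLinear v).normDet * volume (refSimplex r) := by
  obtain ⟨w, hw⟩ := mem_simplex_iff.1 (hc (Metric.mem_closedBall_self hρ.le))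
  set s : Set (Space r) := {y | ‖paramLinear v y‖ ≤ ρ} with hs
  -- the coordinates of the ball's centre; the weight of the vertices outside of the face is
  -- distributed evenly
  set b : Fin (r + 1) → ℝ := fun i => w (v i) + (1 - ∑ j, w (v j)) / (r + 1) with hb
  have hr : (0 : ℝ) < r + 1 := by positivity
  have hb1 : ∑ i, b i = 1 := by
    rw [hb, Finset.sum_add_distrib]
    simp only [Finset.sum_const, Finset.card_univ, Fintype.card_fin, nsmul_eq_mul]
    push_cast
    field_simp
    ring
  have hwle : ∑ j, w (v j) ≤ 1 := by
    rw [← hw.2.2.1, ← Finset.sum_image (f := w) (s := Finset.univ) hv.injective.injOn]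
    refine Finset.sum_le_sum_of_subset_of_nonneg (fun x hx => ?_) fun x _ _ => hw.nonneg x
    obtain ⟨i, -, rfl⟩ := Finset.mem_image.1 hx
    exact hvK ⟨i, rfl⟩
  have hsub : s ⊆ (fun y => refPoint b + y) ⁻¹' refSimplex r := by
    intro y hy i
    have h1 := nonneg_of_mem_simplex hK hv.injective hvK hw (sum_refCoord_sub y 0) (hc (by
      have e : ∑ i, (refCoord r i y - refCoord r i 0) • v i = paramLinear v y := by
        simp only [sub_smul]
        rw [Finset.sum_sub_distrib]
        exact (param_sub v y 0).trans (by rw [sub_zero])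
      rw [e, mem_closedBall_iff_norm, add_sub_cancel_left]
      exact hy)) i
    have h2 : refCoord r i (refPoint b + y)
        = refCoord r i (refPoint b) + (refCoord r i y - refCoord r i 0) := by
      have h3 := (refCoord r i).map_vadd (refPoint b) y
      have h4 := (refCoord r i).map_vadd 0 y
      simp only [vadd_eq_add, add_zero] at h3 h4
      rw [add_comm, h3, h4]; ring
    rw [h2, refCoord_refPoint hb1]
    have : 0 ≤ (1 - ∑ j, w (v j)) / (r + 1) := div_nonneg (by linarith) hr.le
    simp only [hb]
    linarith
  have hvol : (volume : Measure (Space r)) s ≤ volume (refSimplex r) := by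
    refine (measure_mono hsub).trans (le_of_eq ?_)
    exact measure_preimage_add _ _ _
  refine le_trans (le_of_eq ?_) (mul_le_mul_right hvol _)
  have h2 := (paramLinear v).euclideanHausdorffMeasure_image_eq_normDet_mul_volume s
  rw [finrank_euclideanSpace_fin] at h2
  rw [← h2]
  -- `paramLinear v '' s` is an isometric copy of the ball
  obtain ⟨bv⟩ := ((paramLinear v).normDet_ne_zero_tfae.out 4 3).1 (injective_paramLinear hv)
  let g : Space r ≃ₗᵢ[ℝ] LinearMap.range (paramLinear v) :=
    (stdOrthonormalBasis ℝ (Space r)).equiv bv (Equiv.refl _)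
  let Φ := (LinearMap.range (paramLinear v)).subtypeₗᵢ.comp g.toLinearIsometry
  have himg : paramLinear v '' s = Φ '' Metric.closedBall 0 ρ := by
    ext x
    constructor
    · rintro ⟨y, hy, rfl⟩
      refine ⟨g.symm ⟨paramLinear v y, y, rfl⟩, ?_, ?_⟩
      · rw [mem_closedBall_zero_iff, LinearIsometryEquiv.norm_map]
        exact hy
      · simp [Φ]
    · rintro ⟨z, hz, rfl⟩
      obtain ⟨y, hy⟩ := (g z).2
      refine ⟨y, ?_, hy⟩
      rw [hs, mem_ofPred_eq, hy]
      rw [mem_closedBall_zero_iff] at hz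
      rwa [Submodule.norm_coe, LinearIsometryEquiv.norm_map]
  rw [himg, Φ.isometry.euclideanHausdorffMeasure_image,
    EuclideanSpace.euclideanHausdorffMeasure_eq_volume]

end Param


/-! ### Lower bound for the boundary mass matrix -/

section Surface

open scoped Classical

variable {r : ℕ} {𝒯 𝒯Γ : Finset (Finset (Space (r + 1)))} {Ω : Set (Space (r + 1))} {k : ℕ}
  {v : Fin (r + 1) → Space (r + 1)} {G K : Finset (Space (r + 1))}
  {S : Set (Space (r + 1))} {s : ℕ}

lemma surfaceMeasure_eq (Ω : Set (Space (r + 1))) :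
    surfaceMeasure Ω = (μHE[r] : Measure (Space (r + 1))).restrict (frontier Ω) := rfl

lemma IsBoundaryRefinement.isFiniteMeasure (hB : IsBoundaryRefinement Ω 𝒯 𝒯Γ) :
    IsFiniteMeasure (surfaceMeasure Ω) :=
  hB.triangulation.isFiniteMeasure_restrict_euclideanHausdorff

lemma IsTriangulation.hat_param (hT : IsTriangulation 𝒯 s S) (hK : K ∈ 𝒯)
    (hv : AffineIndependent ℝ v) (hG : range v = G) (hGK : G ⊆ K) {y : Space r}
    (hy : y ∈ refSimplex r) (i : Fin (r + 1)) : hat 𝒯 (v i) (param v y) = refCoord r i y := by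
  rw [hT.hat_eq hK ((barycentricIn_param hv hG hy).mono hGK), spread_apply hv.injective]

/-- Almost every point of a facet lies in its relative interior. -/
lemma IsTriangulation.ae_hat_ne_zero (hT : IsTriangulation 𝒯 s S) (hK : K ∈ 𝒯) (hGK : G ⊆ K)
    (hcard : G.card = r + 1) :
    ∀ᵐ x ∂(μHE[r] : Measure (Space (r + 1))).restrict (simplex G), ∀ u ∈ G, hat 𝒯 u x ≠ 0 := by
  obtain ⟨v, hv, hvG⟩ := exists_enumeration hcard ((hT.indep K hK).mono hGK)
  refine ae_restrict_simplex hv hvG ?_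
  filter_upwards [ae_refCoord_ne_zero] with y hy hyr u hu
  rw [← Finset.mem_coe, ← hvG] at hu
  obtain ⟨i, rfl⟩ := hu
  rw [hT.hat_param hK hv hvG hGK hyr]
  exact hy i

lemma IsTriangulation.lagrange_param (hT : IsTriangulation 𝒯 s S) (hK : K ∈ 𝒯)
    (hv : AffineIndependent ℝ v) (hG : range v = G) (hGK : G ⊆ K) {n : Space (r + 1) →₀ ℕ}
    (hn : n.support ⊆ G) {y : Space r} (hy : y ∈ refSimplex r) :
    lagrange 𝒯 k n (param v y) = refLagrange k (fun i => n (v i)) y := by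
  have himg : Finset.univ.image v = G := by
    apply Finset.coe_injective
    rw [Finset.coe_image, Finset.coe_univ, image_univ, hG]
  rw [lagrange, refLagrange, Finset.prod_subset hn, ← himg, Finset.prod_image hv.injective.injOn]
  · refine Finset.prod_congr rfl fun i _ => ?_
    rw [hT.hat_param hK hv hG hGK hy]
  · intro x _ hx
    rw [Finsupp.notMem_support_iff.1 hx]
    simp

lemma sum_enumeration (hv : AffineIndependent ℝ v) (hG : range v = G) {n : Space (r + 1) →₀ ℕ}
    (hn : n ∈ nodes 𝒯 k) (hnG : n.support ⊆ G) : ∑ i, n (v i) = k := by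
  have himg : Finset.univ.image v = G := by
    apply Finset.coe_injective
    rw [Finset.coe_image, Finset.coe_univ, image_univ, hG]
  rw [← sum_support_of_mem_nodes hn, Finset.sum_subset hnG, ← himg,
    Finset.sum_image hv.injective.injOn]
  intro x _ hx
  exact Finsupp.notMem_support_iff.1 hx

lemma boundary_mem_nodes (j : boundaryNodes Ω 𝒯 k) : j.1 ∈ nodes 𝒯 k :=
  (Finset.mem_filter.1 j.2).1

/-- Two nodes of a facet with the same multi-index on the facet coincide. -/
lemma eq_of_enumeration (hG : range v = G) {n m : Space (r + 1) →₀ ℕ} (hn : n.support ⊆ G)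
    (hm : m.support ⊆ G) (h : ∀ i, n (v i) = m (v i)) : n = m := by
  ext x
  by_cases hx : x ∈ G
  · rw [← Finset.mem_coe, ← hG] at hx
    obtain ⟨i, rfl⟩ := hx
    exact h i
  · rw [Finsupp.notMem_support_iff.1 fun h => hx (hn h),
      Finsupp.notMem_support_iff.1 fun h => hx (hm h)]

/-- The squared nodal values are controlled by the `L²` norm on a facet. -/
lemma IsTriangulation.nodal_sq_le (hT : IsTriangulation 𝒯 s S) (hK : K ∈ 𝒯)
    (hv : AffineIndependent ℝ v) (hG : range v = G) (hGK : G ⊆ K) {c : ℝ}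
    (hc : ∀ (W : RefNode r k → ℝ) (b : RefNode r k),
      (W b) ^ 2 ≤ c * ∫ y in refSimplex r, (∑ a, W a * refLagrange k a.1 y) ^ 2)
    (w : boundaryNodes Ω 𝒯 k → ℝ) (i : boundaryNodes Ω 𝒯 k) (hi : i.1.support ⊆ G) :
    (paramLinear v).normDet * (w i) ^ 2
      ≤ c * ∫ x in simplex G, (∑ j, w j * lagrange 𝒯 k j.1 x) ^ 2 ∂(μHE[r]) := by
  -- `W a` is the coefficient of the boundary node on the facet with the multi-index `a`
  set W : RefNode r k → ℝ := fun a =>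
    ∑ j : boundaryNodes Ω 𝒯 k, if j.1.support ⊆ G ∧ ∀ l, j.1 (v l) = a.1 l then w j else 0 with hW
  have hnode : ∀ j : boundaryNodes Ω 𝒯 k, j.1.support ⊆ G →
      (fun l => j.1 (v l)) ∈ Finset.piAntidiag (Finset.univ : Finset (Fin (r + 1))) k := by
    intro j hj
    rw [Finset.mem_piAntidiag]
    exact ⟨sum_enumeration hv hG (boundary_mem_nodes j) hj, fun _ _ => Finset.mem_univ _⟩
  have hWi : W ⟨_, hnode i hi⟩ = w i := by
    simp only [hW]
    rw [Finset.sum_eq_single i]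
    · rw [if_pos ⟨hi, fun _ => rfl⟩]
    · intro j _ hj
      refine if_neg fun h => hj (Subtype.ext (eq_of_enumeration hG h.1 hi h.2))
    · simp
  have hF : ∀ y ∈ refSimplex r, ∑ a, W a * refLagrange k a.1 y
      = ∑ j, w j * lagrange 𝒯 k j.1 (param v y) := by
    intro y hy
    simp only [hW, Finset.sum_mul]
    rw [Finset.sum_comm]
    refine Finset.sum_congr rfl fun j _ => ?_
    by_cases hj : j.1.support ⊆ G
    · rw [Finset.sum_eq_single ⟨_, hnode j hj⟩]
      · rw [if_pos ⟨hj, fun _ => rfl⟩, hT.lagrange_param hK hv hG hGK hj hy]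
      · intro a _ ha
        rw [if_neg, zero_mul]
        exact fun h => ha (Subtype.ext (funext fun l => (h.2 l).symm))
      · simp
    · rw [hT.lagrange_eq_zero_of_not_subset hK hGK
        (image_param hv hG ▸ mem_image_of_mem _ hy) hj, mul_zero]
      exact Finset.sum_eq_zero fun a _ => by rw [if_neg fun h => hj h.1, zero_mul]
  have h1 := hc W ⟨_, hnode i hi⟩
  rw [hWi, setIntegral_congr_fun (g := fun y => (∑ j, w j * lagrange 𝒯 k j.1 (param v y)) ^ 2)
    measurableSet_refSimplex (fun y hy => by rw [hF y hy])] at h1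
  rw [← image_param hv hG, setIntegral_image_param hv]
  calc _ ≤ (paramLinear v).normDet * _ := mul_le_mul_of_nonneg_left h1 (LinearMap.normDet_nonneg _)
    _ = _ := by ring

lemma card_boundaryNodes_le (hcard : G.card = s) :
    (Finset.univ.filter fun j : boundaryNodes Ω 𝒯 k => j.1.support ⊆ G).card
      ≤ s.multichoose k := by
  refine le_trans ?_ (card_dofNode_le (Ω := Ω) (𝒯 := 𝒯) hcard)
  refine Finset.card_le_card_of_injOn Sum.inr (fun j hj => ?_) Sum.inr_injective.injOn
  rw [Finset.mem_coe, Finset.mem_filter] at hj ⊢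
  exact ⟨Finset.mem_univ _, hj.2⟩

lemma IsTriangulation.continuousOn_lagrange_frontier (hT : IsTriangulation 𝒯 (r + 1) (closure Ω))
    (n : Space (r + 1) →₀ ℕ) : ContinuousOn (lagrange 𝒯 k n) (frontier Ω) :=
  (hT.continuousOn_lagrange k n).mono frontier_subset_closure

lemma IsTriangulation.isCompact_frontier (hT : IsTriangulation 𝒯 (r + 1) (closure Ω)) :
    IsCompact (frontier Ω) :=
  hT.isCompact.of_isClosed_subset isClosed_frontier frontier_subset_closure

lemma IsBoundaryRefinement.integrable (hB : IsBoundaryRefinement Ω 𝒯 𝒯Γ)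
    (hT : IsTriangulation 𝒯 (r + 1) (closure Ω)) {f : Space (r + 1) → ℝ}
    (hf : ContinuousOn f (frontier Ω)) : Integrable f (surfaceMeasure Ω) := by
  have := hB.isFiniteMeasure
  obtain ⟨C, hC⟩ := hT.isCompact_frontier.exists_bound_of_continuousOn hf
  have hm : MeasurableSet (frontier Ω) := isClosed_frontier.measurableSet
  exact Integrable.of_bound (C := C) (hf.aestronglyMeasurable hm)
    ((ae_restrict_iff' hm).2 (.of_forall fun x hx => hC x hx))

/-- Almost every point of the boundary lies in at most one facet, hence in few supports. -/
lemma IsTriangulation.ae_sum_indicator_le (hT : IsTriangulation 𝒯 s S)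
    {Gi : boundaryNodes Ω 𝒯 k → Finset (Space (r + 1))} (hGi : ∀ i, IsBoundaryFacet Ω 𝒯 (Gi i))
    (hsub : ∀ i, i.1.support ⊆ Gi i) :
    ∀ᵐ x ∂(surfaceMeasure Ω), ∀ t : ℝ, 0 ≤ t →
      ∑ i, (simplex (Gi i)).indicator (fun _ => t) x ≤ ((r + 1).multichoose k : ℕ) * t := by
  have h : ∀ᵐ x ∂(surfaceMeasure Ω), ∀ i, x ∈ simplex (Gi i) → ∀ u ∈ Gi i, hat 𝒯 u x ≠ 0 := by
    refine ae_all_iff.2 fun i => ?_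
    obtain ⟨hcard, -, K, hK, hGK⟩ := hGi i
    exact ae_restrict_of_ae ((ae_restrict_iff' (isCompact_simplex _).isClosed.measurableSet).1
      (hT.ae_hat_ne_zero hK hGK hcard))
  filter_upwards [h] with x hx t ht
  by_cases hex : ∃ i, x ∈ simplex (Gi i)
  · obtain ⟨i₀, hi₀⟩ := hex
    obtain ⟨hcard, -, K, hK, hGK⟩ := hGi i₀
    have hzero := (hT.barycentricIn_hat hK hGK hi₀).2.1
    calc ∑ i, (simplex (Gi i)).indicator (fun _ => t) x
        = ∑ i, if x ∈ simplex (Gi i) then t else 0 :=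
          Finset.sum_congr rfl fun i _ => by rw [indicator_apply]
      _ = (Finset.univ.filter fun i => x ∈ simplex (Gi i)).card * t := by
          rw [← Finset.sum_filter, Finset.sum_const, nsmul_eq_mul]
      _ ≤ _ := by
          gcongr
          refine le_trans (Finset.card_le_card fun i hi => ?_)
            (card_boundaryNodes_le (Ω := Ω) (𝒯 := 𝒯) (G := Gi i₀) hcard)
          rw [Finset.mem_filter] at hi ⊢
          refine ⟨Finset.mem_univ _, fun u hu => ?_⟩
          by_contra hu'
          exact hx i hi.2 u (hsub i hu) (hzero u hu')
  · push Not at hex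
    rw [Finset.sum_eq_zero fun i _ => indicator_of_notMem (hex i) _]
    positivity

lemma assemble_Mlam_eq {N : ℕ} (α κ : Space (r + 1) → ℝ) (ψ : Fin N → Space (r + 1) → ℝ) :
    (assemble Ω α κ 𝒯 𝒯Γ k ψ).Mlam = Matrix.of fun i j => ∫ x,
      (fun _ => (1 : ℝ)) x * inner ℝ ((fun i : boundaryNodes Ω 𝒯 k => lagrange 𝒯 k i.1) i x)
        ((fun i : boundaryNodes Ω 𝒯 k => lagrange 𝒯 k i.1) j x) ∂(surfaceMeasure Ω) := by
  ext i j
  simp [assemble, bulkBasis, mul_comm]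

lemma IsBoundaryRefinement.normSq_Mlam {N : ℕ} (hB : IsBoundaryRefinement Ω 𝒯 𝒯Γ)
    (hT : IsTriangulation 𝒯 (r + 1) (closure Ω)) (α κ : Space (r + 1) → ℝ)
    (ψ : Fin N → Space (r + 1) → ℝ) (w : boundaryNodes Ω 𝒯 k → ℝ) :
    normSq (assemble Ω α κ 𝒯 𝒯Γ k ψ).Mlam w
      = ∫ x, (∑ j, w j * lagrange 𝒯 k j.1 x) ^ 2 ∂(surfaceMeasure Ω) := by
  rw [assemble_Mlam_eq, normSq_gram]
  · simp
  · intro i j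
    exact hB.integrable hT (continuousOn_const.mul
      ((hT.continuousOn_lagrange_frontier i.1).inner (hT.continuousOn_lagrange_frontier j.1)))

/-- The boundary mass matrix is bounded from below by a multiple of `h ^ (d - 1)`. -/
lemma IsBoundaryRefinement.sum_sq_le {N : ℕ} (hB : IsBoundaryRefinement Ω 𝒯 𝒯Γ)
    (hT : IsTriangulation 𝒯 (r + 1) (closure Ω)) (hk : 1 ≤ k) {σ : ℝ} (hσ0 : 0 < σ)
    (hh : 0 < meshWidth 𝒯) (hσ : QuasiUniform σ 𝒯) {c : ℝ} (hc0 : 0 ≤ c)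
    (hc : ∀ (W : RefNode r k → ℝ) (b : RefNode r k),
      (W b) ^ 2 ≤ c * ∫ y in refSimplex r, (∑ a, W a * refLagrange k a.1 y) ^ 2)
    (α κ : Space (r + 1) → ℝ) (ψ : Fin N → Space (r + 1) → ℝ) (w : boundaryNodes Ω 𝒯 k → ℝ) :
    (meshWidth 𝒯 / σ) ^ r * (volume : Measure (Space r)).real (Metric.ball 0 1)
        * ∑ i, (w i) ^ 2
      ≤ (volume : Measure (Space r)).real (refSimplex r) * c * ((r + 1).multichoose k : ℕ)
        * normSq (assemble Ω α κ 𝒯 𝒯Γ k ψ).Mlam w := by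
  have := hB.isFiniteMeasure
  -- every node is estimated on one facet that contains it
  choose Gi hGi hsub using fun i : boundaryNodes Ω 𝒯 k =>
    hB.exists_facet_of_mem_boundaryNodes hT hk i.2
  set F : Space (r + 1) → ℝ := fun x => (∑ j, w j * lagrange 𝒯 k j.1 x) ^ 2 with hF
  have hFc : ContinuousOn F (frontier Ω) :=
    (continuousOn_finsetSum _ fun j _ =>
      continuousOn_const.mul (hT.continuousOn_lagrange_frontier j.1)).pow 2
  have hFi := hB.integrable hT hFc
  have hmeas : ∀ i, MeasurableSet (simplex (Gi i)) :=
    fun i => (isCompact_simplex _).isClosed.measurableSet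
  set V := (volume : Measure (Space r)).real (refSimplex r) with hV
  have h1 : ∀ i, (meshWidth 𝒯 / σ) ^ r * (volume : Measure (Space r)).real (Metric.ball 0 1)
      * (w i) ^ 2 ≤ V * c * ∫ x in simplex (Gi i), F x ∂(surfaceMeasure Ω) := by
    intro i
    obtain ⟨hcard, hGΓ, K, hK, hGK⟩ := hGi i
    obtain ⟨v, hv, hvG⟩ := exists_enumeration hcard ((hT.indep K hK).mono hGK)
    obtain ⟨x₀, ρ, hρ, hle, hball⟩ := hσ K hK
    have h2 := hT.nodal_sq_le hK hv hvG hGK hc w i (hsub i)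
    have h3 := volume_closedBall_le_of_subset_simplex (hT.indep K hK) hv
      (hvG.le.trans (Finset.coe_subset.2 hGK)) hρ hball
    have h4 : (volume : Measure (Space r)).real (Metric.closedBall 0 ρ)
        ≤ (paramLinear v).normDet * V := by
      have := ENNReal.toReal_mono
        (ENNReal.mul_lt_top ENNReal.ofReal_lt_top volume_refSimplex_lt_top).ne h3
      rwa [ENNReal.toReal_mul, ENNReal.toReal_ofReal (LinearMap.normDet_nonneg _)] at this
    rw [Measure.addHaar_real_closedBall _ _ hρ.le, finrank_euclideanSpace_fin] at h4
    have h5 : meshWidth 𝒯 / σ ≤ ρ := by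
      rw [div_le_iff₀ hσ0, mul_comm]; exact hle
    have h6 : (meshWidth 𝒯 / σ) ^ r * (volume : Measure (Space r)).real (Metric.ball 0 1)
        ≤ (paramLinear v).normDet * V := by
      refine le_trans ?_ h4
      gcongr
    rw [surfaceMeasure_eq, Measure.restrict_restrict_of_subset hGΓ]
    calc _ ≤ (paramLinear v).normDet * V * (w i) ^ 2 := by gcongr
      _ = V * ((paramLinear v).normDet * (w i) ^ 2) := by ring
      _ ≤ V * (c * ∫ x in simplex (Gi i), F x ∂(μHE[r])) := by gcongr
      _ = _ := by ring
  have hsum : ∑ i, ∫ x in simplex (Gi i), F x ∂(surfaceMeasure Ω)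
      ≤ ((r + 1).multichoose k : ℕ) * ∫ x, F x ∂(surfaceMeasure Ω) := by
    calc ∑ i, ∫ x in simplex (Gi i), F x ∂(surfaceMeasure Ω)
        = ∫ x, ∑ i, (simplex (Gi i)).indicator F x ∂(surfaceMeasure Ω) := by
          rw [integral_finsetSum _ fun i _ => hFi.indicator (hmeas i)]
          exact Finset.sum_congr rfl fun i _ => (integral_indicator (hmeas i)).symm
      _ ≤ ∫ x, ((r + 1).multichoose k : ℕ) * F x ∂(surfaceMeasure Ω) := by
          refine integral_mono_ae (integrable_finsetSum _ fun i _ => hFi.indicator (hmeas i))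
            (hFi.const_mul _) ?_
          filter_upwards [hT.ae_sum_indicator_le hGi hsub] with x hx
          have := hx (F x) (sq_nonneg _)
          simpa only [indicator_apply] using this
      _ = _ := integral_const_mul _ _
  rw [hB.normSq_Mlam hT]
  calc _ = ∑ i, (meshWidth 𝒯 / σ) ^ r
        * (volume : Measure (Space r)).real (Metric.ball 0 1) * (w i) ^ 2 := by
        rw [Finset.mul_sum]
    _ ≤ ∑ i, V * c * ∫ x in simplex (Gi i), F x ∂(surfaceMeasure Ω) :=
        Finset.sum_le_sum fun i _ => h1 i
    _ = V * c * ∑ i, ∫ x in simplex (Gi i), F x ∂(surfaceMeasure Ω) := by rw [Finset.mul_sum]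
    _ ≤ V * c * (((r + 1).multichoose k : ℕ) * ∫ x, F x ∂(surfaceMeasure Ω)) := by gcongr
    _ = _ := by ring

end Surface


/-! ### The surface matrices -/

section SurfaceMatrices

open scoped Classical

variable {r : ℕ} {𝒯 𝒯Γ : Finset (Finset (Space (r + 1)))} {Ω : Set (Space (r + 1))} {k N : ℕ}
  {ψ : Fin N → Space (r + 1) → ℝ}

lemma assemble_Mp_eq (α κ : Space (r + 1) → ℝ) :
    (assemble Ω α κ 𝒯 𝒯Γ k ψ).Mp = Matrix.of fun i j => ∫ x,
      (fun _ => (1 : ℝ)) x * inner ℝ (ψ i x) (ψ j x) ∂(surfaceMeasure Ω) := by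
  ext i j
  simp [assemble, mul_comm]

lemma IsBoundaryRefinement.integrable_gram_Mp (hB : IsBoundaryRefinement Ω 𝒯 𝒯Γ)
    (hT : IsTriangulation 𝒯 (r + 1) (closure Ω)) (hψ : IsSurfaceBasis Ω 𝒯Γ ψ) (i j : Fin N) :
    Integrable (fun x => (fun _ => (1 : ℝ)) x * inner ℝ (ψ i x) (ψ j x)) (surfaceMeasure Ω) :=
  hB.integrable hT (continuousOn_const.mul ((hψ.cont i).inner (hψ.cont j)))

lemma IsBoundaryRefinement.posSemidef_Mp (hB : IsBoundaryRefinement Ω 𝒯 𝒯Γ)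
    (hT : IsTriangulation 𝒯 (r + 1) (closure Ω)) (hψ : IsSurfaceBasis Ω 𝒯Γ ψ)
    (α κ : Space (r + 1) → ℝ) : (assemble Ω α κ 𝒯 𝒯Γ k ψ).Mp.PosSemidef := by
  rw [assemble_Mp_eq]
  exact posSemidef_gram (by simp) (hB.integrable_gram_Mp hT hψ)

lemma IsBoundaryRefinement.normSq_Mp (hB : IsBoundaryRefinement Ω 𝒯 𝒯Γ)
    (hT : IsTriangulation 𝒯 (r + 1) (closure Ω)) (hψ : IsSurfaceBasis Ω 𝒯Γ ψ)
    (α κ : Space (r + 1) → ℝ) (q : Fin N → ℝ) :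
    normSq (assemble Ω α κ 𝒯 𝒯Γ k ψ).Mp q
      = ∫ x, (∑ j, q j * ψ j x) ^ 2 ∂(surfaceMeasure Ω) := by
  rw [assemble_Mp_eq, normSq_gram (hB.integrable_gram_Mp hT hψ)]
  simp

lemma transpose_Mlam (α κ : Space (r + 1) → ℝ) :
    (assemble Ω α κ 𝒯 𝒯Γ k ψ).Mlamᵀ = (assemble Ω α κ 𝒯 𝒯Γ k ψ).Mlam := by
  ext i j
  simp [assemble, mul_comm]

/-- The interior basis functions vanish on the boundary. -/
lemma IsBoundaryRefinement.Bu_mulVec (hB : IsBoundaryRefinement Ω 𝒯 𝒯Γ)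
    (hT : IsTriangulation 𝒯 (r + 1) (closure Ω)) (hk : 1 ≤ k) (α κ : Space (r + 1) → ℝ)
    (u : BulkDof Ω 𝒯 k → ℝ) :
    (assemble Ω α κ 𝒯 𝒯Γ k ψ).Bu *ᵥ u = (assemble Ω α κ 𝒯 𝒯Γ k ψ).Mlam *ᵥ (u ∘ Sum.inr) := by
  ext i
  simp only [Matrix.mulVec, dotProduct, Fintype.sum_sum_type]
  have h : ∀ j : interiorNodes Ω 𝒯 k, (assemble Ω α κ 𝒯 𝒯Γ k ψ).Bu i (Sum.inl j) = 0 := by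
    intro j
    refine (setIntegral_congr_fun (g := fun _ => (0 : ℝ)) isClosed_frontier.measurableSet
      fun x hx => ?_).trans (by simp)
    simp only [bulkBasis, Sum.elim_inl]
    rw [hB.lagrange_eq_zero hT hk j.2 hx, mul_zero]
  simp only [h, zero_mul, Finset.sum_const_zero, zero_add]
  rfl

lemma IsBoundaryRefinement.dotProduct_Bp (hB : IsBoundaryRefinement Ω 𝒯 𝒯Γ)
    (hT : IsTriangulation 𝒯 (r + 1) (closure Ω)) (hψ : IsSurfaceBasis Ω 𝒯Γ ψ)
    (α κ : Space (r + 1) → ℝ) (w : boundaryNodes Ω 𝒯 k → ℝ) (q : Fin N → ℝ) :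
    w ⬝ᵥ ((assemble Ω α κ 𝒯 𝒯Γ k ψ).Bp *ᵥ q)
      = ∫ x, (∑ i, w i * lagrange 𝒯 k i.1 x) * (∑ j, q j * ψ j x) ∂(surfaceMeasure Ω) := by
  have e : ∀ x, (∑ i, w i * lagrange 𝒯 k i.1 x) * (∑ j, q j * ψ j x)
      = ∑ i, ∑ j, w i * q j * (lagrange 𝒯 k i.1 x * ψ j x) := by
    intro x
    rw [Finset.sum_mul]
    refine Finset.sum_congr rfl fun i _ => ?_
    rw [Finset.mul_sum]
    exact Finset.sum_congr rfl fun j _ => by ring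
  have hint : ∀ (i : boundaryNodes Ω 𝒯 k) j,
      Integrable (fun x => lagrange 𝒯 k i.1 x * ψ j x) (surfaceMeasure Ω) := fun i j =>
    hB.integrable hT ((hT.continuousOn_lagrange_frontier i.1).mul (hψ.cont j))
  simp_rw [e]
  rw [integral_finsetSum _ fun i _ => integrable_finsetSum _ fun j _ => (hint i j).const_mul _]
  simp only [dotProduct, Matrix.mulVec]
  refine Finset.sum_congr rfl fun i _ => ?_
  rw [integral_finsetSum _ fun j _ => (hint i j).const_mul _, Finset.mul_sum]
  refine Finset.sum_congr rfl fun j _ => ?_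
  rw [integral_const_mul]
  change w i * ((∫ x, lagrange 𝒯 k i.1 x * ψ j x ∂(surfaceMeasure Ω)) * q j) = _
  ring

/-- The `L²` projection onto the multiplier space is a contraction. -/
lemma IsBoundaryRefinement.normSq_projection_le (hB : IsBoundaryRefinement Ω 𝒯 𝒯Γ)
    (hT : IsTriangulation 𝒯 (r + 1) (closure Ω)) (hψ : IsSurfaceBasis Ω 𝒯Γ ψ)
    (α κ : Space (r + 1) → ℝ) {w : boundaryNodes Ω 𝒯 k → ℝ} {q : Fin N → ℝ}
    (hw : (assemble Ω α κ 𝒯 𝒯Γ k ψ).Mlam *ᵥ w = (assemble Ω α κ 𝒯 𝒯Γ k ψ).Bp *ᵥ q) :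
    normSq (assemble Ω α κ 𝒯 𝒯Γ k ψ).Mlam w ≤ normSq (assemble Ω α κ 𝒯 𝒯Γ k ψ).Mp q := by
  have h1 : normSq (assemble Ω α κ 𝒯 𝒯Γ k ψ).Mlam w
      = ∫ x, (∑ i, w i * lagrange 𝒯 k i.1 x) * (∑ j, q j * ψ j x) ∂(surfaceMeasure Ω) := by
    rw [← hB.dotProduct_Bp hT hψ α κ, ← hw]; rfl
  have h2 := hB.normSq_Mlam (𝒯Γ := 𝒯Γ) (k := k) hT α κ ψ w
  have h3 := hB.normSq_Mp (k := k) hT hψ α κ q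
  have hf : ContinuousOn (fun x => ∑ i, w i * lagrange 𝒯 k i.1 x) (frontier Ω) :=
    continuousOn_finsetSum _ fun i _ =>
      continuousOn_const.mul (hT.continuousOn_lagrange_frontier i.1)
  have hg : ContinuousOn (fun x => ∑ j, q j * ψ j x) (frontier Ω) :=
    continuousOn_finsetSum _ fun j _ => continuousOn_const.mul (hψ.cont j)
  have h4 : 0 ≤ ∫ x, ((∑ i, w i * lagrange 𝒯 k i.1 x) - ∑ j, q j * ψ j x) ^ 2
      ∂(surfaceMeasure Ω) := integral_nonneg fun x => sq_nonneg _
  have e : ∀ x, ((∑ i, w i * lagrange 𝒯 k i.1 x) - ∑ j, q j * ψ j x) ^ 2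
      = (∑ i, w i * lagrange 𝒯 k i.1 x) ^ 2
        - 2 * ((∑ i, w i * lagrange 𝒯 k i.1 x) * ∑ j, q j * ψ j x)
        + (∑ j, q j * ψ j x) ^ 2 := fun x => by ring
  simp_rw [e] at h4
  have i1 : Integrable (fun x => (∑ i, w i * lagrange 𝒯 k i.1 x) ^ 2) (surfaceMeasure Ω) :=
    hB.integrable hT (hf.pow 2)
  have i2 : Integrable (fun x => 2 * ((∑ i, w i * lagrange 𝒯 k i.1 x) * ∑ j, q j * ψ j x))
      (surfaceMeasure Ω) := (hB.integrable hT (hf.mul hg)).const_mul 2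
  have i3 : Integrable (fun x => (∑ j, q j * ψ j x) ^ 2) (surfaceMeasure Ω) :=
    hB.integrable hT (hg.pow 2)
  have i4 : Integrable (fun x => (∑ i, w i * lagrange 𝒯 k i.1 x) ^ 2
      - 2 * ((∑ i, w i * lagrange 𝒯 k i.1 x) * ∑ j, q j * ψ j x)) (surfaceMeasure Ω) := i1.sub i2
  rw [integral_add i4 i3, integral_sub i1 i2, integral_const_mul, ← h1, ← h3] at h4
  rw [← h2] at h4
  linarith

/-! ### The surface stiffness matrix -/

lemma contDiff_eval {d : ℕ} (P : MvPolynomial (Fin d) ℝ) :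
    ContDiff ℝ 1 fun x : Space d => MvPolynomial.eval (fun i => x i) P := by
  induction P using MvPolynomial.induction_on with
  | C a => simpa using contDiff_const
  | add p q hp hq => simpa using hp.add hq
  | mul_X p i hp =>
    simpa using hp.mul (EuclideanSpace.proj i : Space d →L[ℝ] ℝ).contDiff

lemma param_refPoint_single {d : ℕ} (v : Fin (r + 1) → Space d) (i : Fin (r + 1)) :
    param v (refPoint (Pi.single i 1)) = v i := by
  have h : ∑ j, (Pi.single i 1 : Fin (r + 1) → ℝ) j = 1 := by simp
  simp only [param, refCoord_refPoint h]
  rw [Finset.sum_eq_single i]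
  · simp
  · intro j _ hj; simp [hj]
  · simp

lemma vectorSpan_le_range {d : ℕ} (v : Fin (r + 1) → Space d) :
    vectorSpan ℝ (range v) ≤ LinearMap.range (paramLinear v) := by
  rw [vectorSpan_def, Submodule.span_le]
  rintro _ ⟨_, ⟨i, rfl⟩, _, ⟨j, rfl⟩, rfl⟩
  refine ⟨refPoint (Pi.single i 1) - refPoint (Pi.single j 1), ?_⟩
  rw [← param_sub, param_refPoint_single, param_refPoint_single]
  rfl

/-- The tangential gradient of a function which is polynomial on a simplex is continuous there, up
to a null set. -/
lemma exists_continuous_tangentialGradient {d : ℕ} {F : Finset (Space d)} (hcard : F.card = r + 1)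
    (hF : AffineIndependent ℝ (fun v : F => (v : Space d))) {q : Space d → ℝ}
    {P : MvPolynomial (Fin d) ℝ} (hq : ∀ x ∈ simplex F, q x = MvPolynomial.eval (fun i => x i) P) :
    ∃ g : Space d → Space d, Continuous g ∧
      ∀ᵐ x ∂(μHE[r] : Measure (Space d)).restrict (simplex F), tangentialGradient F q x = g x := by
  obtain ⟨v, hv, hvF⟩ := exists_enumeration hcard hF
  set π := (vectorSpan ℝ (F : Set (Space d))).starProjection with hπ
  set f : Space d → ℝ := fun x => MvPolynomial.eval (fun i => x i) P with hf
  have hfd : ContDiff ℝ 1 f := contDiff_eval P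
  refine ⟨fun x => (InnerProductSpace.toDual ℝ (Space d)).symm ((fderiv ℝ f x).comp π), ?_, ?_⟩
  · exact (LinearIsometryEquiv.continuous _).comp
      ((hfd.continuous_fderiv one_ne_zero).clm_comp continuous_const)
  refine ae_restrict_simplex hv hvF ?_
  filter_upwards [ae_refCoord_ne_zero] with y hy hyr
  have hpos : ∀ i, 0 < refCoord r i y := fun i => lt_of_le_of_ne (hyr i) (hy i).symm
  obtain ⟨B, hB⟩ := (paramLinear v).exists_leftInverse_of_injective
    (LinearMap.ker_eq_bot.2 (injective_paramLinear hv))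
  have hcont : Continuous fun z => y + B (π z) :=
    continuous_const.add (B.continuous_of_finiteDimensional.comp π.continuous)
  have hev : (fun z => q (param v y + π z)) =ᶠ[nhds 0] fun z => f (param v y + π z) := by
    have hmem : {y : Space r | ∀ i, 0 < refCoord r i y} ∈ nhds (y + B (π 0)) := by
      refine isOpen_setOf_refCoord_pos.mem_nhds ?_
      rw [map_zero, map_zero, add_zero]
      exact hpos
    filter_upwards [hcont.continuousAt.preimage_mem_nhds hmem] with z hz
    refine hq _ ?_
    rw [← image_param hv hvF]
    refine ⟨y + B (π z), fun i => (hz i).le, ?_⟩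
    have h1 : π z ∈ LinearMap.range (paramLinear v) := by
      refine vectorSpan_le_range v ?_
      rw [hvF]
      exact Submodule.starProjection_apply_mem _ _
    obtain ⟨t, ht⟩ := h1
    have h2 : B (π z) = t := by
      rw [← ht]
      exact LinearMap.congr_fun hB t
    rw [param_eq, map_add, h2, ht, param_eq]
    abel
  rw [tangentialGradient, gradient, hev.fderiv_eq]
  congr 1
  have h3 : HasFDerivAt (fun z => param v y + π z) π 0 := π.hasFDerivAt.const_add _
  have h4 : HasFDerivAt f (fderiv ℝ f (param v y)) (param v y + π 0) := by
    rw [map_zero, add_zero]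
    exact (hfd.differentiable one_ne_zero _).hasFDerivAt
  exact (h4.comp 0 h3).fderiv

lemma IsBoundaryRefinement.posSemidef_Kp (hB : IsBoundaryRefinement Ω 𝒯 𝒯Γ)
    (hψ : IsSurfaceBasis Ω 𝒯Γ ψ) (α : Space (r + 1) → ℝ) {κ : Space (r + 1) → ℝ}
    (hκ : IsCoefficient (surfaceMeasure Ω) κ) :
    (assemble Ω α κ 𝒯 𝒯Γ k ψ).Kp.PosSemidef := by
  have := hB.isFiniteMeasure
  obtain ⟨hκm, a₀, a₁, ha₀, hκb⟩ := hκ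
  have e : (assemble Ω α κ 𝒯 𝒯Γ k ψ).Kp = ∑ F ∈ 𝒯Γ, Matrix.of fun i j => ∫ x,
      κ x * inner ℝ (tangentialGradient F (ψ i) x) (tangentialGradient F (ψ j) x)
        ∂((surfaceMeasure Ω).restrict (simplex F)) := by
    ext i j
    rw [Matrix.sum_apply]
    rfl
  rw [e]
  refine Matrix.posSemidef_sum _ fun F hF => ?_
  have hκF := ae_restrict_of_ae (s := simplex F) hκb
  have hFm : MeasurableSet (simplex F) := (isCompact_simplex F).isClosed.measurableSet
  have hg : ∀ j, ∃ g : Space (r + 1) → Space (r + 1), Continuous g ∧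
      ∀ᵐ x ∂(surfaceMeasure Ω).restrict (simplex F), tangentialGradient F (ψ j) x = g x := by
    intro j
    obtain ⟨P, hP⟩ := hψ.poly j F hF
    obtain ⟨g, hg, hge⟩ := exists_continuous_tangentialGradient (r := r)
      (hB.triangulation.card_eq F hF) (hB.triangulation.indep F hF) hP
    refine ⟨g, hg, ?_⟩
    rw [surfaceMeasure_eq, Measure.restrict_restrict hFm]
    exact ae_restrict_of_ae_restrict_of_subset inter_subset_left hge
  choose g hg hge using hg
  choose C hC using fun j => (isCompact_simplex F).exists_bound_of_continuousOn (hg j).continuousOn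
  refine posSemidef_gram ?_ fun i j => integrable_gram
    (f := fun j => tangentialGradient F (ψ j)) (a₁ := a₁) (L := ∑ j, |C j|) hκm.restrict ?_
    (fun j => ?_) (fun j => ?_) i j
  · filter_upwards [hκF] with x hx
    linarith
  · filter_upwards [hκF] with x hx
    rw [abs_of_nonneg (by linarith)]
    exact hx.2
  · exact (hg j).aestronglyMeasurable.congr ((hge j).mono fun x hx => hx.symm)
  · filter_upwards [hge j, ae_restrict_mem hFm] with x hx hxF
    rw [hx]
    refine (hC j x hxF).trans ((le_abs_self _).trans ?_)
    exact Finset.single_le_sum (f := fun j => |C j|) (fun _ _ => abs_nonneg _) (Finset.mem_univ j)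

end SurfaceMatrices


/-! ### Stability of the finite element system -/

section Stability

variable {r : ℕ} {𝒯 𝒯Γ : Finset (Finset (Space (r + 1)))} {Ω : Set (Space (r + 1))} {k : ℕ}

lemma sum_sq_extension (w : boundaryNodes Ω 𝒯 k → ℝ) :
    ∑ i : BulkDof Ω 𝒯 k, (Sum.elim (0 : interiorNodes Ω 𝒯 k → ℝ) w i) ^ 2 = ∑ i, (w i) ^ 2 := by
  simp [Fintype.sum_sum_type]

lemma QuasiUniform.pos {σ : ℝ} (hσ : QuasiUniform σ 𝒯) (hh : 0 < meshWidth 𝒯) : 0 < σ := by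
  obtain ⟨K, hK⟩ : 𝒯.Nonempty := by
    rw [Finset.nonempty_iff_ne_empty]
    rintro rfl
    simp [meshWidth] at hh
  obtain ⟨-, ρ, hρ, hle, -⟩ := hσ K hK
  by_contra! h
  nlinarith [mul_nonneg (neg_nonneg.2 h) hρ.le]

lemma isUnit_det_of_mulVec_eq_zero {B : Type} [Fintype B] {_ : DecidableEq B} {M : Matrix B B ℝ}
    (hM : ∀ w, M *ᵥ w = 0 → w = 0) : IsUnit M.det := by
  rw [← Matrix.isUnit_iff_isUnit_det, ← Matrix.mulVec_injective_iff_isUnit]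
  intro x y hxy
  exact sub_eq_zero.1 (hM (x - y) (by rw [Matrix.mulVec_sub, sub_eq_zero]; exact hxy))

lemma mulVec_inv_mulVec {B : Type} [Fintype B] {_ : DecidableEq B} {M : Matrix B B ℝ}
    (hM : IsUnit M.det) (w : B → ℝ) : M *ᵥ (M⁻¹ *ᵥ w) = w := by
  rw [Matrix.mulVec_mulVec, Matrix.mul_nonsing_inv _ hM, Matrix.one_mulVec]

/-- On a fine mesh and for a step size which is small compared to the mesh width, the matrices of
the finite element discretization are stable. -/
lemma exists_isStableSystem (r : ℕ) {k : ℕ} (hk : 1 ≤ k) (Ω : Set (Space (r + 1)))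
    (hΩ : interior (closure Ω) = Ω) {α κ : Space (r + 1) → ℝ}
    (hα : IsCoefficient (volume.restrict Ω) α) (hκ : IsCoefficient (surfaceMeasure Ω) κ) (σ : ℝ) :
    ∃ h₀ > (0 : ℝ), ∃ c > (0 : ℝ), h₀ ≤ 1 ∧ c ≤ 1 ∧
      ∀ 𝒯 𝒯Γ : Finset (Finset (Space (r + 1))), IsTriangulation 𝒯 (r + 1) (closure Ω) →
        QuasiUniform σ 𝒯 → IsBoundaryRefinement Ω 𝒯 𝒯Γ →
      ∀ (N : ℕ) (ψ : Fin N → Space (r + 1) → ℝ), IsSurfaceBasis Ω 𝒯Γ ψ →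
      ∀ τ > (0 : ℝ), meshWidth 𝒯 ≤ h₀ → τ ≤ c * meshWidth 𝒯 →
        IsStableSystem (assemble Ω α κ 𝒯 𝒯Γ k ψ) τ := by
  obtain ⟨hαm, a₀, a, ha₀, hαb⟩ := hα
  set a₁ := |a| with ha₁
  have hα0 : ∀ᵐ x ∂(volume.restrict Ω), 0 ≤ α x := hαb.mono fun x hx => by linarith
  have hα1 : ∀ᵐ x ∂(volume.restrict Ω), α x ≤ a₁ := hαb.mono fun x hx => hx.2.trans (le_abs_self a)
  obtain ⟨c₀, hc₀, hc⟩ := exists_refLagrange_bound r hk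
  set ωd := (volume : Measure (Space (r + 1))).real (Metric.ball 0 1) with hωd
  set ωr := (volume : Measure (Space r)).real (Metric.ball 0 1) with hωr
  have hωr0 : 0 < ωr :=
    ENNReal.toReal_pos (Metric.measure_ball_pos _ _ one_pos).ne' measure_ball_lt_top.ne
  set m₁ : ℝ := (((r + 1 + 1).multichoose k : ℕ) : ℝ) with hm₁
  -- `A₀` is the constant of the lower bound for the boundary mass; the mass of an extension by zero is at
  -- most `c₁ h` times the boundary mass, and its stiffness is at most `c₂ / h` times the boundary mass
  set A₀ : ℝ := |σ| ^ r / ωr * ((volume : Measure (Space r)).real (refSimplex r) * c₀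
    * ((r + 1).multichoose k : ℕ)) with hA₀
  have hA₀0 : 0 ≤ A₀ := by positivity
  set c₁ : ℝ := m₁ * ((k : ℝ) ^ k) ^ 2 * ωd * A₀ with hc₁
  set c₂ : ℝ := a₁ * m₁ * ((k : ℝ) ^ (k + 2) * σ) ^ 2 * ωd * A₀ with hc₂
  have hc₁0 : 0 ≤ c₁ := by positivity
  have hc₂0 : 0 ≤ c₂ := by positivity
  refine ⟨1 / (1 + 10000 * c₁), by positivity, 1 / (1 + 10000 * c₂), by positivity,
    (div_le_one (by positivity)).2 (by linarith), (div_le_one (by positivity)).2 (by linarith), ?_⟩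
  intro 𝒯 𝒯Γ hT hqu hB N ψ hψ τ hτ hh₀ hτc
  have hh : 0 < meshWidth 𝒯 := by
    by_contra! h
    have : 1 / (1 + 10000 * c₂) * meshWidth 𝒯 ≤ 0 :=
      mul_nonpos_of_nonneg_of_nonpos (by positivity) h
    linarith
  have hσ0 := hqu.pos hh
  set h := meshWidth 𝒯 with hh_def
  set S := assemble Ω α κ 𝒯 𝒯Γ k ψ with hS
  -- the lower bound for the boundary mass matrix
  have hlow : ∀ w, h ^ r * ∑ i, (w i) ^ 2 ≤ A₀ * normSq S.Mlam w := by
    intro w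
    have h1 := hB.sum_sq_le hT hk hσ0 hh hqu hc₀ hc α κ ψ w
    rw [← hωr, ← hh_def, div_pow, ← hS] at h1
    have h2 := mul_le_mul_of_nonneg_left h1 (by positivity : 0 ≤ σ ^ r / ωr)
    rw [hA₀, abs_of_pos hσ0]
    calc _ = σ ^ r / ωr * (h ^ r / σ ^ r * ωr * ∑ i, (w i) ^ 2) := by field_simp
      _ ≤ _ := h2
      _ = _ := by ring
  have hpos : ∀ w, 0 ≤ normSq S.Mlam w := fun w => by
    rw [hS, hB.normSq_Mlam hT]
    exact integral_nonneg fun x => sq_nonneg _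
  have hinj : ∀ w, S.Mlam *ᵥ w = 0 → w = 0 := by
    intro w hw
    have h1 := hlow w
    rw [normSq, hw, dotProduct_zero, mul_zero] at h1
    have h2 : ∑ i, (w i) ^ 2 ≤ 0 := by
      by_contra! h3
      have : 0 < h ^ r * ∑ i, (w i) ^ 2 := by positivity
      linarith
    have h3 := (Finset.sum_eq_zero_iff_of_nonneg fun i _ => sq_nonneg (w i)).1
      (le_antisymm h2 (Finset.sum_nonneg fun i _ => sq_nonneg (w i)))
    funext i
    simpa using h3 i (Finset.mem_univ i)
  refine
    { mu := hT.posSemidef_mass hΩ α κ 𝒯Γ ψ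
      ku := hT.posSemidef_stiffness hΩ hk hh hqu hαm hα0 hα1 κ 𝒯Γ ψ
      mp := hB.posSemidef_Mp hT hψ α κ
      kp := hB.posSemidef_Kp hψ α hκ
      mlam_symm := transpose_Mlam α κ
      mlam_unit := isUnit_det_of_mulVec_eq_zero hinj
      bu := hB.Bu_mulVec hT hk α κ
      mass_extension := fun w => ?_
      stiffness_extension := fun w => ?_
      projection := fun q => hB.normSq_projection_le hT hψ α κ
        (mulVec_inv_mulVec (isUnit_det_of_mulVec_eq_zero hinj) _) }
  · have h1 := hT.normSq_mass_le hΩ hk hh.le α κ 𝒯Γ ψ (Sum.elim 0 w)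
    rw [sum_sq_extension, ← hS, ← hh_def, ← hωd, ← hm₁] at h1
    have h2 : normSq S.Mu (Sum.elim 0 w) ≤ c₁ * h * normSq S.Mlam w := by
      refine h1.trans ?_
      calc _ = m₁ * ((k : ℝ) ^ k) ^ 2 * ωd * h * (h ^ r * ∑ i, (w i) ^ 2) := by ring
        _ ≤ m₁ * ((k : ℝ) ^ k) ^ 2 * ωd * h * (A₀ * normSq S.Mlam w) := by
            gcongr ?_ * ?_
            exact hlow w
        _ = _ := by rw [hc₁]; ring
    have h3 : 10000 * c₁ * h ≤ 1 := by
      rw [le_div_iff₀ (by positivity)] at hh₀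
      nlinarith
    calc 10000 * normSq S.Mu (Sum.elim 0 w) ≤ 10000 * (c₁ * h * normSq S.Mlam w) := by gcongr
      _ = 10000 * c₁ * h * normSq S.Mlam w := by ring
      _ ≤ _ := mul_le_of_le_one_left (hpos w) h3
  · have h1 := hT.normSq_stiffness_le hΩ hk hh hqu hαm (abs_nonneg a) hα0 hα1 κ 𝒯Γ ψ
      (Sum.elim 0 w)
    rw [sum_sq_extension, ← hS, ← hh_def, ← hωd, ← hm₁, ← ha₁] at h1
    have h2 : normSq S.Ku (Sum.elim 0 w) ≤ c₂ / h * normSq S.Mlam w := by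
      refine h1.trans ?_
      calc _ = a₁ * m₁ * ((k : ℝ) ^ (k + 2) * σ) ^ 2 * ωd / h * (h ^ r * ∑ i, (w i) ^ 2) := by
            rw [pow_succ h r]; field_simp
        _ ≤ a₁ * m₁ * ((k : ℝ) ^ (k + 2) * σ) ^ 2 * ωd / h * (A₀ * normSq S.Mlam w) := by
            gcongr ?_ * ?_
            exact hlow w
        _ = _ := by rw [hc₂]; ring
    have h3 : 10000 * τ * (c₂ / h) ≤ 1 := by
      have h4 : τ * (1 + 10000 * c₂) ≤ h := by
        rw [one_div_mul_eq_div, le_div_iff₀ (by positivity)] at hτc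
        exact hτc
      rw [mul_div_assoc', div_le_one hh]
      nlinarith
    calc 10000 * τ * normSq S.Ku (Sum.elim 0 w)
        ≤ 10000 * τ * (c₂ / h * normSq S.Mlam w) := by gcongr
      _ = 10000 * τ * (c₂ / h) * normSq S.Mlam w := by ring
      _ ≤ _ := mul_le_of_le_one_left (hpos w) h3

end Stability

end BulkSurface

theorem mainTheorem3 (d : ℕ) (hd : d = 2 ∨ d = 3) (k : ℕ) (hk : 1 ≤ k)
    (Ω : Set (BulkSurface.Space d)) (hΩ : interior (closure Ω) = Ω)
    (α κ : BulkSurface.Space d → ℝ)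
    (hα : BulkSurface.IsCoefficient (volume.restrict Ω) α)
    (hκ : BulkSurface.IsCoefficient (BulkSurface.surfaceMeasure Ω) κ)
    (σ : ℝ) :
    ∃ h₀ > (0 : ℝ), ∃ c > (0 : ℝ), ∀ T > (0 : ℝ), ∀ R C₀ : ℝ, ∃ C : ℝ,
      ∀ 𝒯 𝒯Γ : Finset (Finset (BulkSurface.Space d)),
        BulkSurface.IsTriangulation 𝒯 d (closure Ω) →
        BulkSurface.QuasiUniform σ 𝒯 →
        BulkSurface.IsBoundaryRefinement Ω 𝒯 𝒯Γ →
      ∀ (N : ℕ) (ψ : Fin N → BulkSurface.Space d → ℝ),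
        BulkSurface.IsSurfaceBasis Ω 𝒯Γ ψ →
      ∀ S, S = BulkSurface.assemble Ω α κ 𝒯 𝒯Γ k ψ →
      ∀ τ > (0 : ℝ), BulkSurface.meshWidth 𝒯 ≤ h₀ → τ ≤ c * BulkSurface.meshWidth 𝒯 →
      ∀ fu fp u p lam,
        BulkSurface.IsSemidiscreteSolution S (-2 * τ) T fu fp u p lam →
        BulkSurface.IsRegular S (-2 * τ) T R u p →
      ∀ uhat phat lamhat,
        BulkSurface.IsAuxiliarySolution S τ T fu fp uhat phat lamhat →
        (∀ j : ℤ, -2 ≤ j → j ≤ 0 →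
          BulkSurface.normSq S.Mu (uhat j - u (j * τ))
            + τ * BulkSurface.normSq S.Ku (uhat j - u (j * τ))
            + BulkSurface.normSq S.Mp (phat j - p (j * τ))
            + τ * BulkSurface.normSq S.Kp (phat j - p (j * τ)) ≤ C₀ * τ ^ 4) →
      ∀ n : ℤ, -2 ≤ n → n * τ ≤ T →
        BulkSurface.normSq S.Ku (uhat n - u (n * τ))
          + BulkSurface.normSq S.Kp (phat n - p (n * τ)) ≤ C * τ ^ 3 := by
  obtain ⟨r, rfl⟩ : ∃ r, d = r + 1 := ⟨d - 1, by omega⟩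
  obtain ⟨h₀, hh₀, c, hc, hh₀1, hc1, hstable⟩ :=
    BulkSurface.exists_isStableSystem r hk Ω hΩ hα hκ σ
  refine ⟨h₀, hh₀, c, hc, fun T hT R C₀ => ⟨270000 * Real.exp (2 * T) * R + 120 * C₀, ?_⟩⟩
  intro 𝒯 𝒯Γ h𝒯 hqu hB N ψ hψ S hS τ hτ hmesh hτc fu fp u p lam hsol hreg uhat phat lamhat haux
    hinit n hn hnT
  subst hS
  have hτ1 : τ ≤ 1 := by
    have h1 : c * BulkSurface.meshWidth 𝒯 ≤ c * 1 :=
      mul_le_mul_of_nonneg_left (hmesh.trans hh₀1) hc.le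
    linarith
  exact (hstable 𝒯 𝒯Γ h𝒯 hqu hB N ψ hψ τ hτ hmesh hτc).error_bound hτ hτ1 hT hsol hreg
    haux.consistent haux.step hinit n hn hnT
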